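/- Let $\eta_3\in(-2,2)$ and consider the system $$x_1'=x_2,\quad x_2'=x_3,\quad x_3'=x_4,\quad x_4'=-x_1+\eta_3x_3+x_1^2$$ in $\mathbb{R}^4$, with (local) flow $\varphi$ and first integral $H=\tfrac12x_1^2-\tfrac13x_1^3-\tfrac{\eta_3}{2}x_2^2+x_2x_4-\tfrac12x_3^2$. Put $S=\{x_2=0\}$ and $C=S\cap\{H=0\}$; let $v_1=\{x_1=x_2=x_3=0\}$, $v_2=\{x_1=\tfrac32,\ x_2=x_3=0\}$, and let $C_1,C_2,C_3,C_4\subset C$ be the subsets where respectively $x_1<0<x_3$; $x_1>0,\,x_3>0$; $x_1>0>x_3$; $x_1<0,\,x_3<0$. For a point $x$ let $\Pi(x)$, when it exists, be the first point of $S$ on the orbit $\{\varphi(t,x):t>0\}$. Let $W^u$ be the unstable manifold of the origin, whose local part (the points with backward orbit staying in a fixed ball about the origin and tending to the origin) is, over the disc $x_1^2+x_2^2<R^2$, the graph $x_3=a(x_1,x_2)$, $x_4=b(x_1,x_2)$ of functions $a,b$ analytic on this disc. Fix $0<r<R$, let $\sigma(\theta)=(x_1,x_2,a(x_1,x_2),b(x_1,x_2))$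 with $x_1=r\cos\theta$, $x_2=r\sin\theta$, and $D^u=\sigma((0,2\pi])$. Let $\Sigma^u_k=\Pi^k(D^u)$, $k\ge1$, be the set of $k$-th intersections with $S$, at positive times, of the orbits starting on $D^u$. Let $k\ge 1$ and let $q=(0,0,0,q_4)\in\Sigma^u_k\cap v_1$ with $q_4<0$ be a point where $W^u$ intersects $v_1$ transversely within $\{H=0\}$, that is, $T_qW^u+T_qv_1=T_q\{H=0\}$. Assume that the orbit of $q$ meets $D^u$ in exactly one point $p$, that $p\ne\sigma(\pi),\sigma(2\pi)$, and that the orbit of $q$ does not meet $v_1\cup v_2$ strictly between $p$ and $q$ (so its earlier intersections with $S$ are transverse). Then there are arbitrarily small open neighbourhoods $U$ of $q$ such that $$(\Sigma^u_k\cap U)\setminus\{q\}=\Sigma^{u,1}_k\cup\Sigma^{u,2}_k ,$$ where $\Sigma^{u,1}_k\subset C_1$ and $\Sigma^{u,2}_k\subset C_2$ are open arcs having $q$ as an end point. Moreover $\Pi$ is defined on both arcs, and the sets $\Sigma^{u,4}_{k+1}=\Pi(\Sigma^{u,1}_k)$ and $\Sigma^{u,3}_{k+1}=\Pi(\Sigma^{u,2}_k)$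 are open arcs with $$\Sigma^{u,4}_{k+1}\subset\Sigma^u_{k+1}\cap C_4,\qquad \Sigma^{u,3}_{k+1}\subset\Sigma^u_{k+1}\cap C_3,$$ and $q$ is a common end point of both. Here an open arc with end point $q$ is a set $\gamma((0,1))$ with $\gamma:[0,1]\to\mathbb{R}^4$ continuous and injective and $\gamma(0)=q$. -/

import Mathlib

open Set Filter Topology

noncomputable section

namespace Bifocal

/-- The phase space `ℝ⁴`; the coordinates `(x₁, x₂, x₃, x₄)` are `(x 0, x 1, x 2, x 3)`.
Only its topology and its differentiable structure matter below. -/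
abbrev Phase : Type := Fin 4 → ℝ

/-- The vector field `x₁' = x₂`, `x₂' = x₃`, `x₃' = x₄`, `x₄' = -x₁ + η₃ x₃ + x₁²`. -/
def vectorField (η : ℝ) (x : Phase) : Phase :=
  ![x 1, x 2, x 3, -x 0 + η * x 2 + x 0 ^ 2]

/-- The first integral
`H = x₁²/2 - x₁³/3 - (η₃/2) x₂² + x₂ x₄ - x₃²/2`. -/
def firstIntegral (η : ℝ) (x : Phase) : ℝ :=
  x 0 ^ 2 / 2 - x 0 ^ 3 / 3 - η / 2 * x 1 ^ 2 + x 1 * x 3 - x 2 ^ 2 / 2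

/-- `φ(t, x)` is defined and equal to `y`, for a time `t ≥ 0`. (Solutions may blow up in finite
time, so the flow is only a partial map.) -/
def FlowsTo (η t : ℝ) (x y : Phase) : Prop :=
  0 ≤ t ∧ ∃ γ : ℝ → Phase,
    IsIntegralCurveOn γ (fun _ => vectorField η) (Icc 0 t) ∧ γ 0 = x ∧ γ t = y

/-- `x` and `y` lie on the same orbit. -/
def SameOrbit (η : ℝ) (x y : Phase) : Prop :=
  ∃ t : ℝ, FlowsTo η t x y ∨ FlowsTo η t y x

/-! ### The cross section and the loop cylinder -/

/-- The cross section `S = {x₂ = 0}`. -/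
def crossSection : Set Phase := {x | x 1 = 0}

/-- The loop cylinder `C = S ∩ {H = 0}`. -/
def loopCylinder (η : ℝ) : Set Phase := crossSection ∩ {x | firstIntegral η x = 0}

/-- The vertical line `v₁ ⊂ S`. -/
def line1 : Set Phase := {x | x ∈ crossSection ∧ x 0 = 0 ∧ x 2 = 0}

/-- The vertical line `v₂ ⊂ S`. -/
def line2 : Set Phase := {x | x ∈ crossSection ∧ x 0 = 3 / 2 ∧ x 2 = 0}

def region1 (η : ℝ) : Set Phase := {x | x ∈ loopCylinder η ∧ x 0 < 0 ∧ 0 < x 2}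
def region2 (η : ℝ) : Set Phase := {x | x ∈ loopCylinder η ∧ 0 < x 0 ∧ 0 < x 2}
def region3 (η : ℝ) : Set Phase := {x | x ∈ loopCylinder η ∧ 0 < x 0 ∧ x 2 < 0}
def region4 (η : ℝ) : Set Phase := {x | x ∈ loopCylinder η ∧ x 0 < 0 ∧ x 2 < 0}

/-- `y = φ(τ, x)` is the first point of the orbit of `x` after `x` itself that lies on `S`:
`τ > 0`, `y ∈ S` and `φ(t, x) ∉ S` for `0 < t < τ`. For `x ∈ C` this says `y = Π(x)`, with `Π`
the Poincaré map. -/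
def FirstHit (η : ℝ) (x y : Phase) : Prop :=
  ∃ τ : ℝ, 0 < τ ∧ ∃ γ : ℝ → Phase,
    IsIntegralCurveOn γ (fun _ => vectorField η) (Icc 0 τ) ∧ γ 0 = x ∧ γ τ = y ∧
    y ∈ crossSection ∧ ∀ t ∈ Ioo 0 τ, γ t ∉ crossSection

/-- The image of a set under the (partially defined) map sending a point to its first
subsequent intersection with `S`. -/
def hitImage (η : ℝ) (A : Set Phase) : Set Phase := {y | ∃ x ∈ A, FirstHit η x y}

/-! ### The unstable manifold of the origin -/

/-- The local unstable manifold of the origin, relative to its `δ`-neighbourhood: the points whose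
backward orbit is defined for all negative times, stays in the neighbourhood and tends to the
origin. -/
def localUnstable (η δ : ℝ) : Set Phase :=
  {x | ∃ γ : ℝ → Phase, IsIntegralCurveOn γ (fun _ => vectorField η) (Iic 0) ∧ γ 0 = x ∧
    (∀ t ≤ 0, ‖γ t‖ < δ) ∧ Tendsto γ atBot (𝓝 0)}

/-- The part of the graph `x₃ = a(x₁, x₂)`, `x₄ = b(x₁, x₂)` over the disc `x₁² + x₂² < R²`. -/
def graphOver (a b : ℝ → ℝ → ℝ) (R : ℝ) : Set Phase :=
  {x | x 0 ^ 2 + x 1 ^ 2 < R ^ 2 ∧ x 2 = a (x 0) (x 1) ∧ x 3 = b (x 0) (x 1)}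

/-- `a` and `b` are the functions, analytic on the disc of radius `R`, whose graph over this disc
is the local unstable manifold of the origin. The set equality determines their values on the
disc. -/
structure IsLocalUnstableGraph (η δ R : ℝ) (a b : ℝ → ℝ → ℝ) : Prop where
  analytic_fst : AnalyticOnNhd ℝ (fun y : ℝ × ℝ => a y.1 y.2) {y | y.1 ^ 2 + y.2 ^ 2 < R ^ 2}
  analytic_snd : AnalyticOnNhd ℝ (fun y : ℝ × ℝ => b y.1 y.2) {y | y.1 ^ 2 + y.2 ^ 2 < R ^ 2}
  eq_graph : localUnstable η δ ∩ {x | x 0 ^ 2 + x 1 ^ 2 < R ^ 2} = graphOver a b R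

/-- The tangent vectors at `q` of the (immersed) unstable manifold
`W^u = ⋃_{T ≥ 0} φ_T(W^u_loc)`: velocities at `q` of curves that run in a sheet `φ_T(W^u_loc)`,
for one time `T`. -/
def unstableTangent (η : ℝ) (a b : ℝ → ℝ → ℝ) (R : ℝ) (q : Phase) : Set Phase :=
  {v | ∃ T : ℝ, ∃ c : ℝ → Phase, c 0 = q ∧ HasDerivAt c v 0 ∧
    ∀ᶠ s in 𝓝 (0 : ℝ), ∃ x ∈ graphOver a b R, FlowsTo η T x (c s)}

/-- `W^u` and the line `v₁` (with direction `(0,0,0,1)`) intersect transversely at `q`, inside the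
three-dimensional level set of `H` that contains them:
`T_q W^u + T_q v₁ = T_q {H = 0} = ker dH(q)`. -/
def TransverseToLine1 (η : ℝ) (a b : ℝ → ℝ → ℝ) (R : ℝ) (q : Phase) : Prop :=
  Submodule.span ℝ (unstableTangent η a b R q) ⊔ Submodule.span ℝ {![0, 0, 0, 1]} =
    LinearMap.ker (fderiv ℝ (firstIntegral η) q).toLinearMap

/-! ### The closed curve `D^u` and its successive intersections with `S` -/

/-- The parametrization `σ(θ) = (x₁, x₂, a(x₁, x₂), b(x₁, x₂))`, `x₁ = r cos θ`, `x₂ = r sin θ`. -/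
def sigma (a b : ℝ → ℝ → ℝ) (r θ : ℝ) : Phase :=
  ![r * Real.cos θ, r * Real.sin θ,
    a (r * Real.cos θ) (r * Real.sin θ), b (r * Real.cos θ) (r * Real.sin θ)]

/-- `D^{u,+}`. -/
def domainPlus (a b : ℝ → ℝ → ℝ) (r : ℝ) : Set Phase := sigma a b r '' Ioc 0 Real.pi

/-- `D^{u,-}`. -/
def domainMinus (a b : ℝ → ℝ → ℝ) (r : ℝ) : Set Phase :=
  sigma a b r '' Ioc Real.pi (2 * Real.pi)

/-- `D^u = D^{u,+} ∪ D^{u,-}`. -/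
def domain (a b : ℝ → ℝ → ℝ) (r : ℝ) : Set Phase := domainPlus a b r ∪ domainMinus a b r

/-- The `k`-th intersections with `S` of the forward orbits starting on `D` (`D` itself for
`k = 0`). -/
def iteratedHit (η : ℝ) (D : Set Phase) : ℕ → Set Phase
  | 0 => D
  | k + 1 => hitImage η (iteratedHit η D k)

/-- `Σ^u_k = Σ^{u,+}_k ∪ Σ^{u,-}_k`, for `k ≥ 1`. -/
def SigmaU (η : ℝ) (a b : ℝ → ℝ → ℝ) (r : ℝ) (k : ℕ) : Set Phase :=
  iteratedHit η (domainPlus a b r) k ∪ iteratedHit η (domainMinus a b r) k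

/-- `A` is an open arc having `q` as an end point: there is a simple arc `γ : [0,1] → ℝ⁴` starting
at `q` such that `A` is `γ` without its two end points. -/
def IsOpenArcFrom (q : Phase) (A : Set Phase) : Prop :=
  ∃ γ : ℝ → Phase, ContinuousOn γ (Icc 0 1) ∧ InjOn γ (Icc 0 1) ∧ γ 0 = q ∧ A = γ '' Ioo 0 1

end Bifocal

end

/-! ### Global solutions of globally Lipschitz vector fields -/

section GlobalODE

/-! At `q` the orbit touches `S`: there `x₂ = x₃ = 0` and `x₂'' = x₄ = q₄ < 0`, so on a short time
window around `0` the coordinate `x₂` is strictly concave along every orbit starting near `q`. A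
nearby point of `S` with `x₃ > 0` starts an excursion to `x₂ > 0` that soon returns to `S` with `x₃
< 0`; a nearby point of `S` with `x₃ < 0` has just ended such an excursion.

Since `dH(q) = q₄ dx₂`, transversality makes the sheet of `W^u` through `q` a graph over the `(x₁,
x₃)`-plane (`exists_sheet`). On this sheet `H = 0`, and because `q₄ ≠ 0` the equation `x₂ = 0` is
equivalent there to `x₁²/2 - x₁³/3 = x₃²/2` (`eventually_coord_one_eq_zero`). So the sheet meets `S`
in `q` and four branches over `x₃ = ±x₁√(1 - 2x₁/3)`. The two branches with `x₃ > 0` are the arcs in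
`C₁` and `C₂`; `Π` carries them to arcs with `x₃ < 0`. By `exists_poincare` the return time is
continuous and vanishes at `q`, while `x₁` does not decrease and grows by at most `x₃/4`, too little
to change its sign on either arc.

It remains to see that `Σ^u_k` near `q` is exactly the part `x₃ ≥ 0` of this intersection
(`eventually_mem_SigmaU_iff`). A `k`-th intersection is one whose past, after leaving `D^u`,
contains exactly `k` zeros of `x₂`. The zeros before the tangency are simple, so their number is
stable under `C¹`-small perturbations; the part of the window up to time `0` adds one zero if `x₃ ≥
0` and at least two if `x₃ < 0`. A nearby point could still descend from `D^u` after a much longer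
time. Oscillation excludes this: for `η ∈ (-2, 2)` the second coordinate takes both signs
arbitrarily early on the backward orbit of `q` (`exists_lt_coord_one_pos`), so too long a past
contains more than `k` zeros. Within bounded time, nearby orbits can meet `D^u` only near the time
at which the orbit of `q` does.

Solutions may blow up, so nearby orbits are followed with the complete flow of a field truncated in
`x₁`, which agrees with the given one along the backward orbit of `q`. -/

/-- Grönwall's inequality, in both time directions. -/
theorem norm_le_gronwallBound_uIcc {E : Type*} [NormedAddCommGroup E] [NormedSpace ℝ E]
    {z z' : ℝ → E} {K ε s t : ℝ}
    (hz : ∀ τ ∈ uIcc s t, HasDerivWithinAt z (z' τ) (uIcc s t) τ)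
    (hb : ∀ τ ∈ uIcc s t, ‖z' τ‖ ≤ K * ‖z τ‖ + ε) :
    ‖z t‖ ≤ gronwallBound ‖z s‖ K ε |t - s| := by
  rcases le_total s t with h | h
  · rw [uIcc_of_le h] at hz hb
    rw [abs_of_nonneg (by linarith)]
    refine norm_le_gronwallBound_of_norm_deriv_right_le (f' := z')
      (fun τ hτ => (hz τ hτ).continuousWithinAt) (fun τ hτ => ?_) le_rfl
      (fun τ hτ => hb τ (Ico_subset_Icc_self hτ)) t (right_mem_Icc.2 h)
    exact ((hz τ (Ico_subset_Icc_self hτ)).mono_of_mem_nhdsWithin (Icc_mem_nhdsGE_of_mem hτ))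
  · rw [uIcc_of_ge h] at hz hb
    rw [abs_of_nonpos (by linarith)]
    have key : ∀ τ ∈ Icc (-s) (-t), HasDerivWithinAt (fun u => z (-u)) (-z' (-τ))
        (Icc (-s) (-t)) τ := by
      intro τ hτ
      have h1 := (hz (-τ) ⟨by linarith [hτ.2], by linarith [hτ.1]⟩).scomp (s := Icc (-s) (-t)) τ
        ((hasDerivAt_neg τ).hasDerivWithinAt)
        (fun u hu => ⟨by linarith [hu.2], by linarith [hu.1]⟩)
      simpa [Function.comp_def] using h1
    have := norm_le_gronwallBound_of_norm_deriv_right_le (f := fun u => z (-u))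
      (f' := fun u => -z' (-u)) (K := K) (ε := ε) (δ := ‖z s‖)
      (fun τ hτ => (key τ hτ).continuousWithinAt)
      (fun τ hτ => ((key τ (Ico_subset_Icc_self hτ)).mono_of_mem_nhdsWithin
        (Icc_mem_nhdsGE_of_mem hτ)))
      (by simp) (fun τ hτ => by
        rw [norm_neg]; exact hb (-τ) ⟨by linarith [hτ.2], by linarith [hτ.1]⟩)
      (-t) (right_mem_Icc.2 (by linarith))
    simpa [neg_add_eq_sub, add_comm, sub_eq_add_neg] using this

/-- Truncation of a real number to `[-M, M]`. -/
def clampReal (M a : ℝ) : ℝ := max (-M) (min M a)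

theorem abs_clampReal_sub_le (M a b : ℝ) : |clampReal M a - clampReal M b| ≤ |a - b| := by
  unfold clampReal
  refine (abs_max_sub_max_le_max _ _ _ _).trans (max_le (by simp) ?_)
  exact (abs_min_sub_min_le_max _ _ _ _).trans (max_le (by simp) le_rfl)

theorem abs_clampReal_le {M : ℝ} (hM : 0 ≤ M) (a : ℝ) : |clampReal M a| ≤ M := by
  unfold clampReal
  rw [abs_le]
  exact ⟨le_max_left _ _, max_le (by linarith) (min_le_left _ _)⟩

theorem clampReal_of_abs_le {M a : ℝ} (h : |a| ≤ M) : clampReal M a = a := by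
  rw [abs_le] at h
  rw [clampReal, min_eq_right h.2, max_eq_right h.1]

theorem abs_clampReal_le_abs {M : ℝ} (hM : 0 ≤ M) (a : ℝ) : |clampReal M a| ≤ |a| := by
  have := abs_clampReal_sub_le M a 0
  rwa [clampReal_of_abs_le (a := 0) (by simpa using hM), sub_zero, sub_zero] at this

/-- A vector field that is globally Lipschitz in space has solutions on compact intervals. -/
theorem exists_integralCurveOn_Icc {ι : Type*} [Fintype ι] {f : ℝ → (ι → ℝ) → (ι → ℝ)}
    {K : NNReal} (hf : ∀ t, LipschitzWith K (f t)) (hc : ∀ x, Continuous fun t => f t x)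
    (x₀ : ι → ℝ) {N : ℝ} (hN : 0 ≤ N) :
    ∃ α : ℝ → (ι → ℝ), α 0 = x₀ ∧ IsIntegralCurveOn α f (Icc (-N) N) := by
  obtain ⟨C, hC⟩ := (isCompact_Icc (a := -N) (b := N)).exists_bound_of_continuousOn
    (hc 0).continuousOn
  have hC0 : 0 ≤ C := (norm_nonneg _).trans (hC 0 ⟨by linarith, hN⟩)
  -- A priori bound. Cutting the coordinates off at `M` bounds the field, so Picard–Lindelöf applies
  -- on all of `[-N, N]`; the cut-off does not enlarge the norm, so the Grönwall estimate still
  -- holds and shows that the cut-off never acts.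
  set M : ℝ := gronwallBound ‖x₀‖ K C N with hM
  have hM0 : 0 ≤ M := by
    have := gronwallBound_mono (norm_nonneg x₀) hC0 K.2 hN
    rw [gronwallBound_x0] at this
    exact (norm_nonneg _).trans this
  let r : (ι → ℝ) → (ι → ℝ) := fun x i => clampReal M (x i)
  have hr1 : LipschitzWith 1 r := by
    refine LipschitzWith.of_dist_le_mul fun x y => ?_
    rw [NNReal.coe_one, one_mul, dist_pi_le_iff dist_nonneg]
    intro i
    exact (abs_clampReal_sub_le M (x i) (y i)).trans (dist_le_pi_dist x y i)
  have hrM : ∀ x, ‖r x‖ ≤ M := fun x => (pi_norm_le_iff_of_nonneg hM0).2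
    fun i => abs_clampReal_le hM0 _
  have hrn : ∀ x, ‖r x‖ ≤ ‖x‖ := fun x => (pi_norm_le_iff_of_nonneg (norm_nonneg _)).2
    fun i => (abs_clampReal_le_abs hM0 _).trans (norm_le_pi_norm x i)
  have hrid : ∀ x, ‖x‖ ≤ M → r x = x := fun x hx => funext fun i =>
    clampReal_of_abs_le ((norm_le_pi_norm x i).trans hx)
  have hgrow : ∀ t ∈ Icc (-N) N, ∀ x, ‖f t x‖ ≤ K * ‖x‖ + C := by
    intro t ht x
    have h1 := (hf t).dist_le_mul x 0
    rw [dist_eq_norm, dist_zero_right] at h1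
    have h2 := norm_le_norm_add_norm_sub' (f t x) (f t 0)
    linarith [hC t ht]
  have hL0 : 0 ≤ K * M + C := by positivity
  have hPL : IsPicardLindelof (fun t x => f t (r x)) (tmin := -N) (tmax := N)
      ⟨0, by linarith, hN⟩ x₀ (⟨K * M + C, hL0⟩ * ⟨N, hN⟩) 0 ⟨K * M + C, hL0⟩ K := by
    refine ⟨fun t _ => ?_, fun x _ => (hc _).continuousOn, fun t ht x _ => ?_, ?_⟩
    · have := ((hf t).comp hr1).lipschitzOnWith (s := Metric.closedBall x₀
        ((⟨K * M + C, hL0⟩ * ⟨N, hN⟩ : NNReal) : ℝ))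
      rw [mul_one] at this
      exact this
    · refine (hgrow t ht _).trans ?_
      change _ ≤ K * M + C
      have := hrM x
      gcongr
    · simp only [sub_zero, zero_sub, neg_neg, max_self, NNReal.coe_zero]
      exact le_rfl
  obtain ⟨α, h0, hα⟩ := hPL.exists_eq_forall_mem_Icc_hasDerivWithinAt₀
  refine ⟨α, h0, fun t ht => ?_⟩
  have hαM : ∀ t ∈ Icc (-N) N, ‖α t‖ ≤ M := by
    intro t ht
    have hsub : uIcc 0 t ⊆ Icc (-N) N := uIcc_subset_Icc ⟨by linarith, hN⟩ ht
    have := norm_le_gronwallBound_uIcc (z := α) (s := 0) (t := t) (K := K) (ε := C)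
      (fun τ hτ => (hα τ (hsub hτ)).mono hsub)
      (fun τ hτ => (hgrow τ (hsub hτ) _).trans (by have := hrn (α τ); gcongr))
    have h0' : α 0 = x₀ := h0
    rw [h0', sub_zero] at this
    exact this.trans (gronwallBound_mono (norm_nonneg _) hC0 K.2 (abs_le.2 ht))
  have := hα t ht
  simp only [hrid _ (hαM t ht)] at this
  exact this

/-- A vector field that is globally Lipschitz in space is complete. -/
theorem exists_integralCurve {ι : Type*} [Fintype ι] {f : ℝ → (ι → ℝ) → (ι → ℝ)}
    {K : NNReal} (hf : ∀ t, LipschitzWith K (f t)) (hc : ∀ x, Continuous fun t => f t x)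
    (x₀ : ι → ℝ) : ∃ α : ℝ → (ι → ℝ), α 0 = x₀ ∧ IsIntegralCurve α f := by
  choose α h0 hα using fun n : ℕ => exists_integralCurveOn_Icc hf hc x₀ (Nat.cast_nonneg n)
  have huniq : ∀ m n : ℕ, m ≤ n → EqOn (α m) (α n) (Ioo (-(m : ℝ)) m) := by
    intro m n hmn
    have hmn' : (m : ℝ) ≤ n := by exact_mod_cast hmn
    rcases Nat.eq_zero_or_pos m with rfl | hm
    · intro t ht; simp at ht
    have hm' : (0 : ℝ) < m := by exact_mod_cast hm
    refine ODE_solution_unique_of_mem_Ioo (v := f) (s := fun _ => univ) (K := K) (t₀ := 0)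
      (fun t _ => (hf t).lipschitzOnWith) ⟨by linarith, hm'⟩
      (fun t ht => ⟨(hα m t (Ioo_subset_Icc_self ht)).hasDerivAt (Icc_mem_nhds ht.1 ht.2),
        mem_univ _⟩) (fun t ht => ⟨(hα n t ⟨by linarith [ht.1], by linarith [ht.2]⟩).hasDerivAt
        (Icc_mem_nhds (by linarith [ht.1]) (by linarith [ht.2])), mem_univ _⟩) ?_
    rw [h0, h0]
  refine ⟨fun t => α (⌈|t|⌉₊ + 1) t, by simp [h0], fun t => ?_⟩
  -- Times `s` near `t` may have `⌈|s|⌉₊ = ⌈|t|⌉₊ + 1`; index `+ 2` dominates every solution used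
  -- there.
  set n := ⌈|t|⌉₊ + 2 with hn
  have hlt : ∀ s : ℝ, |s| < ⌈|s|⌉₊ + 1 := fun s => by
    have := Nat.le_ceil |s|
    linarith
  have heq : (fun t => α (⌈|t|⌉₊ + 1) t) =ᶠ[𝓝 t] α n := by
    have : ∀ᶠ s in 𝓝 t, |s| < |t| + 1 :=
      continuous_abs.continuousAt.eventually_lt continuousAt_const (by linarith)
    filter_upwards [this] with s hs
    refine huniq _ _ ?_ ?_
    · have : ⌈|s|⌉₊ ≤ ⌈|t|⌉₊ + 1 := by
        rw [Nat.ceil_le]; push_cast; linarith [Nat.le_ceil |t|]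
      omega
    · have := abs_lt.1 (hlt s)
      push_cast
      exact this
  have hd : HasDerivAt (α n) (f t (α n t)) t := by
    have h1 := abs_lt.1 (hlt t)
    refine (hα n t ?_).hasDerivAt (Icc_mem_nhds ?_ ?_)
    · rw [hn]; push_cast; exact ⟨by linarith, by linarith⟩
    · rw [hn]; push_cast; linarith
    · rw [hn]; push_cast; linarith
  rw [← heq.eq_of_nhds] at hd
  exact hd.congr_of_eventuallyEq heq

end GlobalODE

/-! ### The truncated system, its flow, and differentiability in the initial point -/

namespace Bifocal

/-- The vector field with the quadratic term truncated, so that it is globally Lipschitz. -/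
noncomputable def modField (η M : ℝ) (x : Phase) : Phase :=
  ![x 1, x 2, x 3, -x 0 + η * x 2 + clampReal |M| (x 0) ^ 2]

/-- A Lipschitz constant of the truncated vector field. -/
noncomputable def modConst (η M : ℝ) : NNReal := ⟨1 + |η| + 2 * |M|, by positivity⟩

/-- Gives the variational equation along an orbit the same Lipschitz constant as the truncated
field; there `c` is twice the truncated `x₁`. -/
theorem norm_linear_companion_le {c η C : ℝ} (hc : |c| ≤ C) (v : Phase) :
    ‖(![v 1, v 2, v 3, -v 0 + η * v 2 + c * v 0] : Phase)‖ ≤ (1 + |η| + C) * ‖v‖ := by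
  have hC : 0 ≤ C := (abs_nonneg _).trans hc
  have h := norm_le_pi_norm v
  simp only [Real.norm_eq_abs] at h
  have h1 : ∀ i, |v i| ≤ (1 + |η| + C) * ‖v‖ := fun i => by
    have := h i
    nlinarith [norm_nonneg v, abs_nonneg η]
  refine (pi_norm_le_iff_of_nonneg (by positivity)).2 fun i => ?_
  fin_cases i
  · exact h1 1
  · exact h1 2
  · exact h1 3
  · change |-v 0 + η * v 2 + c * v 0| ≤ _
    have e1 : |η * v 2| ≤ |η| * ‖v‖ := by rw [abs_mul]; gcongr; exact h 2
    have e2 : |c * v 0| ≤ C * ‖v‖ := by rw [abs_mul]; gcongr; exact h 0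
    have e3 := abs_add_le (-v 0 + η * v 2) (c * v 0)
    have e4 := abs_add_le (-v 0) (η * v 2)
    rw [abs_neg] at e4
    have := h 0
    linarith

theorem lipschitzWith_modField (η M : ℝ) : LipschitzWith (modConst η M) (modField η M) := by
  refine LipschitzWith.of_dist_le_mul fun x y => ?_
  rw [dist_eq_norm, dist_eq_norm]
  have hM := abs_nonneg M
  have hx := abs_clampReal_le hM (x 0)
  have hy := abs_clampReal_le hM (y 0)
  have hxy := abs_clampReal_sub_le |M| (x 0) (y 0)
  have h := norm_le_pi_norm (x - y)
  simp only [Real.norm_eq_abs, Pi.sub_apply] at h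
  set N := ‖x - y‖
  have hN : 0 ≤ N := norm_nonneg _
  change _ ≤ (1 + |η| + 2 * |M|) * N
  have h1 : ∀ i, |x i - y i| ≤ (1 + |η| + 2 * |M|) * N := fun i => by
    have := h i
    nlinarith [abs_nonneg η]
  refine (pi_norm_le_iff_of_nonneg (by positivity)).2 fun i => ?_
  fin_cases i
  · exact h1 1
  · exact h1 2
  · exact h1 3
  · change |(-x 0 + η * x 2 + clampReal |M| (x 0) ^ 2) -
      (-y 0 + η * y 2 + clampReal |M| (y 0) ^ 2)| ≤ _
    set a := clampReal |M| (x 0)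
    set b := clampReal |M| (y 0)
    have e0 : (-x 0 + η * x 2 + a ^ 2) - (-y 0 + η * y 2 + b ^ 2) =
        -(x 0 - y 0) + η * (x 2 - y 2) + (a + b) * (a - b) := by ring
    rw [e0]
    have e1 : |η * (x 2 - y 2)| ≤ |η| * N := by rw [abs_mul]; gcongr; exact h 2
    have e2 : |(a + b) * (a - b)| ≤ (2 * |M|) * N := by
      rw [abs_mul]
      have := abs_add_le a b
      have := h 0
      gcongr <;> linarith
    have e3 := abs_add_le (-(x 0 - y 0) + η * (x 2 - y 2)) ((a + b) * (a - b))
    have e4 := abs_add_le (-(x 0 - y 0)) (η * (x 2 - y 2))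
    rw [abs_neg] at e4
    have := h 0
    linarith

theorem modField_eq_vectorField (η : ℝ) {M : ℝ} {x : Phase} (hx : |x 0| ≤ |M|) :
    modField η M x = vectorField η x := by
  rw [modField, vectorField, clampReal_of_abs_le hx]

/-- The flow of the truncated vector field. -/
noncomputable def flow (η M : ℝ) (x : Phase) : ℝ → Phase :=
  Classical.choose (exists_integralCurve (f := fun _ => modField η M) (K := modConst η M)
    (fun _ => lipschitzWith_modField η M) (fun _ => continuous_const) x)

variable {η M : ℝ}

@[simp] theorem flow_zero (x : Phase) : flow η M x 0 = x :=
  (Classical.choose_spec (exists_integralCurve (f := fun _ => modField η M) (K := modConst η M)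
    (fun _ => lipschitzWith_modField η M) (fun _ => continuous_const) x)).1

theorem hasDerivAt_flow (x : Phase) (t : ℝ) :
    HasDerivAt (flow η M x) (modField η M (flow η M x t)) t :=
  (Classical.choose_spec (exists_integralCurve (f := fun _ => modField η M) (K := modConst η M)
    (fun _ => lipschitzWith_modField η M) (fun _ => continuous_const) x)).2 t

theorem norm_sub_le_of_modField {γ₁ γ₂ : ℝ → Phase} {s t : ℝ}
    (h₁ : IsIntegralCurveOn γ₁ (fun _ => modField η M) (uIcc s t))
    (h₂ : IsIntegralCurveOn γ₂ (fun _ => modField η M) (uIcc s t)) :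
    ‖γ₁ t - γ₂ t‖ ≤ ‖γ₁ s - γ₂ s‖ * Real.exp (modConst η M * |t - s|) := by
  rw [← gronwallBound_ε0]
  refine norm_le_gronwallBound_uIcc (z := fun t => γ₁ t - γ₂ t)
    (fun τ hτ => (h₁ τ hτ).sub (h₂ τ hτ)) fun τ _ => ?_
  have := (lipschitzWith_modField η M).dist_le_mul (γ₁ τ) (γ₂ τ)
  rw [dist_eq_norm, dist_eq_norm] at this
  simpa using this

theorem eqOn_of_modField {γ₁ γ₂ : ℝ → Phase} {S : Set ℝ} (hS : S.OrdConnected) {s : ℝ}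
    (hs : s ∈ S) (h₁ : IsIntegralCurveOn γ₁ (fun _ => modField η M) S)
    (h₂ : IsIntegralCurveOn γ₂ (fun _ => modField η M) S) (h : γ₁ s = γ₂ s) :
    EqOn γ₁ γ₂ S := by
  intro t ht
  have := norm_sub_le_of_modField (h₁.mono (hS.uIcc_subset hs ht))
    (h₂.mono (hS.uIcc_subset hs ht))
  rw [h, sub_self, norm_zero, zero_mul] at this
  exact sub_eq_zero.1 (norm_le_zero_iff.1 this)

theorem isIntegralCurve_flow (x : Phase) : IsIntegralCurve (flow η M x) (fun _ => modField η M) :=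
  hasDerivAt_flow x

theorem flow_add (x : Phase) (s t : ℝ) : flow η M (flow η M x s) t = flow η M x (s + t) := by
  have h2 : IsIntegralCurve (fun t => flow η M x (s + t)) (fun _ => modField η M) := fun t => by
    have := (hasDerivAt_flow (η := η) (M := M) x (s + t)).scomp t ((hasDerivAt_id t).const_add s)
    rw [one_smul] at this
    exact this
  exact eqOn_of_modField (S := univ) ordConnected_univ (mem_univ 0)
    ((isIntegralCurve_flow _).isIntegralCurveOn _) (h2.isIntegralCurveOn _) (by simp) (mem_univ t)

theorem norm_flow_sub_flow_le (x y : Phase) (t : ℝ) :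
    ‖flow η M x t - flow η M y t‖ ≤ ‖x - y‖ * Real.exp (modConst η M * |t|) := by
  simpa using norm_sub_le_of_modField (s := 0) (t := t)
    ((isIntegralCurve_flow (η := η) (M := M) x).isIntegralCurveOn _)
    ((isIntegralCurve_flow y).isIntegralCurveOn _)

theorem continuous_flow_apply (x : Phase) : Continuous (flow η M x) :=
  (isIntegralCurve_flow x).continuous

theorem continuous_flow : Continuous fun p : Phase × ℝ => flow η M p.1 p.2 := by
  rw [continuous_iff_continuousAt]
  rintro ⟨x, t⟩
  have h1 : Tendsto (fun p : Phase × ℝ => flow η M x p.2) (𝓝 (x, t)) (𝓝 (flow η M x t)) :=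
    ((continuous_flow_apply x).comp continuous_snd).continuousAt
  have h2 : Tendsto (fun p : Phase × ℝ => flow η M p.1 p.2 - flow η M x p.2) (𝓝 (x, t))
      (𝓝 0) := by
    refine squeeze_zero_norm (fun p => norm_flow_sub_flow_le p.1 x p.2) ?_
    have : Continuous fun p : Phase × ℝ => ‖p.1 - x‖ * Real.exp (modConst η M * |p.2|) := by
      fun_prop
    simpa using this.tendsto (x, t)
  simpa [ContinuousAt] using h2.add h1

theorem isIntegralCurveOn_flow {x : Phase} {S : Set ℝ} (h : ∀ t ∈ S, |flow η M x t 0| ≤ |M|) :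
    IsIntegralCurveOn (flow η M x) (fun _ => vectorField η) S := fun t ht => by
  have := (hasDerivAt_flow (η := η) (M := M) x t).hasDerivWithinAt (s := S)
  rwa [modField_eq_vectorField η (h t ht)] at this

theorem isIntegralCurveOn_modField {γ : ℝ → Phase} {S : Set ℝ}
    (h : IsIntegralCurveOn γ (fun _ => vectorField η) S) (hM : ∀ t ∈ S, |γ t 0| ≤ |M|) :
    IsIntegralCurveOn γ (fun _ => modField η M) S := fun t ht => by
  have := h t ht
  simp only [← modField_eq_vectorField η (hM t ht)] at this
  exact this

/-- Uniqueness of solutions. -/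
theorem eqOn_of_vectorField {γ₁ γ₂ : ℝ → Phase} {S : Set ℝ} (hS : S.OrdConnected) {s : ℝ}
    (hs : s ∈ S) (h₁ : IsIntegralCurveOn γ₁ (fun _ => vectorField η) S)
    (h₂ : IsIntegralCurveOn γ₂ (fun _ => vectorField η) S) (h : γ₁ s = γ₂ s) :
    EqOn γ₁ γ₂ S := by
  intro t ht
  have hsub := hS.uIcc_subset hs ht
  obtain ⟨C₁, hC₁⟩ := isCompact_uIcc.exists_bound_of_continuousOn (h₁.mono hsub).continuousOn
  obtain ⟨C₂, hC₂⟩ := isCompact_uIcc.exists_bound_of_continuousOn (h₂.mono hsub).continuousOn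
  refine eqOn_of_modField (M := max C₁ C₂) (ordConnected_uIcc (a := s) (b := t)) left_mem_uIcc
    (isIntegralCurveOn_modField (h₁.mono hsub) fun τ hτ => ?_)
    (isIntegralCurveOn_modField (h₂.mono hsub) fun τ hτ => ?_) h right_mem_uIcc
  · exact ((norm_le_pi_norm _ 0).trans (hC₁ τ hτ)).trans
      ((le_max_left _ _).trans (le_abs_self _))
  · exact ((norm_le_pi_norm _ 0).trans (hC₂ τ hτ)).trans
      ((le_max_right _ _).trans (le_abs_self _))

theorem gronwallBound_zero_mul (K ε x : ℝ) :
    gronwallBound 0 K ε x = ε * gronwallBound 0 K 1 x := by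
  unfold gronwallBound
  split_ifs <;> ring

theorem gronwallBound_zero_one_nonneg {K x : ℝ} (hK : 0 ≤ K) (hx : 0 ≤ x) :
    0 ≤ gronwallBound 0 K 1 x := by
  simpa [gronwallBound_x0] using gronwallBound_mono le_rfl zero_le_one hK hx

/-- The time-`T` map is strictly differentiable at a point whose orbit stays where the vector
field is not truncated. -/
theorem exists_hasStrictFDerivAt_flow {q : Phase} {T : ℝ}
    (hq : ∀ t ∈ uIcc 0 T, |flow η M q t 0| < |M|) :
    ∃ D : Phase →L[ℝ] Phase, HasStrictFDerivAt (fun x => flow η M x T) D q := by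
  let c : ℝ → ℝ := fun t => 2 * clampReal |M| (flow η M q t 0)
  have hcM : ∀ t, |c t| ≤ 2 * |M| := fun t => by
    rw [abs_mul, abs_two]
    exact mul_le_mul_of_nonneg_left (abs_clampReal_le (abs_nonneg _) _) zero_le_two
  have hcc : Continuous c := by
    have := continuous_flow_apply (η := η) (M := M) q
    unfold c clampReal
    fun_prop
  -- The vector field linearised along the orbit of `q`; the derivative `D` below has as columns the
  -- solutions at time `T` of this variational equation.
  let A : ℝ → Phase → Phase := fun t v => ![v 1, v 2, v 3, -v 0 + η * v 2 + c t * v 0]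
  have hAsub : ∀ t v w, A t (v - w) = A t v - A t w := fun t v w => by
    ext i; fin_cases i <;> simp [A]; ring
  have hAnorm : ∀ t v, ‖A t v‖ ≤ modConst η M * ‖v‖ := fun t v =>
    norm_linear_companion_le (hcM t) v
  have hALip : ∀ t, LipschitzWith (modConst η M) (A t) := fun t =>
    LipschitzWith.of_dist_le_mul fun v w => by
      rw [dist_eq_norm, dist_eq_norm, ← hAsub]; exact hAnorm t _
  have hAcont : ∀ v, Continuous fun t => A t v := fun v => by
    refine continuous_pi fun i => ?_
    fin_cases i <;> simp [A] <;> fun_prop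
  choose V hV0 hV using fun i : Fin 4 => exists_integralCurve hALip hAcont (Pi.single i 1)
  have hAsum : ∀ t (w : Phase), ∑ i, w i • A t (V i t) = A t (∑ i, w i • V i t) := fun t w => by
    ext i; fin_cases i <;> simp [A, Fin.sum_univ_four] <;> ring
  let D : Phase →L[ℝ] Phase := ∑ i, (ContinuousLinearMap.proj i).smulRight (V i T)
  have hD : ∀ w, D w = ∑ i, w i • V i T := fun w => by simp [D]
  refine ⟨D, ?_⟩
  rw [hasStrictFDerivAt_iff_isLittleO, Asymptotics.isLittleO_iff]
  intro ε hε
  set G := gronwallBound 0 (modConst η M) 1 |T|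
  have hG : 0 ≤ G := gronwallBound_zero_one_nonneg (modConst η M).2 (abs_nonneg _)
  set E := Real.exp (modConst η M * |T|)
  have hE : 0 < E := Real.exp_pos _
  have hEt : ∀ t ∈ uIcc 0 T, ∀ x y : Phase, ‖flow η M x t - flow η M y t‖ ≤ ‖x - y‖ * E := by
    intro t ht x y
    refine (norm_flow_sub_flow_le x y t).trans ?_
    refine mul_le_mul_of_nonneg_left (Real.exp_le_exp.2 (mul_le_mul_of_nonneg_left ?_
      (modConst η M).2)) (norm_nonneg _)
    rcases le_total 0 T with h | h
    · rw [uIcc_of_le h] at ht; rw [abs_of_nonneg h, abs_of_nonneg ht.1]; exact ht.2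
    · rw [uIcc_of_ge h] at ht; rw [abs_of_nonpos h, abs_of_nonpos ht.2]; linarith [ht.1]
  obtain ⟨m, hm, hmM⟩ : ∃ m > 0, ∀ t ∈ uIcc 0 T, |flow η M q t 0| + m ≤ |M| := by
    obtain ⟨t₀, ht₀, hmax⟩ := isCompact_uIcc.exists_isMaxOn (nonempty_uIcc (a := (0 : ℝ)) (b := T))
      (f := fun t => |flow η M q t 0|) (by
        have := continuous_flow_apply (η := η) (M := M) q
        fun_prop)
    refine ⟨|M| - |flow η M q t₀ 0|, by linarith [hq t₀ ht₀], fun t ht => ?_⟩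
    have : |flow η M q t 0| ≤ |flow η M q t₀ 0| := hmax ht
    linarith
  -- The first bound keeps orbits starting in the `ρ`-ball where the field is not truncated; the
  -- second makes the final Grönwall error at most `ε * ‖x - y‖`.
  set ρ := min (m / E) (ε / (2 * E * E * (G + 1)))
  have hρ : 0 < ρ := by positivity
  have hρ1 : ρ * E ≤ m := by
    have := min_le_left (m / E) (ε / (2 * E * E * (G + 1)))
    rwa [le_div_iff₀ hE] at this
  have hρ2 : 2 * E * E * ρ * (G + 1) ≤ ε := by
    have := min_le_right (m / E) (ε / (2 * E * E * (G + 1)))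
    rw [le_div_iff₀ (by positivity)] at this
    linarith
  have hnear : ∀ᶠ p : Phase × Phase in 𝓝 (q, q), ‖p.1 - q‖ < ρ ∧ ‖p.2 - q‖ < ρ := by
    have h1 : Continuous fun p : Phase × Phase => ‖p.1 - q‖ := by fun_prop
    have h2 : Continuous fun p : Phase × Phase => ‖p.2 - q‖ := by fun_prop
    exact (h1.continuousAt.eventually_lt continuousAt_const (by simpa)).and
      (h2.continuousAt.eventually_lt continuousAt_const (by simpa))
  filter_upwards [hnear] with ⟨x, y⟩ ⟨hx, hy⟩
  simp only at hx hy ⊢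
  let z : ℝ → Phase := fun t => flow η M x t - flow η M y t - ∑ i, (x - y) i • V i t
  have hz : ∀ t, HasDerivAt z (modField η M (flow η M x t) - modField η M (flow η M y t) -
      ∑ i, (x - y) i • A t (V i t)) t := fun t =>
    ((hasDerivAt_flow x t).sub (hasDerivAt_flow y t)).sub
      (HasDerivAt.fun_sum fun i _ => (hV i t).fun_const_smul _)
  have hz0 : z 0 = 0 := by
    ext i
    fin_cases i <;> simp [z, hV0, Fin.sum_univ_four]
  have hbound : ∀ t ∈ uIcc 0 T, ‖modField η M (flow η M x t) - modField η M (flow η M y t) -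
      ∑ i, (x - y) i • A t (V i t)‖ ≤ modConst η M * ‖z t‖ + 2 * E * E * ρ * ‖x - y‖ := by
    intro t ht
    set X := flow η M x t
    set Y := flow η M y t
    set Q := flow η M q t with hQ
    have hXQ : ‖X - Q‖ ≤ ρ * E := (hEt t ht x q).trans (by gcongr)
    have hYQ : ‖Y - Q‖ ≤ ρ * E := (hEt t ht y q).trans (by gcongr)
    have hX0 : |X 0 - Q 0| ≤ ρ * E := (norm_le_pi_norm (X - Q) 0).trans hXQ
    have hY0 : |Y 0 - Q 0| ≤ ρ * E := (norm_le_pi_norm (Y - Q) 0).trans hYQ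
    have hXY : |X 0 - Y 0| ≤ ‖x - y‖ * E := (norm_le_pi_norm (X - Y) 0).trans (hEt t ht x y)
    have hQM := hmM t ht
    have hXM : |X 0| ≤ |M| := by have := abs_sub_abs_le_abs_sub (X 0) (Q 0); linarith
    have hYM : |Y 0| ≤ |M| := by have := abs_sub_abs_le_abs_sub (Y 0) (Q 0); linarith
    rw [hAsum]
    -- The field is quadratic, so the remainder is exact: `X₀² - Y₀² - 2Q₀(X₀ - Y₀) = (X₀ + Y₀ -
    -- 2Q₀)(X₀ - Y₀)`. Both factors are controlled, which yields strict differentiability.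
    have hid : modField η M X - modField η M Y - A t (∑ i, (x - y) i • V i t) =
        A t (z t) + Pi.single 3 ((X 0 + Y 0 - 2 * Q 0) * (X 0 - Y 0)) := by
      have hzt : ∑ i, (x - y) i • V i t = X - Y - z t := by simp [z, X, Y]
      rw [hzt, hAsub, hAsub, modField_eq_vectorField η hXM, modField_eq_vectorField η hYM]
      have hct : c t = 2 * Q 0 := by
        simp only [c]
        rw [clampReal_of_abs_le (by rw [← hQ]; linarith)]
      ext i
      fin_cases i <;> simp [A, vectorField, hct]
      ring
    rw [hid]
    refine (norm_add_le _ _).trans (add_le_add (hAnorm t _) ?_)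
    rw [Pi.norm_single, Real.norm_eq_abs, abs_mul]
    have : |X 0 + Y 0 - 2 * Q 0| ≤ 2 * (ρ * E) := by
      have := abs_add_le (X 0 - Q 0) (Y 0 - Q 0)
      have e : X 0 + Y 0 - 2 * Q 0 = (X 0 - Q 0) + (Y 0 - Q 0) := by ring
      rw [e]; linarith
    calc _ ≤ 2 * (ρ * E) * (‖x - y‖ * E) := by gcongr
      _ = _ := by ring
  have := norm_le_gronwallBound_uIcc (z := z) (s := 0) (t := T)
    (fun τ _ => (hz τ).hasDerivWithinAt) hbound
  rw [hz0, norm_zero, gronwallBound_zero_mul, sub_zero] at this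
  rw [hD]
  refine this.trans ?_
  have : 2 * E * E * ρ * ‖x - y‖ * G = (2 * E * E * ρ * G) * ‖x - y‖ := by ring
  rw [show gronwallBound 0 (modConst η M) 1 |T| = G from rfl, this]
  gcongr
  have : 0 ≤ 2 * E * E * ρ := by positivity
  linarith

end Bifocal

/-! ### Oscillation of `x₂` on orbits emanating from the origin -/

namespace Bifocal

variable {η : ℝ}

theorem hasDerivAt_coords {γ : ℝ → Phase} {t : ℝ} (h : HasDerivAt γ (vectorField η (γ t)) t) :
    HasDerivAt (fun s => γ s 0) (γ t 1) t ∧ HasDerivAt (fun s => γ s 1) (γ t 2) t ∧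
    HasDerivAt (fun s => γ s 2) (γ t 3) t ∧
    HasDerivAt (fun s => γ s 3) (-γ t 0 + η * γ t 2 + γ t 0 ^ 2) t := by
  rw [hasDerivAt_pi] at h
  exact ⟨h 0, h 1, h 2, h 3⟩

/-- A Sturm-type inequality for the oscillator `f'' + 2κf' + f` with `κ² + β² = 1`, over half
a period. -/
theorem add_exp_mul_le_of_oscillator {κ β : ℝ} (hκ : κ ^ 2 + β ^ 2 = 1) (hβ : 0 < β)
    {f f₁ f₂ : ℝ → ℝ} {t G : ℝ} (hG : 0 ≤ G)
    (hf : ∀ s ∈ Icc t (t + Real.pi / β), HasDerivAt f (f₁ s) s)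
    (hf₁ : ∀ s ∈ Icc t (t + Real.pi / β), HasDerivAt f₁ (f₂ s) s)
    (hle : ∀ s ∈ Icc t (t + Real.pi / β), f₂ s + 2 * κ * f₁ s + f s ≤ G) :
    f t + Real.exp (κ * (Real.pi / β)) * f (t + Real.pi / β) ≤
      Real.exp (|κ| * (Real.pi / β)) * (Real.pi / β) / β * G := by
  set ω := Real.pi / β with hω
  have hω0 : 0 < ω := by positivity
  have hβω : β * ω = Real.pi := by rw [hω]; field_simp
  -- Wronskian with a solution of the adjoint oscillator: its derivative is `f'' + 2κf' + f` times a
  -- weight that is nonnegative over half a period, and its end values are multiples of the two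
  -- values of `f` to be compared.
  let φ : ℝ → ℝ := fun s => Real.exp (κ * (s - t)) *
    ((f₁ s + κ * f s) * Real.sin (β * (s - t)) - β * f s * Real.cos (β * (s - t)))
  have hφ : ∀ s ∈ Icc t (t + ω), HasDerivAt φ (Real.exp (κ * (s - t)) * Real.sin (β * (s - t)) *
      (f₂ s + 2 * κ * f₁ s + f s)) s := by
    intro s hs
    have hl : HasDerivAt (fun s => s - t) 1 s := (hasDerivAt_id s).sub_const t
    have h1 := (hl.const_mul κ).exp
    have h2 := (hl.const_mul β).sin
    have h3 := (hl.const_mul β).cos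
    have h4 := h1.mul ((((hf₁ s hs).add ((hf s hs).const_mul κ)).mul h2).sub
      (((hf s hs).const_mul β).mul h3))
    refine h4.congr_deriv ?_
    have : β ^ 2 = 1 - κ ^ 2 := by linarith
    simp only [Pi.add_apply, Pi.sub_apply, Pi.mul_apply]
    linear_combination (Real.exp (κ * (s - t)) * Real.sin (β * (s - t)) * f s) * this
  have hder : ∀ s ∈ interior (Icc t (t + ω)), deriv φ s ≤ Real.exp (|κ| * ω) * G := by
    intro s hs
    rw [interior_Icc] at hs
    have hs' := Ioo_subset_Icc_self hs
    rw [(hφ s hs').deriv]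
    have hsin : 0 ≤ Real.sin (β * (s - t)) := Real.sin_nonneg_of_nonneg_of_le_pi
      (mul_nonneg hβ.le (by linarith [hs.1])) (by
        rw [← hβω]; exact mul_le_mul_of_nonneg_left (by linarith [hs.2]) hβ.le)
    have hexp : Real.exp (κ * (s - t)) ≤ Real.exp (|κ| * ω) := Real.exp_le_exp.2 <| by
      have h0 : 0 ≤ s - t := by linarith [hs.1]
      calc κ * (s - t) ≤ |κ| * (s - t) := by gcongr; exact le_abs_self κ
        _ ≤ |κ| * ω := by gcongr; linarith [hs.2]
    calc _ ≤ Real.exp (κ * (s - t)) * Real.sin (β * (s - t)) * G :=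
          mul_le_mul_of_nonneg_left (hle s hs') (by positivity)
      _ ≤ Real.exp (|κ| * ω) * 1 * G := by
          gcongr
          exact Real.sin_le_one _
      _ = _ := by ring
  have hmv := (convex_Icc t (t + ω)).image_sub_le_mul_sub_of_deriv_le
    (fun s hs => (hφ s hs).continuousAt.continuousWithinAt)
    (fun s hs => (hφ s (interior_subset hs)).differentiableAt.differentiableWithinAt) hder
    t (left_mem_Icc.2 (by linarith)) (t + ω) (right_mem_Icc.2 (by linarith)) (by linarith)
  have e1 : φ t = -(β * f t) := by simp [φ]
  have e2 : φ (t + ω) = Real.exp (κ * ω) * (β * f (t + ω)) := by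
    simp [φ, hβω]
  rw [e1, e2, add_sub_cancel_left] at hmv
  have : Real.exp (|κ| * ω) * ω / β * G = Real.exp (|κ| * ω) * G * ω / β := by ring
  rw [this, le_div_iff₀ hβ]
  linarith

/-- A solution that tends to the origin backward in time and whose second coordinate eventually
has a constant sign is trivial. -/
theorem eq_zero_of_eventually_signed (hη : η ∈ Ioo (-2 : ℝ) 2) {γ : ℝ → Phase}
    (hγ : IsIntegralCurveOn γ (fun _ => vectorField η) (Iic 0)) (hlim : Tendsto γ atBot (𝓝 0))
    {σ : ℝ} (hσ : σ ^ 2 = 1) {T : ℝ} (hT : T ≤ 0) (hs : ∀ t < T, 0 ≤ σ * γ t 1) : γ 0 = 0 := by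
  obtain ⟨hη1, hη2⟩ := hη
  -- The linear part `u'''' - ηu'' + u` factors through `λ⁴ - ηλ² + 1 = (λ² + 2αλ + 1)(λ² - 2αλ +
  -- 1)`, where `α² + β² = 1` and `β > 0`: two oscillators with the same half period.
  set α := Real.sqrt (2 + η) / 2 with hα
  set β := Real.sqrt (2 - η) / 2 with hβ
  have hα2 : 4 * α ^ 2 = 2 + η := by
    rw [hα, div_pow, Real.sq_sqrt (by linarith)]; ring
  have hβ2 : 4 * β ^ 2 = 2 - η := by
    rw [hβ, div_pow, Real.sq_sqrt (by linarith)]; ring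
  have hβ0 : 0 < β := by
    have := Real.sqrt_pos.2 (show 0 < 2 - η by linarith)
    positivity
  set ω := Real.pi / β with hω
  have hω0 : 0 < ω := by positivity
  have hσ1 : |σ| = 1 := by
    have := sq_abs σ
    rw [hσ] at this
    nlinarith [abs_nonneg σ]
  have hd : ∀ t < 0, HasDerivAt γ (vectorField η (γ t)) t := fun t ht =>
    (hγ t ht.le).hasDerivAt (Iic_mem_nhds ht)
  have h0 := fun t ht => (hasDerivAt_coords (hd t ht)).1
  have h1 := fun t ht => (hasDerivAt_coords (hd t ht)).2.1
  have h2 := fun t ht => (hasDerivAt_coords (hd t ht)).2.2.1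
  have h3 := fun t ht => (hasDerivAt_coords (hd t ht)).2.2.2
  let U : ℝ → ℝ := fun t => σ * γ t 0
  have hmono : MonotoneOn U (Iio T) := by
    refine monotoneOn_of_deriv_nonneg (convex_Iio T)
      (fun t ht => ((h0 t (lt_of_lt_of_le ht hT)).const_mul σ).continuousAt.continuousWithinAt)
      (fun t ht => ?_) fun t ht => ?_
    · rw [interior_Iio] at ht
      exact ((h0 t (lt_of_lt_of_le ht hT)).const_mul σ).differentiableAt.differentiableWithinAt
    · rw [interior_Iio] at ht
      rw [((h0 t (lt_of_lt_of_le ht hT)).const_mul σ).deriv]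
      exact hs t ht
  have hUlim : Tendsto U atBot (𝓝 0) := by
    have : Tendsto (fun t => γ t 0) atBot (𝓝 0) := (tendsto_pi_nhds.1 hlim) 0
    simpa using this.const_mul σ
  have hUnn : ∀ t < T, 0 ≤ U t := fun t ht =>
    le_of_tendsto hUlim (by
      filter_upwards [eventually_le_atBot t] with s hs
      exact hmono (lt_of_le_of_lt hs ht) ht hs)
  -- One factor applied to `U`; the other factor applied to `V` leaves only the quadratic term
  -- `σx₁²`.
  let V : ℝ → ℝ := fun t => σ * (γ t 2 + 2 * α * γ t 1 + γ t 0)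
  set C := Real.exp (|α| * ω) * ω / β with hC
  have hC0 : 0 < C := by positivity
  have hV : ∀ t, t + ω < T → V t + Real.exp (-α * ω) * V (t + ω) ≤ C * U (t + ω) ^ 2 := by
    intro t ht
    have := add_exp_mul_le_of_oscillator (κ := -α) (β := β) (by nlinarith) hβ0 (f := V)
      (f₁ := fun t => σ * (γ t 3 + 2 * α * γ t 2 + γ t 1))
      (f₂ := fun t => σ * ((-γ t 0 + η * γ t 2 + γ t 0 ^ 2) + 2 * α * γ t 3 + γ t 2))
      (t := t) (G := U (t + ω) ^ 2) (sq_nonneg _) ?_ ?_ ?_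
    · rwa [abs_neg] at this
    · intro s hs
      have hs0 : s < 0 := by linarith [hs.2]
      exact (((h2 s hs0).add ((h1 s hs0).const_mul (2 * α))).add (h0 s hs0)).const_mul σ
    · intro s hs
      have hs0 : s < 0 := by linarith [hs.2]
      exact (((h3 s hs0).add ((h2 s hs0).const_mul (2 * α))).add (h1 s hs0)).const_mul σ
    · intro s hs
      have hsT : s < T := by linarith [hs.2]
      have hUs : U s ≤ U (t + ω) := hmono hsT ht hs.2
      have e : σ * ((-γ s 0 + η * γ s 2 + γ s 0 ^ 2) + 2 * α * γ s 3 + γ s 2) +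
          2 * -α * (σ * (γ s 3 + 2 * α * γ s 2 + γ s 1)) + V s = σ * γ s 0 ^ 2 := by
        simp only [V]
        linear_combination (-σ * γ s 2) * hα2
      rw [e]
      calc σ * γ s 0 ^ 2 ≤ 1 * γ s 0 ^ 2 := by gcongr; rw [← hσ1]; exact le_abs_self σ
        _ = U s ^ 2 := by simp only [U]; rw [mul_pow, hσ]
        _ ≤ U (t + ω) ^ 2 := by have := hUnn s hsT; gcongr
  -- The second oscillator estimate is applied to `U + exp(-αω)U(· + ω)`, whose forcing was bounded
  -- by the first. The two exponential weights cancel in front of `U s`, and the other terms are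
  -- nonnegative.
  have hU : ∀ s < T, U s ≤ C ^ 2 * U s ^ 2 := by
    intro s hsT
    set t := s - 2 * ω with ht
    have := add_exp_mul_le_of_oscillator (κ := α) (β := β) (by nlinarith) hβ0
      (f := fun r => U r + Real.exp (-α * ω) * U (r + ω))
      (f₁ := fun r => σ * γ r 1 + Real.exp (-α * ω) * (σ * γ (r + ω) 1))
      (f₂ := fun r => σ * γ r 2 + Real.exp (-α * ω) * (σ * γ (r + ω) 2))
      (t := t) (G := C * U s ^ 2) (by positivity) ?_ ?_ ?_
    · have e1 : t + ω + ω = s := by rw [ht]; ring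
      rw [← hω, ← hC, e1] at this
      have e2 : Real.exp (α * ω) * Real.exp (-α * ω) = 1 := by
        rw [← Real.exp_add]; simp
      have p1 := hUnn t (by linarith)
      have p2 := hUnn (t + ω) (by linarith)
      have p3 : 0 ≤ Real.exp (-α * ω) * U (t + ω) := by positivity
      have p4 : 0 ≤ Real.exp (α * ω) * U (t + ω) := by positivity
      have e3 : Real.exp (α * ω) * (U (t + ω) + Real.exp (-α * ω) * U s) =
        Real.exp (α * ω) * U (t + ω) + U s := by linear_combination U s * e2
      rw [e3] at this
      nlinarith
    · intro r hr
      have hr0 : r < 0 := by linarith [hr.2]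
      have hr1 : r + ω < 0 := by linarith [hr.2]
      exact ((h0 r hr0).const_mul σ).add
        ((((h0 _ hr1).comp_add_const r ω).const_mul σ).const_mul _)
    · intro r hr
      have hr0 : r < 0 := by linarith [hr.2]
      have hr1 : r + ω < 0 := by linarith [hr.2]
      exact ((h1 r hr0).const_mul σ).add
        ((((h1 _ hr1).comp_add_const r ω).const_mul σ).const_mul _)
    · intro r hr
      have hrT : r + ω < T := by linarith [hr.2]
      have := hV r hrT
      have hUs : U (r + ω) ≤ U s := hmono hrT hsT (by linarith [hr.2])
      have hU0 := hUnn _ hrT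
      have : C * U (r + ω) ^ 2 ≤ C * U s ^ 2 := by gcongr
      simp only [V, U] at *
      linarith
  -- Since `U → 0`, eventually `C²U < 1`, and then `0 ≤ U ≤ C²U²` leaves only `U = 0`.
  obtain ⟨T', hT'⟩ : ∃ T' ≤ T, ∀ t < T', U t = 0 := by
    have : ∀ᶠ t in atBot, U t < 1 / C ^ 2 := hUlim.eventually_lt_const (by positivity)
    obtain ⟨T₁, hT₁⟩ := eventually_atBot.1 this
    refine ⟨min T T₁, min_le_left _ _, fun t ht => ?_⟩
    have htT := lt_of_lt_of_le ht (min_le_left _ _)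
    have h1 := hT₁ t (le_of_lt (lt_of_lt_of_le ht (min_le_right _ _)))
    have h2 := hU t htT
    have h3 := hUnn t htT
    rw [lt_div_iff₀ (by positivity)] at h1
    by_contra hne
    have : 0 < U t := lt_of_le_of_ne h3 (Ne.symm hne)
    nlinarith
  obtain ⟨hT'T, hT'⟩ := hT'
  have hσ0 : σ ≠ 0 := by rintro rfl; norm_num at hσ
  have hzero : ∀ {f f' : ℝ → ℝ}, (∀ t < 0, HasDerivAt f (f' t) t) → (∀ t < T', f t = 0) →
      ∀ t < T', f' t = 0 := by
    intro f f' hf hf0 t ht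
    have e : f =ᶠ[𝓝 t] fun _ => 0 := by
      filter_upwards [Iio_mem_nhds ht] with s hs using hf0 s hs
    exact (hf t (by linarith)).unique ((hasDerivAt_const t (0 : ℝ)).congr_of_eventuallyEq e)
  have z0 : ∀ t < T', γ t 0 = 0 := fun t ht => by simpa [U, hσ0] using hT' t ht
  have z1 := hzero (f' := fun t => γ t 1) h0 z0
  have z2 := hzero (f' := fun t => γ t 2) h1 z1
  have z3 := hzero (f' := fun t => γ t 3) h2 z2
  have hz : γ (T' - 1) = 0 := by
    have : T' - 1 < T' := by linarith
    ext i
    fin_cases i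
    exacts [z0 _ this, z1 _ this, z2 _ this, z3 _ this]
  have hconst : IsIntegralCurveOn (fun _ => (0 : Phase)) (fun _ => vectorField η) (Iic 0) := by
    intro t _
    have : vectorField η 0 = 0 := by ext i; fin_cases i <;> simp [vectorField]
    simp only [this]
    exact hasDerivWithinAt_const _ _ _
  exact eqOn_of_vectorField ordConnected_Iic (s := T' - 1) (by simp; linarith) hγ hconst hz
    (by simp)

/-- A nontrivial solution tending to the origin backward in time has a second coordinate taking
both signs arbitrarily early. -/
theorem exists_lt_coord_one_pos (hη : η ∈ Ioo (-2 : ℝ) 2) {γ : ℝ → Phase}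
    (hγ : IsIntegralCurveOn γ (fun _ => vectorField η) (Iic 0)) (hlim : Tendsto γ atBot (𝓝 0))
    (h0 : γ 0 ≠ 0) (T : ℝ) : (∃ t < T, 0 < γ t 1) ∧ ∃ t < T, γ t 1 < 0 := by
  constructor
  · by_contra! h
    exact h0 (eq_zero_of_eventually_signed hη hγ hlim (σ := -1) (T := min T 0) (by norm_num)
      (min_le_right _ _) fun t ht => by linarith [h t (lt_of_lt_of_le ht (min_le_left _ _))])
  · by_contra! h
    exact h0 (eq_zero_of_eventually_signed hη hγ hlim (σ := 1) (T := min T 0) (by norm_num)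
      (min_le_right _ _) fun t ht => by linarith [h t (lt_of_lt_of_le ht (min_le_left _ _))])

end Bifocal

/-! ### Counting zeros of perturbed functions -/

section ZeroCount

/-- `h` is a `C¹`-perturbation of `g` on `[a, b]` of size less than `ε`. -/
def C1Close (g g' h h' : ℝ → ℝ) (a b ε : ℝ) : Prop :=
  ∀ t ∈ Icc a b, HasDerivAt h (h' t) t ∧ |h t - g t| < ε ∧ |h' t - g' t| < ε

theorem C1Close.mono {g g' h h' : ℝ → ℝ} {a b ε a' b' ε' : ℝ} (H : C1Close g g' h h' a b ε)
    (ha : a ≤ a') (hb : b' ≤ b) (hε : ε ≤ ε') : C1Close g g' h h' a' b' ε' := fun t ht =>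
  have := H t ⟨ha.trans ht.1, ht.2.trans hb⟩
  ⟨this.1, this.2.1.trans_le hε, this.2.2.trans_le hε⟩

theorem C1Close.neg {g g' h h' : ℝ → ℝ} {a b ε : ℝ} (H : C1Close g g' h h' a b ε) :
    C1Close (fun t => -g t) (fun t => -g' t) (fun t => -h t) (fun t => -h' t) a b ε :=
  fun t ht => by
    obtain ⟨h1, h2, h3⟩ := H t ht
    refine ⟨h1.neg, ?_, ?_⟩
    · rwa [neg_sub_neg, abs_sub_comm]
    · rwa [neg_sub_neg, abs_sub_comm]

/-- On a nonempty compact interval the minimum of `|g|` is positive and serves as `ε`. -/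
theorem exists_forall_C1Close_no_zeros {g g' : ℝ → ℝ} {a b : ℝ} (hg : ContinuousOn g (Icc a b))
    (h0 : ∀ t ∈ Icc a b, g t ≠ 0) :
    ∃ ε > 0, ∀ h h', C1Close g g' h h' a b ε → ∀ t ∈ Icc a b, h t ≠ 0 := by
  rcases (Icc a b).eq_empty_or_nonempty with he | hne
  · exact ⟨1, one_pos, fun h h' _ t ht => by simp [he] at ht⟩
  obtain ⟨t₀, ht₀, hmin⟩ := isCompact_Icc.exists_isMinOn hne hg.abs
  refine ⟨|g t₀|, abs_pos.2 (h0 t₀ ht₀), fun h h' H t ht hz => ?_⟩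
  have h1 : |g t₀| ≤ |g t| := hmin ht
  have h2 := (H t ht).2.1
  rw [hz, zero_sub, abs_neg] at h2
  linarith

/-- A perturbation smaller than the minimum of `g'` stays strictly increasing; if it also respects
the end values, it still changes sign. -/
theorem exists_forall_C1Close_unique_zero_of_pos {g g' : ℝ → ℝ} {c d : ℝ} (hcd : c < d)
    (hg' : ContinuousOn g' (Icc c d)) (hpos : ∀ t ∈ Icc c d, 0 < g' t) (hc : g c < 0)
    (hd : 0 < g d) :
    ∃ ε > 0, ∀ h h', C1Close g g' h h' c d ε → {t | t ∈ Icc c d ∧ h t = 0}.encard = 1 := by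
  obtain ⟨t₀, ht₀, hmin⟩ := isCompact_Icc.exists_isMinOn (nonempty_Icc.2 hcd.le) hg'
  refine ⟨min (g' t₀) (min (-g c) (g d)),
    lt_min (hpos t₀ ht₀) (lt_min (by linarith) hd), fun h h' H => ?_⟩
  have hcont : ContinuousOn h (Icc c d) := fun t ht => (H t ht).1.continuousAt.continuousWithinAt
  have hmono : StrictMonoOn h (Icc c d) := by
    refine strictMonoOn_of_deriv_pos (convex_Icc c d) hcont fun t ht => ?_
    have ht' := interior_subset ht
    rw [(H t ht').1.deriv]
    have h1 := (H t ht').2.2.trans_le (min_le_left _ _)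
    have h2 : g' t₀ ≤ g' t := hmin ht'
    linarith [(abs_lt.1 h1).1]
  have hhc : h c < 0 := by
    have h1 := (H c (left_mem_Icc.2 hcd.le)).2.1.trans_le ((min_le_right _ _).trans
      (min_le_left _ _))
    linarith [(abs_lt.1 h1).2]
  have hhd : 0 < h d := by
    have h1 := (H d (right_mem_Icc.2 hcd.le)).2.1.trans_le ((min_le_right _ _).trans
      (min_le_right _ _))
    linarith [(abs_lt.1 h1).1]
  obtain ⟨s, hs, hs0⟩ := intermediate_value_Icc hcd.le hcont ⟨hhc.le, hhd.le⟩
  rw [encard_eq_one]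
  refine ⟨s, ?_⟩
  ext t
  simp only [mem_ofPred_eq, mem_singleton_iff]
  exact ⟨fun ht => hmono.injOn ht.1 hs (ht.2.trans hs0.symm), fun ht => ht ▸ ⟨hs, hs0⟩⟩

theorem exists_forall_C1Close_unique_zero {g g' : ℝ → ℝ} {a b s : ℝ} (hs : s ∈ Ioo a b)
    (hg : ∀ t ∈ Icc a b, HasDerivAt g (g' t) t) (hg' : ContinuousOn g' (Icc a b))
    (hs0 : g s = 0) (hs' : g' s ≠ 0) :
    ∃ c d, a < c ∧ c < s ∧ s < d ∧ d < b ∧ (∀ t ∈ Icc c d, g t = 0 → t = s) ∧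
      ∃ ε > 0, ∀ h h', C1Close g g' h h' c d ε → {t | t ∈ Icc c d ∧ h t = 0}.encard = 1 := by
  wlog hpos : 0 < g' s generalizing g g'
  · have hneg : g' s < 0 := lt_of_le_of_ne (not_lt.1 hpos) hs'
    obtain ⟨c, d, h1, h2, h3, h4, h5, ε, hε, H⟩ := this (g := fun t => -g t)
      (g' := fun t => -g' t) (fun t ht => (hg t ht).neg) hg'.neg (by simp [hs0]) (by simpa)
      (by simpa)
    refine ⟨c, d, h1, h2, h3, h4, fun t ht h => h5 t ht (by simpa using h), ε, hε,
      fun h h' hh => ?_⟩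
    simpa using H _ _ hh.neg
  have hnear : ∀ᶠ t in 𝓝 s, 0 < g' t :=
    (hg'.continuousAt (Icc_mem_nhds hs.1 hs.2)).eventually_const_lt hpos
  obtain ⟨δ, hδ, hball⟩ := Metric.eventually_nhds_iff.1 hnear
  set c := max (s - δ / 2) ((a + s) / 2)
  set d := min (s + δ / 2) ((b + s) / 2)
  have hca : a < c := lt_of_lt_of_le (by linarith [hs.1]) (le_max_right _ _)
  have hcs : c < s := max_lt (by linarith) (by linarith [hs.1])
  have hsd : s < d := lt_min (by linarith) (by linarith [hs.2])
  have hdb : d < b := lt_of_le_of_lt (min_le_right _ _) (by linarith [hs.2])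
  have hsub : Icc c d ⊆ Icc a b := Icc_subset_Icc hca.le hdb.le
  have hp : ∀ t ∈ Icc c d, 0 < g' t := fun t ht => hball (by
    have h1 : s - δ / 2 ≤ c := le_max_left _ _
    have h2 : d ≤ s + δ / 2 := min_le_left _ _
    rw [Real.dist_eq, abs_lt]
    exact ⟨by linarith [ht.1], by linarith [ht.2]⟩)
  have hmono : StrictMonoOn g (Icc c d) :=
    strictMonoOn_of_deriv_pos (convex_Icc c d)
      (fun t ht => (hg t (hsub ht)).continuousAt.continuousWithinAt) fun t ht => by
        rw [(hg t (hsub (interior_subset ht))).deriv]; exact hp t (interior_subset ht)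
  have hsm : s ∈ Icc c d := ⟨hcs.le, hsd.le⟩
  refine ⟨c, d, hca, hcs, hsd, hdb, fun t ht h => hmono.injOn ht hsm (h.trans hs0.symm),
    exists_forall_C1Close_unique_zero_of_pos (hcs.trans hsd) (hg'.mono hsub) hp ?_ ?_⟩
  · rw [← hs0]; exact hmono (left_mem_Icc.2 (hcs.trans hsd).le) hsm hcs
  · rw [← hs0]; exact hmono hsm (right_mem_Icc.2 (hcs.trans hsd).le) hsd

theorem encard_zeros_Icc_add {h : ℝ → ℝ} {a b c : ℝ} (hab : a ≤ b) (hbc : b ≤ c) (hb : h b ≠ 0) :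
    {t | t ∈ Icc a c ∧ h t = 0}.encard =
      {t | t ∈ Icc a b ∧ h t = 0}.encard + {t | t ∈ Icc b c ∧ h t = 0}.encard := by
  rw [← encard_union_eq]
  · congr 1
    ext t
    simp only [mem_ofPred_eq, mem_union, mem_Icc]
    constructor
    · rintro ⟨⟨h1, h2⟩, h3⟩
      rcases le_total t b with h | h
      exacts [Or.inl ⟨⟨h1, h⟩, h3⟩, Or.inr ⟨⟨h, h2⟩, h3⟩]
    · rintro (⟨⟨h1, h2⟩, h3⟩ | ⟨⟨h1, h2⟩, h3⟩)
      exacts [⟨⟨h1, h2.trans hbc⟩, h3⟩, ⟨⟨hab.trans h1, h2⟩, h3⟩]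
  · rw [Set.disjoint_left]
    rintro t ⟨⟨_, h2⟩, h3⟩ ⟨⟨h4, _⟩, _⟩
    exact hb (le_antisymm h2 h4 ▸ h3)

/-- The number of simple zeros is stable under `C¹`-small perturbations. -/
theorem exists_forall_C1Close_encard_zeros_eq {g g' : ℝ → ℝ} {a : ℝ} (n : ℕ) :
    ∀ {b : ℝ}, (∀ t ∈ Icc a b, HasDerivAt g (g' t) t) → ContinuousOn g' (Icc a b) →
    g a ≠ 0 → g b ≠ 0 → (∀ t ∈ Icc a b, g t = 0 → g' t ≠ 0) →
    {t | t ∈ Icc a b ∧ g t = 0}.encard = n →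
    ∃ ε > 0, ∀ h h', C1Close g g' h h' a b ε →
      {t | t ∈ Icc a b ∧ h t = 0}.encard = n := by
  induction n with
  | zero =>
    intro b hg hg' ha hb hs hn
    rw [Nat.cast_zero, encard_eq_zero] at hn
    obtain ⟨ε, hε, H⟩ := exists_forall_C1Close_no_zeros (g := g) (g' := g') (a := a) (b := b)
      (fun t ht => (hg t ht).continuousAt.continuousWithinAt)
      (fun t ht h0 => by
        have : t ∈ {t | t ∈ Icc a b ∧ g t = 0} := ⟨ht, h0⟩
        rw [hn] at this; exact this)
    refine ⟨ε, hε, fun h h' hh => ?_⟩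
    rw [Nat.cast_zero, encard_eq_zero, eq_empty_iff_forall_notMem]
    rintro t ⟨ht, h0⟩
    exact H h h' hh t ht h0
  | succ n ih =>
    intro b hg hg' ha hb hs hn
    have hfin : {t | t ∈ Icc a b ∧ g t = 0}.Finite := by
      rw [← encard_lt_top_iff, hn]; exact ENat.natCast_lt_top _
    have hne : {t | t ∈ Icc a b ∧ g t = 0}.Nonempty := by
      rw [← encard_pos, hn]; simp
    -- Induction removes the last zero: `[c, d]` isolates it, `[d, b]` has no zeros, and `[a, c]`
    -- has `n`.
    obtain ⟨s, hsmax⟩ := hfin.exists_maximal hne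
    have hsI := hsmax.prop.1
    have hs0 : g s = 0 := hsmax.prop.2
    have hsmax' : ∀ t ∈ Icc a b, g t = 0 → t ≤ s := fun t ht h0 => by
      rcases le_total t s with h | h
      exacts [h, hsmax.le_of_ge ⟨ht, h0⟩ h]
    have hsO : s ∈ Ioo a b := ⟨lt_of_le_of_ne hsI.1 (by rintro rfl; exact ha hs0),
      lt_of_le_of_ne hsI.2 (by rintro rfl; exact hb hs0)⟩
    obtain ⟨c, d, hac, hcs, hsd, hdb, huniq, ε₂, hε₂, H₂⟩ :=
      exists_forall_C1Close_unique_zero hsO hg hg' hs0 (hs s hsI hs0)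
    have hgc : g c ≠ 0 := fun h => hcs.ne (huniq c ⟨le_rfl, (hcs.trans hsd).le⟩ h)
    have hgd : g d ≠ 0 := fun h => hsd.ne' (huniq d ⟨(hcs.trans hsd).le, le_rfl⟩ h)
    have hsub₁ : Icc a c ⊆ Icc a b := Icc_subset_Icc le_rfl (by linarith)
    have hsub₃ : Icc d b ⊆ Icc a b := Icc_subset_Icc (by linarith) le_rfl
    have hcount : {t | t ∈ Icc a c ∧ g t = 0}.encard = n := by
      have h1 : {t | t ∈ Icc a b ∧ g t = 0} = insert s {t | t ∈ Icc a c ∧ g t = 0} := by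
        ext t
        simp only [mem_ofPred_eq, mem_insert_iff, mem_Icc]
        constructor
        · rintro ⟨⟨h1, h2⟩, h3⟩
          rcases le_or_gt t c with h | h
          · exact Or.inr ⟨⟨h1, h⟩, h3⟩
          · exact Or.inl (huniq t ⟨h.le, (hsmax' t ⟨h1, h2⟩ h3).trans hsd.le⟩ h3)
        · rintro (rfl | ⟨⟨h1, h2⟩, h3⟩)
          exacts [⟨hsI, hs0⟩, ⟨⟨h1, by linarith⟩, h3⟩]
      rw [h1, encard_insert_of_notMem (by
        rintro ⟨⟨_, h2⟩, _⟩; linarith)] at hn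
      push_cast at hn
      exact ENat.add_left_injective_of_ne_top ENat.one_ne_top hn
    obtain ⟨ε₁, hε₁, H₁⟩ := ih (fun t ht => hg t (hsub₁ ht)) (hg'.mono hsub₁) ha hgc
      (fun t ht => hs t (hsub₁ ht)) hcount
    obtain ⟨ε₃, hε₃, H₃⟩ := exists_forall_C1Close_no_zeros (g := g) (g' := g') (a := d) (b := b)
      (fun t ht => (hg t (hsub₃ ht)).continuousAt.continuousWithinAt)
      (fun t ht h0 => by linarith [hsmax' t (hsub₃ ht) h0, ht.1])
    refine ⟨min ε₁ (min ε₂ (min ε₃ (min |g c| |g d|))), by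
      have := abs_pos.2 hgc
      have := abs_pos.2 hgd
      positivity, fun h h' hh => ?_⟩
    have hlt : ∀ t ∈ Icc a b, |h t - g t| < |g c| ∧ |h t - g t| < |g d| := fun t ht => by
      have := (hh t ht).2.1
      simp only [lt_min_iff] at this
      exact ⟨this.2.2.2.1, this.2.2.2.2⟩
    have hhc : h c ≠ 0 := fun h0 => by
      have := (hlt c ⟨hac.le, by linarith⟩).1
      rw [h0, zero_sub, abs_neg] at this
      exact lt_irrefl _ this
    have hhd : h d ≠ 0 := fun h0 => by
      have := (hlt d ⟨by linarith, hdb.le⟩).2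
      rw [h0, zero_sub, abs_neg] at this
      exact lt_irrefl _ this
    rw [encard_zeros_Icc_add hac.le (show c ≤ b by linarith) hhc,
      encard_zeros_Icc_add (hcs.trans hsd).le hdb.le hhd,
      H₁ h h' (hh.mono le_rfl (by linarith) (min_le_left _ _)),
      H₂ h h' (hh.mono hac.le hdb.le ((min_le_right _ _).trans (min_le_left _ _)))]
    have : {t | t ∈ Icc d b ∧ h t = 0} = ∅ := by
      rw [eq_empty_iff_forall_notMem]
      rintro t ⟨ht, h0⟩
      exact H₃ h h' (hh.mono (by linarith) le_rfl ((min_le_right _ _).trans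
        ((min_le_right _ _).trans (min_le_left _ _)))) t ht h0
    rw [this, encard_empty]
    push_cast
    rw [add_zero]

/-- A function taking both signs arbitrarily early has many zeros, and so do its uniform
perturbations. -/
theorem exists_forall_close_le_encard_zeros {g : ℝ → ℝ}
    (hosc : ∀ T : ℝ, (∃ t < T, 0 < g t) ∧ ∃ t < T, g t < 0) (n : ℕ) :
    ∃ N > 0, ∃ ε > 0, ∀ h : ℝ → ℝ, ContinuousOn h (Icc (-N) 0) →
      (∀ t ∈ Icc (-N) 0, |h t - g t| < ε) →
      (n : ℕ∞) ≤ {t | t ∈ Ioo (-N) 0 ∧ h t = 0}.encard := by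
  induction n with
  | zero => exact ⟨1, one_pos, 1, one_pos, fun h _ _ => by simp⟩
  | succ n ih =>
    obtain ⟨N, hN, ε, hε, H⟩ := ih
    obtain ⟨t₂, ht₂, hp⟩ := (hosc (-N)).1
    obtain ⟨t₁, ht₁, hm⟩ := (hosc t₂).2
    -- The sign change on `[t₁, t₂]` lies before the window of the induction hypothesis, so its zero
    -- is new; the `+ 1` puts it in the open interval.
    refine ⟨-t₁ + 1, by linarith, min ε (min (g t₂) (-g t₁)),
      lt_min hε (lt_min hp (by linarith)), fun h hc hh => ?_⟩
    have hsub : Icc (-N) 0 ⊆ Icc (-(-t₁ + 1)) 0 := Icc_subset_Icc (by linarith) le_rfl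
    have h1 := H h (hc.mono hsub) fun t ht => (hh t (hsub ht)).trans_le (min_le_left _ _)
    have e1 := (hh t₁ ⟨by linarith, by linarith⟩).trans_le
      ((min_le_right _ _).trans (min_le_right _ _))
    have e2 := (hh t₂ ⟨by linarith, by linarith⟩).trans_le
      ((min_le_right _ _).trans (min_le_left _ _))
    obtain ⟨z, hz, hz0⟩ := intermediate_value_Icc ht₁.le
      (hc.mono (Icc_subset_Icc (by linarith) (by linarith)))
      (show (0 : ℝ) ∈ Icc (h t₁) (h t₂) from
        ⟨by linarith [(abs_lt.1 e1).2], by linarith [(abs_lt.1 e2).1]⟩)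
    have hsub2 : insert z {t | t ∈ Ioo (-N) 0 ∧ h t = 0} ⊆
        {t | t ∈ Ioo (-(-t₁ + 1)) 0 ∧ h t = 0} := by
      rintro t (rfl | ⟨ht, h0⟩)
      · exact ⟨⟨by linarith [hz.1], by linarith [hz.2]⟩, hz0⟩
      · exact ⟨⟨by linarith [ht.1], ht.2⟩, h0⟩
    refine le_trans ?_ (encard_le_encard hsub2)
    rw [encard_insert_of_notMem (by rintro ⟨⟨h1, _⟩, _⟩; linarith [hz.2])]
    push_cast
    gcongr

end ZeroCount

/-! ### Shifting and gluing integral curves -/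

section Curves

variable {E : Type*} [NormedAddCommGroup E] [NormedSpace ℝ E] {f : E → E}

theorem IsIntegralCurveOn.shift {γ : ℝ → E} {S S' : Set ℝ} {d : ℝ}
    (h : IsIntegralCurveOn γ (fun _ => f) S) (hS : ∀ t ∈ S', t + d ∈ S) :
    IsIntegralCurveOn (fun t => γ (t + d)) (fun _ => f) S' := fun t ht => by
  have := (h (t + d) (hS t ht)).scomp t ((hasDerivWithinAt_id t S').add_const d) hS
  rw [one_smul] at this
  exact this

theorem IsIntegralCurveOn.concat {c₁ c₂ : ℝ → E} {A B : Set ℝ} {u : ℝ}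
    (h₁ : IsIntegralCurveOn c₁ (fun _ => f) A) (h₂ : IsIntegralCurveOn c₂ (fun _ => f) B)
    (hA : A ⊆ Iic u) (hB : B ⊆ Ici u) (huA : u ∈ A) (huB : u ∈ B) (hu : c₁ u = c₂ u) :
    IsIntegralCurveOn (fun t => if t ≤ u then c₁ t else c₂ t) (fun _ => f) (A ∪ B) := by
  have e₁ : EqOn (fun t => if t ≤ u then c₁ t else c₂ t) c₁ A := fun t ht => if_pos (hA ht)
  have e₂ : EqOn (fun t => if t ≤ u then c₁ t else c₂ t) c₂ B := fun t ht => by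
    have hut : u ≤ t := hB ht
    rcases hut.eq_or_lt with h | h
    · subst h; simp [hu]
    · exact if_neg (not_le.2 h)
  have d₁ : ∀ t ∈ A, HasDerivWithinAt (fun t => if t ≤ u then c₁ t else c₂ t) (f (c₁ t)) A t :=
    fun t ht => (h₁ t ht).congr e₁ (e₁ ht)
  have d₂ : ∀ t ∈ B, HasDerivWithinAt (fun t => if t ≤ u then c₁ t else c₂ t) (f (c₂ t)) B t :=
    fun t ht => (h₂ t ht).congr e₂ (e₂ ht)
  intro t ht
  change HasDerivWithinAt _ (f (if t ≤ u then c₁ t else c₂ t)) _ _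
  rcases lt_trichotomy t u with h | h | h
  · have htA : t ∈ A := ht.resolve_right fun hb => absurd (hB hb) (not_le.2 h)
    rw [if_pos h.le]
    refine (d₁ t htA).mono_of_mem_nhdsWithin ?_
    filter_upwards [self_mem_nhdsWithin, mem_nhdsWithin_of_mem_nhds (Iio_mem_nhds h)] with s hs hsu
    exact hs.resolve_right fun hb => absurd (show u ≤ s from hB hb) (not_le.2 hsu)
  · subst h
    rw [if_pos le_rfl]
    refine (d₁ t huA).union ?_
    have := d₂ t huB
    rwa [← hu] at this
  · have htB : t ∈ B := ht.resolve_left fun hb => absurd (hA hb) (not_le.2 h)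
    rw [if_neg (not_le.2 h)]
    refine (d₂ t htB).mono_of_mem_nhdsWithin ?_
    filter_upwards [self_mem_nhdsWithin, mem_nhdsWithin_of_mem_nhds (Ioi_mem_nhds h)] with s hs hsu
    exact hs.resolve_left fun hb => absurd (show s ≤ u from hA hb) (not_le.2 hsu)

end Curves

/-! ### The first integral, the local unstable manifold, and hits as zero counts -/

namespace Bifocal

variable {η δ R r : ℝ} {a b : ℝ → ℝ → ℝ}

theorem firstIntegral_eq_of_curve {γ : ℝ → Phase} {S : Set ℝ} (hS : S.OrdConnected)
    (h : IsIntegralCurveOn γ (fun _ => vectorField η) S) {s t : ℝ} (hs : s ∈ S) (ht : t ∈ S) :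
    firstIntegral η (γ s) = firstIntegral η (γ t) := by
  have hd : ∀ τ ∈ S, HasDerivWithinAt (fun τ => firstIntegral η (γ τ)) 0 S τ := by
    intro τ hτ
    have hγ := h τ hτ
    rw [hasDerivWithinAt_pi] at hγ
    have h0 : HasDerivWithinAt (fun s => γ s 0) (γ τ 1) S τ := hγ 0
    have h1 : HasDerivWithinAt (fun s => γ s 1) (γ τ 2) S τ := hγ 1
    have h2 : HasDerivWithinAt (fun s => γ s 2) (γ τ 3) S τ := hγ 2
    have h3 : HasDerivWithinAt (fun s => γ s 3) (-γ τ 0 + η * γ τ 2 + γ τ 0 ^ 2) S τ := hγ 3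
    have := (((((h0.pow 2).div_const 2).sub ((h0.pow 3).div_const 3)).sub
      ((h1.pow 2).const_mul (η / 2))).add (h1.mul h3)).sub ((h2.pow 2).div_const 2)
    refine this.congr_deriv ?_
    simp
    ring
  have := (hS.convex).norm_image_sub_le_of_norm_hasDerivWithin_le (C := 0) hd (by simp) hs ht
  rw [zero_mul] at this
  exact (sub_eq_zero.1 (norm_le_zero_iff.1 this)).symm

theorem continuous_firstIntegral : Continuous (firstIntegral η) := by
  unfold firstIntegral; fun_prop

theorem firstIntegral_eq_zero_of_localUnstable {x : Phase} (hx : x ∈ localUnstable η δ) :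
    firstIntegral η x = 0 := by
  obtain ⟨γ, hγ, h0, -, hlim⟩ := hx
  have h1 : Tendsto (fun t => firstIntegral η (γ t)) atBot (𝓝 (firstIntegral η 0)) :=
    (continuous_firstIntegral.tendsto 0).comp hlim
  have h2 : Tendsto (fun t => firstIntegral η (γ t)) atBot (𝓝 (firstIntegral η x)) := by
    refine tendsto_const_nhds.congr' ?_
    filter_upwards [eventually_le_atBot 0] with t ht
    rw [← h0]
    exact firstIntegral_eq_of_curve ordConnected_Iic hγ (by simp) ht
  rw [tendsto_nhds_unique h2 h1]
  simp [firstIntegral]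

/-- By uniqueness the curve is part of the backward orbit of its end point, so no smallness
assumption is needed; forward propagation does need one. -/
theorem localUnstable_of_backward {c : ℝ → Phase} {u v : ℝ} (huv : u ≤ v)
    (hc : IsIntegralCurveOn c (fun _ => vectorField η) (Icc u v))
    (hv : c v ∈ localUnstable η δ) : c u ∈ localUnstable η δ := by
  obtain ⟨γ, hγ, h0, hδ, hlim⟩ := hv
  have heq := eqOn_of_vectorField (η := η) (γ₁ := fun t => γ (t + -v)) (γ₂ := c) (s := v)
    ordConnected_Icc (right_mem_Icc.2 huv) (hγ.shift fun t ht => by simpa using ht.2) hc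
    (by simp [h0])
  refine ⟨fun t => γ (t + (u - v)), hγ.shift fun t ht => ?_, ?_, fun t ht => hδ _ ?_, ?_⟩
  · simp only [mem_Iic] at ht ⊢; linarith
  · have := heq (left_mem_Icc.2 huv)
    change γ (0 + (u - v)) = c u
    rw [← this, zero_add, sub_eq_add_neg]
  · linarith
  · exact hlim.comp (tendsto_atBot_add_const_right _ _ tendsto_id)

theorem localUnstable_of_forward {c : ℝ → Phase} {u v : ℝ} (huv : u ≤ v)
    (hc : IsIntegralCurveOn c (fun _ => vectorField η) (Icc u v))
    (hcδ : ∀ t ∈ Icc u v, ‖c t‖ < δ)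
    (hu : c u ∈ localUnstable η δ) : c v ∈ localUnstable η δ := by
  obtain ⟨γ, hγ, h0, hδ, hlim⟩ := hu
  have h1 : IsIntegralCurveOn (fun t => γ (t + (v - u))) (fun _ => vectorField η) (Iic (u - v)) :=
    hγ.shift fun t ht => by simp only [mem_Iic] at ht ⊢; linarith
  have h2 : IsIntegralCurveOn (fun t => c (t + v)) (fun _ => vectorField η) (Icc (u - v) 0) :=
    hc.shift fun t ht => ⟨by linarith [ht.1], by linarith [ht.2]⟩
  have h3 := h1.concat h2 le_rfl Icc_subset_Ici_self (mem_Iic.2 le_rfl)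
    (left_mem_Icc.2 (by linarith)) (by simp [h0])
  rw [Iic_union_Icc_eq_Iic (by linarith)] at h3
  refine ⟨_, h3, ?_, fun t ht => ?_, ?_⟩
  · rcases huv.eq_or_lt with h | h
    · subst h; simp [h0]
    · rw [if_neg (by linarith), zero_add]
  · split_ifs with h
    · exact hδ _ (by linarith)
    · exact hcδ _ ⟨by linarith, by linarith⟩
  · refine (hlim.comp (tendsto_atBot_add_const_right _ (v - u) tendsto_id)).congr' ?_
    filter_upwards [eventually_le_atBot (u - v)] with t ht
    simp [ht]

theorem zero_mem_localUnstable (hδ : 0 < δ) : (0 : Phase) ∈ localUnstable η δ := by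
  refine ⟨fun _ => 0, fun t _ => ?_, rfl, by simpa using fun _ _ => hδ, tendsto_const_nhds⟩
  have : vectorField η 0 = 0 := by ext i; fin_cases i <;> simp [vectorField]
  simp only [this]
  exact hasDerivWithinAt_const _ _ _

theorem mem_domain_iff (hr : 0 < r) (hrR : r < R) {x : Phase} :
    x ∈ domain a b r ↔ x ∈ graphOver a b R ∧ x 0 ^ 2 + x 1 ^ 2 = r ^ 2 := by
  have hdom : domain a b r = sigma a b r '' Ioc 0 (2 * Real.pi) := by
    rw [domain, domainPlus, domainMinus, ← image_union,
      Ioc_union_Ioc_eq_Ioc Real.pi_pos.le (by linarith [Real.pi_pos])]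
  have hrr : r ^ 2 < R ^ 2 := by gcongr
  rw [hdom]
  constructor
  · rintro ⟨θ, -, rfl⟩
    have e : (r * Real.cos θ) ^ 2 + (r * Real.sin θ) ^ 2 = r ^ 2 := by
      linear_combination r ^ 2 * Real.cos_sq_add_sin_sq θ
    exact ⟨⟨by simpa [sigma] using e.trans_lt hrr, rfl, rfl⟩, by simpa [sigma] using e⟩
  · rintro ⟨⟨-, h2, h3⟩, h⟩
    obtain ⟨θ, hθ1, hθ2⟩ : ∃ θ : ℝ, x 0 = r * Real.cos θ ∧ x 1 = r * Real.sin θ := by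
      set z : ℂ := ⟨x 0, x 1⟩
      have hz : ‖z‖ = r := by
        rw [← Real.sqrt_sq hr.le, ← h, Complex.norm_def, Complex.normSq_mk]
        ring_nf
      refine ⟨z.arg, ?_, ?_⟩
      · rw [← hz, Complex.norm_mul_cos_arg]
      · rw [← hz, Complex.norm_mul_sin_arg]
    have hp := toIocMod_mem_Ioc Real.two_pi_pos 0 θ
    rw [zero_add] at hp
    refine ⟨toIocMod Real.two_pi_pos 0 θ, hp, ?_⟩
    have hc : Real.cos (toIocMod Real.two_pi_pos 0 θ) = Real.cos θ := by
      rw [toIocMod, zsmul_eq_mul]; exact Real.cos_sub_int_mul_two_pi θ _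
    have hs : Real.sin (toIocMod Real.two_pi_pos 0 θ) = Real.sin θ := by
      rw [toIocMod, zsmul_eq_mul]; exact Real.sin_sub_int_mul_two_pi θ _
    ext i
    simp only [sigma, hc, hs, ← hθ1, ← hθ2]
    fin_cases i
    exacts [rfl, rfl, h2.symm, h3.symm]

theorem hitImage_union (A B : Set Phase) :
    hitImage η (A ∪ B) = hitImage η A ∪ hitImage η B := by
  ext y
  simp only [hitImage, mem_union, mem_ofPred_eq, or_and_right, exists_or]

theorem SigmaU_eq (k : ℕ) : SigmaU η a b r k = iteratedHit η (domain a b r) k := by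
  induction k with
  | zero => rfl
  | succ k ih =>
    simp only [SigmaU, iteratedHit] at ih ⊢
    rw [← ih, hitImage_union]

/-- Replaces the recursion by a count of zeros of `x₂` along a single curve ending at time `0`. The
interval is open on the left because the starting point on `D` is never counted, even if it lies on
`S`. -/
theorem exists_curve_of_iteratedHit {D : Set Phase} (k : ℕ) : ∀ {y : Phase},
    y ∈ iteratedHit η D k → ∃ t ≥ 0, ∃ c : ℝ → Phase,
      IsIntegralCurveOn c (fun _ => vectorField η) (Icc (-t) 0) ∧ c 0 = y ∧ c (-t) ∈ D ∧
      {s | s ∈ Ioc (-t) 0 ∧ c s 1 = 0}.encard = k := by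
  induction k with
  | zero =>
    intro y hy
    refine ⟨0, le_rfl, fun _ => y, ?_, rfl, hy, by simp⟩
    intro t ht
    have : t = 0 := by simpa using ht
    subst this
    simp [hasDerivWithinAt_iff_hasFDerivWithinAt, HasFDerivWithinAt.of_subsingleton]
  | succ k ih =>
    rintro y ⟨x, hx, τ, hτ, γ, hγ, h0, hτy, hyS, hno⟩
    obtain ⟨t, ht, c, hc, hc0, hcD, hcard⟩ := ih hx
    have h1 : IsIntegralCurveOn (fun s => c (s + τ)) (fun _ => vectorField η)
        (Icc (-(t + τ)) (-τ)) := hc.shift fun s hs => ⟨by linarith [hs.1], by linarith [hs.2]⟩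
    have h2 : IsIntegralCurveOn (fun s => γ (s + τ)) (fun _ => vectorField η)
        (Icc (-τ) 0) := hγ.shift fun s hs => ⟨by linarith [hs.1], by linarith [hs.2]⟩
    have h3 := h1.concat h2 Icc_subset_Iic_self Icc_subset_Ici_self
      (right_mem_Icc.2 (by linarith)) (left_mem_Icc.2 (by linarith)) (by simp [hc0, h0])
    rw [Icc_union_Icc_eq_Icc (by linarith) (by linarith)] at h3
    refine ⟨t + τ, by linarith, _, h3, ?_, ?_, ?_⟩
    · rw [if_neg (by linarith), zero_add, hτy]
    · rw [if_pos (by linarith)]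
      have : -(t + τ) + τ = -t := by ring
      rwa [this]
    · have : {s | s ∈ Ioc (-(t + τ)) 0 ∧ (if s ≤ -τ then c (s + τ) else γ (s + τ)) 1 = 0} =
          insert 0 ((fun s => s - τ) '' {s | s ∈ Ioc (-t) 0 ∧ c s 1 = 0}) := by
        ext s
        simp only [mem_ofPred_eq, mem_insert_iff, mem_image]
        constructor
        · rintro ⟨hs, hs0⟩
          split_ifs at hs0 with h
          · exact Or.inr ⟨s + τ, ⟨⟨by linarith [hs.1], by linarith⟩, hs0⟩, by ring⟩
          · left
            by_contra hne
            have : s < 0 := lt_of_le_of_ne hs.2 hne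
            exact hno (s + τ) ⟨by linarith, by linarith⟩ hs0
        · rintro (rfl | ⟨u, ⟨hu, hu0⟩, rfl⟩)
          · refine ⟨⟨by linarith, le_rfl⟩, ?_⟩
            rw [if_neg (by linarith), zero_add, hτy]; exact hyS
          · refine ⟨⟨by linarith [hu.1], by linarith [hu.2]⟩, ?_⟩
            rw [if_pos (by linarith [hu.2])]
            simpa using hu0
      rw [this, encard_insert_of_notMem (by
        rintro ⟨u, ⟨hu, -⟩, h⟩; simp only at h; linarith [hu.2]),
        (sub_left_injective).encard_image, hcard]
      push_cast; rfl

/-- Converse of the count: the induction cuts the curve at the last zero before time `0`. -/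
theorem iteratedHit_of_curve {D : Set Phase} (k : ℕ) : ∀ {t : ℝ} {c : ℝ → Phase},
    IsIntegralCurveOn c (fun _ => vectorField η) (Icc (-t) 0) → c (-t) ∈ D → c 0 1 = 0 →
    {s | s ∈ Ioc (-t) 0 ∧ c s 1 = 0}.encard = (k + 1 : ℕ) → c 0 ∈ iteratedHit η D (k + 1) := by
  induction k with
  | zero =>
    intro t c hc hD h0 hcard
    rw [zero_add, Nat.cast_one, encard_eq_one] at hcard
    obtain ⟨s₀, hs₀⟩ := hcard
    have hs : s₀ ∈ {s | s ∈ Ioc (-t) 0 ∧ c s 1 = 0} := by rw [hs₀]; rfl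
    have ht : 0 < t := by linarith [hs.1.1, hs.1.2]
    have h00 : (0 : ℝ) ∈ {s | s ∈ Ioc (-t) 0 ∧ c s 1 = 0} := ⟨⟨by linarith, le_rfl⟩, h0⟩
    rw [hs₀] at h00
    refine ⟨c (-t), hD, t, ht, fun s => c (s + -t),
      hc.shift fun s hs => ⟨by linarith [hs.1], by linarith [hs.2]⟩, by simp, by simp, h0,
      fun s hs hsS => ?_⟩
    have : s + -t ∈ {s | s ∈ Ioc (-t) 0 ∧ c s 1 = 0} :=
      ⟨⟨by linarith [hs.1], by linarith [hs.2]⟩, hsS⟩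
    rw [hs₀, ← h00] at this
    have : s + -t = 0 := this
    linarith [hs.2]
  | succ k ih =>
    intro t c hc hD h0 hcard
    set Z := {s | s ∈ Ioc (-t) 0 ∧ c s 1 = 0} with hZ
    have hZfin : Z.Finite := by
      rw [← encard_lt_top_iff, hcard]; exact ENat.natCast_lt_top _
    have ht : 0 < t := by
      have : Z.Nonempty := by rw [← encard_pos, hcard]; simp
      obtain ⟨s, hs⟩ := this
      linarith [hs.1.1, hs.1.2]
    have h0Z : (0 : ℝ) ∈ Z := ⟨⟨by linarith, le_rfl⟩, h0⟩
    have hcard' : (Z \ {0}).encard = (k + 1 : ℕ) := by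
      have := encard_sdiff_singleton_add_one h0Z
      rw [hcard] at this
      push_cast at this
      exact ENat.add_left_injective_of_ne_top ENat.one_ne_top this
    have hne : (Z \ {0}).Nonempty := by rw [← encard_pos, hcard']; simp
    obtain ⟨s, hs⟩ := (hZfin.sdiff (t := {0})).exists_maximal hne
    have hsZ : s ∈ Z := hs.prop.1
    have hs0 : s < 0 := lt_of_le_of_ne hsZ.1.2 hs.prop.2
    have hsmax : ∀ u ∈ Z \ {0}, u ≤ s := fun u hu => by
      rcases le_total u s with h | h
      exacts [h, hs.le_of_ge hu h]
    refine ⟨c s, ?_, -s, by linarith, fun u => c (u + s),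
      hc.shift fun u hu => ⟨by linarith [hu.1, hsZ.1.1], by linarith [hu.2]⟩, by simp,
      by simp, h0, fun u hu huS => ?_⟩
    · have hc' : IsIntegralCurveOn (fun u => c (u + s)) (fun _ => vectorField η)
          (Icc (-(t + s)) 0) :=
        hc.shift fun u hu => ⟨by linarith [hu.1], by linarith [hu.2]⟩
      have := ih hc' (by
        have : -(t + s) + s = -t := by ring
        rwa [this]) (by simpa using hsZ.2) (by
        rw [← hcard', ← Function.Injective.encard_image (f := fun u => u - s) sub_left_injective
          (Z \ {0})]
        congr 1
        ext u
        simp only [mem_image, mem_ofPred_eq]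
        constructor
        · rintro ⟨hu, hu0⟩
          exact ⟨u + s, ⟨⟨⟨by linarith [hu.1], by linarith [hu.2]⟩, hu0⟩, by
            simp only [mem_singleton_iff]; linarith [hu.2]⟩, by ring⟩
        · rintro ⟨w, hw, rfl⟩
          refine ⟨⟨by linarith [hw.1.1.1], by linarith [hsmax w hw]⟩, ?_⟩
          simpa using hw.1.2)
      simpa using this
    · have : u + s ∈ Z \ {0} :=
        ⟨⟨⟨by linarith [hu.1, hsZ.1.1], by linarith [hu.2]⟩, huS⟩, by
          simp only [mem_singleton_iff]; linarith [hu.2]⟩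
      linarith [hsmax _ this, hu.1]

end Bifocal

/-! ### The backward orbit of the tangency point -/

namespace Bifocal

/-- The backward orbit of the tangency point `q`, as an orbit of the truncated flow: it crosses
`D^u` at time `-T` only and has `k` zeros of the second coordinate since then. -/
structure TangencyOrbit (η δ R r M T : ℝ) (a b : ℝ → ℝ → ℝ) (k : ℕ) (q : Phase) : Prop where
  hη : η ∈ Ioo (-2 : ℝ) 2
  hab : IsLocalUnstableGraph η δ R a b
  hr : 0 < r
  hrR : r < R
  q0 : q 0 = 0
  q1 : q 1 = 0
  q2 : q 2 = 0
  q3 : q 3 < 0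
  hT : 0 < T
  bound : ∀ t ≤ 0, |flow η M q t 0| < |M|
  lim : Tendsto (flow η M q) atBot (𝓝 0)
  small : ∀ t ≤ -T, ‖flow η M q t‖ < δ
  mem_domain : flow η M q (-T) ∈ domain a b r
  time_unique : ∀ t ≤ 0, flow η M q t ∈ domain a b r → t = -T
  start_ne : flow η M q (-T) 1 ≠ 0
  encard_zeros : {s | s ∈ Ioc (-T) 0 ∧ flow η M q s 1 = 0}.encard = k
  simple : ∀ s ∈ Ioo (-T) 0, flow η M q s 1 = 0 → flow η M q s 2 ≠ 0

theorem exists_bound_of_tendsto_atBot {γ : ℝ → Phase} (hc : ContinuousOn γ (Iic 0))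
    (hlim : Tendsto γ atBot (𝓝 0)) : ∃ C, ∀ t ≤ 0, ‖γ t‖ ≤ C := by
  have h1 : ∀ᶠ t in atBot, ‖γ t‖ < 1 := by
    have := hlim.norm
    rw [norm_zero] at this
    exact this.eventually_lt_const one_pos
  obtain ⟨N, hN⟩ := eventually_atBot.1 h1
  obtain ⟨C, hC⟩ := (isCompact_Icc (a := N) (b := 0)).exists_bound_of_continuousOn
    (hc.mono Icc_subset_Iic_self)
  refine ⟨max 1 C, fun t ht => ?_⟩
  rcases le_total t N with h | h
  exacts [(hN t h).le.trans (le_max_left _ _), (hC t ⟨h, ht⟩).trans (le_max_right _ _)]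

theorem eq_sigma_of_coord_one_eq_zero {a b : ℝ → ℝ → ℝ} {r R : ℝ} (hr : 0 < r) (hrR : r < R)
    {p : Phase} (hp : p ∈ domain a b r) (h1 : p 1 = 0) :
    p = sigma a b r Real.pi ∨ p = sigma a b r (2 * Real.pi) := by
  obtain ⟨⟨-, h2, h3⟩, h⟩ := (mem_domain_iff hr hrR).1 hp
  have h0 : p 0 ^ 2 = r ^ 2 := by rw [h1] at h; simpa using h
  rw [h1] at h2 h3
  rcases sq_eq_sq_iff_eq_or_eq_neg.1 h0 with h | h
  · right
    ext i
    fin_cases i <;> simp [sigma, ← h, h1, h2, h3]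
  · left
    have h' : -r = p 0 := h.symm
    ext i
    fin_cases i <;> simp [sigma, h', h1, h2, h3]

/-- A repeated value makes the orbit periodic, and a periodic orbit that tends to the origin is the
origin. -/
theorem eq_zero_of_flow_eq {η M t₁ t₂ : ℝ} {q : Phase} (hlim : Tendsto (flow η M q) atBot (𝓝 0))
    (ht : t₁ < t₂) (h : flow η M q t₁ = flow η M q t₂) : flow η M q t₁ = 0 := by
  have hper : ∀ n : ℕ, flow η M q (t₁ + n * (t₁ - t₂)) = flow η M q t₁ := by
    intro n
    induction n with
    | zero => simp
    | succ n ih =>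
      rw [← flow_add, h, flow_add, ← h, ← ih]
      congr 1
      push_cast
      ring
  have h1 : Tendsto (fun n : ℕ => t₁ + (n : ℝ) * (t₁ - t₂)) atTop atBot :=
    tendsto_atBot_add_const_left _ _
      (tendsto_natCast_atTop_atTop.atTop_mul_const_of_neg (by linarith))
  exact tendsto_nhds_unique (tendsto_const_nhds.congr fun n => (hper n).symm) (hlim.comp h1)

/-- The backward orbit of `p` in the local unstable manifold is glued to the orbit from `p` to `q`.
The result is bounded, so it is a flow line for a high enough truncation level. It meets `D^u` once
because it is not periodic. Its zeros of `x₂` strictly between `p` and `q` are simple: `H = 0` with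
`x₂ = x₃ = 0` forces `x₁²(x₁ - 3/2) = 0`, that is, a point of `v₁ ∪ v₂`. -/
theorem exists_tangencyOrbit {η : ℝ} (hη : η ∈ Ioo (-2 : ℝ) 2)
    {δ R r : ℝ} {a b : ℝ → ℝ → ℝ} (hab : IsLocalUnstableGraph η δ R a b)
    (hr : 0 < r) (hrR : r < R) {k : ℕ} (hk : 1 ≤ k) {q : Phase} (h0 : q 0 = 0) (h1 : q 1 = 0)
    (h2 : q 2 = 0) (h3 : q 3 < 0) (hqk : q ∈ SigmaU η a b r k) {p : Phase}
    (hp : domain a b r ∩ {x | SameOrbit η x q} = {p})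
    (hpπ : p ≠ sigma a b r Real.pi) (hp2π : p ≠ sigma a b r (2 * Real.pi))
    (hbetween : ∀ x ∈ crossSection, ∀ s t : ℝ, 0 < s → 0 < t →
      FlowsTo η s p x → FlowsTo η t x q → x ∉ line1 ∪ line2) :
    ∃ M T, TangencyOrbit η δ R r M T a b k q := by
  rw [SigmaU_eq] at hqk
  obtain ⟨T, hT, c, hc, hc0, hcD, hcard⟩ := exists_curve_of_iteratedHit k hqk
  have hT0 : 0 < T := by
    have : {s | s ∈ Ioc (-T) 0 ∧ c s 1 = 0}.Nonempty := by
      rw [← encard_pos, hcard]; exact_mod_cast hk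
    obtain ⟨s, hs, -⟩ := this
    linarith [hs.1, hs.2]
  have hflow_of : ∀ {t : ℝ} {γ : ℝ → Phase}, t ≤ 0 →
      IsIntegralCurveOn γ (fun _ => vectorField η) (Icc t 0) → FlowsTo η (-t) (γ t) (γ 0) := by
    intro t γ ht hγ
    exact ⟨by linarith, fun s => γ (s + t),
      hγ.shift fun s hs => ⟨by linarith [hs.1], by linarith [hs.2]⟩, by simp, by simp⟩
  have hmem_p : ∀ {x : Phase}, x ∈ domain a b r → SameOrbit η x q → x = p := fun hx ho => by
    have : _ ∈ domain a b r ∩ {x | SameOrbit η x q} := ⟨hx, ho⟩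
    rw [hp] at this
    exact this
  have hcp : c (-T) = p := hmem_p hcD ⟨T, Or.inl (by
    have := hflow_of (by linarith) hc
    rwa [hc0, neg_neg] at this)⟩
  have hpD : p ∈ domain a b r := hcp ▸ hcD
  have hpLU : p ∈ localUnstable η δ := by
    have := ((mem_domain_iff hr hrR).1 hpD).1
    rw [← hab.eq_graph] at this
    exact this.1
  obtain ⟨γ, hγ, hγ0, hγδ, hγlim⟩ := hpLU
  have hγ' : IsIntegralCurveOn (fun t => γ (t + T)) (fun _ => vectorField η) (Iic (-T)) :=
    hγ.shift fun t ht => by simp only [mem_Iic] at ht ⊢; linarith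
  have hG := hγ'.concat hc le_rfl Icc_subset_Ici_self (mem_Iic.2 le_rfl)
    (left_mem_Icc.2 (by linarith)) (by simp [hγ0, hcp])
  rw [Iic_union_Icc_eq_Iic (by linarith)] at hG
  set g : ℝ → Phase := fun t => if t ≤ -T then γ (t + T) else c t with hgdef
  have hg1 : ∀ t ≤ -T, g t = γ (t + T) := fun t ht => if_pos ht
  have hg2 : ∀ t ∈ Icc (-T) 0, g t = c t := fun t ht => by
    rcases ht.1.eq_or_lt with h | h
    · rw [← h, hg1 _ le_rfl]; simp [hγ0, hcp]
    · exact if_neg (not_le.2 h)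
  have hg0 : g 0 = q := by rw [hg2 0 ⟨by linarith, le_rfl⟩, hc0]
  have hglim : Tendsto g atBot (𝓝 0) := by
    refine (hγlim.comp (tendsto_atBot_add_const_right _ T tendsto_id)).congr' ?_
    filter_upwards [eventually_le_atBot (-T)] with t ht
    exact (hg1 t ht).symm
  obtain ⟨C, hC⟩ := exists_bound_of_tendsto_atBot hG.continuousOn hglim
  have hC0 : 0 ≤ C := (norm_nonneg _).trans (hC 0 le_rfl)
  have hbd : ∀ t ≤ 0, |g t 0| < |C + 1| := fun t ht => by
    rw [abs_of_pos (by linarith : 0 < C + 1)]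
    have := (norm_le_pi_norm (g t) 0).trans (hC t ht)
    rw [Real.norm_eq_abs] at this
    linarith
  have heq : ∀ t ≤ 0, g t = flow η (C + 1) q t := fun t ht =>
    eqOn_of_modField (η := η) (M := C + 1) ordConnected_Iic (mem_Iic.2 le_rfl)
      (isIntegralCurveOn_modField hG fun t ht => (hbd t ht).le)
      ((isIntegralCurve_flow q).isIntegralCurveOn _) (by rw [hg0, flow_zero]) ht
  have hflowp : flow η (C + 1) q (-T) = p := by
    rw [← heq _ (by linarith), hg2 _ ⟨le_rfl, by linarith⟩, hcp]
  have hlim : Tendsto (flow η (C + 1) q) atBot (𝓝 0) := by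
    refine hglim.congr' ?_
    filter_upwards [eventually_le_atBot 0] with t ht using heq t ht
  have hp0 : p ≠ 0 := by
    rintro rfl
    have := ((mem_domain_iff hr hrR).1 hpD).2
    simp at this
    exact (pow_ne_zero 2 hr.ne') this.symm
  have hcflow : ∀ t ∈ Icc (-T) 0, c t = flow η (C + 1) q t := fun t ht => by
    rw [← hg2 t ht, heq t ht.2]
  refine ⟨C + 1, T, hη, hab, hr, hrR, h0, h1, h2, h3, hT0,
    fun t ht => by rw [← heq t ht]; exact hbd t ht, hlim, fun t ht => ?_, hflowp ▸ hpD,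
    fun t ht hD => ?_, ?_, ?_, fun s hs hs0 hs2 => ?_⟩
  · rw [← heq t (by linarith), hg1 t ht]; exact hγδ _ (by linarith)
  · have ho : SameOrbit η (flow η (C + 1) q t) q := ⟨-t, Or.inl (by
      have := hflow_of ht (hG.mono Icc_subset_Iic_self)
      rwa [hg0, heq t ht] at this)⟩
    have hpt := hmem_p hD ho
    rcases lt_trichotomy t (-T) with h | h | h
    · exact absurd (hpt.symm.trans (eq_zero_of_flow_eq hlim h (hpt.trans hflowp.symm))) hp0
    · exact h
    · exact absurd (hflowp.symm.trans (eq_zero_of_flow_eq hlim h (hflowp.trans hpt.symm))) hp0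
  · rw [hflowp]
    intro h
    rcases eq_sigma_of_coord_one_eq_zero hr hrR hpD h with h | h
    exacts [hpπ h, hp2π h]
  · rw [← hcard]
    congr 1
    ext s
    simp only [mem_ofPred_eq]
    refine and_congr_right fun hs => ?_
    rw [hcflow s ⟨hs.1.le, hs.2⟩]
  · set x := flow η (C + 1) q s with hx
    have hgs : g s = x := heq s hs.2.le
    have f2 : FlowsTo η (-s) x q := by
      have := hflow_of hs.2.le (hG.mono Icc_subset_Iic_self)
      rwa [hg0, hgs] at this
    have f1 : FlowsTo η (s + T) p x := by
      refine ⟨by linarith [hs.1], fun u => g (u + -T),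
        hG.shift fun u hu => by simp only [mem_Iic]; linarith [hu.2, hs.2], ?_, ?_⟩
      · simp [hg1, hγ0]
      · simp [hgs]
    have hH : firstIntegral η x = 0 := by
      have e := firstIntegral_eq_of_curve ordConnected_Iic hG (mem_Iic.2 hs.2.le)
        (mem_Iic.2 (le_refl (0 : ℝ)))
      rw [hgs, hg0] at e
      rw [e]; simp [firstIntegral, h0, h1, h2]
    have hx0 : x 0 = 0 ∨ x 0 = 3 / 2 := by
      rw [firstIntegral, hs0, hs2] at hH
      have : x 0 ^ 2 * (x 0 - 3 / 2) = 0 := by linarith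
      rcases mul_eq_zero.1 this with h | h
      exacts [Or.inl (by simpa using h), Or.inr (by linarith)]
    refine hbetween x hs0 _ _ (by linarith [hs.1]) (by linarith [hs.2]) f1 f2 ?_
    rcases hx0 with h | h
    exacts [Or.inl ⟨hs0, h, hs2⟩, Or.inr ⟨hs0, h, hs2⟩]

end Bifocal

/-! ### Strictly concave functions of time -/

section Concave

variable {f f₁ f₂ : ℝ → ℝ} {e : ℝ}

theorem strictAntiOn_of_hasDerivAt_neg {S : Set ℝ} (hS : Convex ℝ S)
    (h : ∀ t, HasDerivAt f (f₁ t) t) (hneg : ∀ t ∈ S, f₁ t < 0) : StrictAntiOn f S :=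
  strictAntiOn_of_deriv_neg hS (fun t _ => (h t).continuousAt.continuousWithinAt) fun t ht => by
    rw [(h t).deriv]; exact hneg t (interior_subset ht)

theorem strictMonoOn_of_hasDerivAt_pos {S : Set ℝ} (hS : Convex ℝ S)
    (h : ∀ t, HasDerivAt f (f₁ t) t) (hpos : ∀ t ∈ interior S, 0 < f₁ t) : StrictMonoOn f S :=
  strictMonoOn_of_deriv_pos hS (fun t _ => (h t).continuousAt.continuousWithinAt) fun t ht => by
    rw [(h t).deriv]; exact hpos t ht

theorem neg_of_concave_left (he : 0 < e) (h : ∀ t, HasDerivAt f (f₁ t) t)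
    (h₁ : ∀ t, HasDerivAt f₁ (f₂ t) t) (hneg : ∀ t ∈ Icc (-e) e, f₂ t < 0) (h0 : f 0 = 0)
    (h10 : 0 ≤ f₁ 0) : ∀ t ∈ Ico (-e) 0, f t < 0 := by
  have hanti := strictAntiOn_of_hasDerivAt_neg (convex_Icc _ _) h₁ hneg
  have hmono : StrictMonoOn f (Icc (-e) 0) := by
    refine strictMonoOn_of_hasDerivAt_pos (convex_Icc _ _) h fun t ht => ?_
    rw [interior_Icc] at ht
    exact h10.trans_lt (hanti ⟨ht.1.le, by linarith [ht.2]⟩ ⟨by linarith, he.le⟩ ht.2)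
  intro t ht
  rw [← h0]
  exact hmono ⟨ht.1, ht.2.le⟩ ⟨by linarith, le_rfl⟩ ht.2

theorem hasDerivAt_reflect (h : ∀ t, HasDerivAt f (f₁ t) t) (t : ℝ) :
    HasDerivAt (fun t => f (-t)) (-f₁ (-t)) t := by
  have := (h (-t)).scomp t (hasDerivAt_neg t)
  rw [neg_one_smul] at this
  exact this

theorem hasDerivAt_reflect_neg (h : ∀ t, HasDerivAt f₁ (f₂ t) t) (t : ℝ) :
    HasDerivAt (fun t => -f₁ (-t)) (f₂ (-t)) t := by
  have := (hasDerivAt_reflect h t).neg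
  rw [neg_neg] at this
  exact this

theorem neg_of_concave_right (he : 0 < e) (h : ∀ t, HasDerivAt f (f₁ t) t)
    (h₁ : ∀ t, HasDerivAt f₁ (f₂ t) t) (hneg : ∀ t ∈ Icc (-e) e, f₂ t < 0) (h0 : f 0 = 0)
    (h10 : f₁ 0 ≤ 0) : ∀ t ∈ Ioc 0 e, f t < 0 := by
  intro t ht
  have := neg_of_concave_left he (hasDerivAt_reflect h) (hasDerivAt_reflect_neg h₁)
    (fun t ht => hneg _ ⟨by linarith [ht.2], by linarith [ht.1]⟩) (by simpa) (by simpa) (-t)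
    ⟨by linarith [ht.2], by linarith [ht.1]⟩
  simpa using this

theorem exists_pos_right (he : 0 < e) (h : HasDerivAt f (f₁ 0) 0) (h0 : f 0 = 0)
    (h10 : 0 < f₁ 0) : ∃ t ∈ Ioo 0 e, 0 < f t := by
  have h1 := (hasDerivAt_iff_tendsto_slope.1 h).eventually_const_lt h10
  have h2 := h1.filter_mono (nhdsWithin_mono (0 : ℝ) (s := Ioi 0) fun t (ht : 0 < t) => ht.ne')
  obtain ⟨t, ht, hte⟩ := (h2.and (Ioo_mem_nhdsGT he)).exists
  refine ⟨t, hte, ?_⟩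
  rw [slope_def_field, h0, sub_zero, sub_zero] at ht
  exact (div_pos_iff_of_pos_right hte.1).1 ht

/-- To be used with `f = x₂`, `f₁ = x₃`, `f₂ = x₄`. The positive slope at `0` and the negative value
at `e` produce a zero; concavity gives positivity before it, the bound by the tangent line, and a
transverse crossing. -/
theorem exists_zero_of_concave_right (he : 0 < e) (h : ∀ t, HasDerivAt f (f₁ t) t)
    (h₁ : ∀ t, HasDerivAt f₁ (f₂ t) t) (hneg : ∀ t ∈ Icc (-e) e, f₂ t < 0) (h0 : f 0 = 0)
    (h10 : 0 < f₁ 0) (hfe : f e < 0) :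
    ∃ τ ∈ Ioo 0 e, f τ = 0 ∧ (∀ t ∈ Ioo 0 τ, 0 < f t ∧ f t ≤ f₁ 0 * t) ∧ f₁ τ < 0 := by
  have hanti := strictAntiOn_of_hasDerivAt_neg (convex_Icc _ _) h₁ hneg
  have hcont : Continuous f := continuous_iff_continuousAt.2 fun t => (h t).continuousAt
  obtain ⟨t₀, ht₀, hp⟩ := exists_pos_right he (h 0) h0 h10
  obtain ⟨τ, hτ, hτ0⟩ := intermediate_value_Ioo' ht₀.2.le hcont.continuousOn
    (show (0 : ℝ) ∈ Ioo (f e) (f t₀) from ⟨hfe, hp⟩)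
  have hτ' : τ ∈ Ioo 0 e := ⟨ht₀.1.trans hτ.1, hτ.2⟩
  have hconc : StrictConcaveOn ℝ (Icc 0 e) f := by
    refine StrictAntiOn.strictConcaveOn_of_deriv (convex_Icc _ _) hcont.continuousOn ?_
    have : deriv f = f₁ := funext fun t => (h t).deriv
    rw [this]
    exact hanti.mono (interior_subset.trans (Icc_subset_Icc (by linarith) le_rfl))
  refine ⟨τ, hτ', hτ0, fun t ht => ⟨?_, ?_⟩, ?_⟩
  · have ha : 0 < 1 - t / τ := by
      rw [sub_pos, div_lt_one hτ'.1]; exact ht.2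
    have hb : 0 < t / τ := div_pos ht.1 hτ'.1
    have := hconc.2 (x := 0) ⟨le_rfl, he.le⟩ (y := τ) ⟨hτ'.1.le, hτ'.2.le⟩ hτ'.1.ne ha hb (by ring)
    simpa [h0, hτ0, hτ'.1.ne'] using this
  · have := (convex_Icc 0 t).image_sub_le_mul_sub_of_deriv_le (f := f) (C := f₁ 0)
      hcont.continuousOn (fun s _ => (h s).differentiableAt.differentiableWithinAt)
      (fun s hs => by
        rw [interior_Icc] at hs
        rw [(h s).deriv]
        exact (hanti ⟨by linarith, he.le⟩ ⟨by linarith [hs.1], by linarith [hs.2, ht.2, hτ'.2]⟩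
          hs.1).le) 0 ⟨le_rfl, ht.1.le⟩ t ⟨ht.1.le, le_rfl⟩ ht.1.le
    simpa [h0] using this
  · by_contra! hge
    have hmono : StrictMonoOn f (Icc 0 τ) := by
      refine strictMonoOn_of_hasDerivAt_pos (convex_Icc _ _) h fun t ht => ?_
      rw [interior_Icc] at ht
      exact hge.trans_lt (hanti ⟨by linarith [ht.1], by linarith [ht.2, hτ'.2]⟩
        ⟨by linarith [hτ'.1], hτ'.2.le⟩ ht.2)
    have := hmono ⟨le_rfl, hτ'.1.le⟩ ⟨hτ'.1.le, le_rfl⟩ hτ'.1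
    linarith

theorem exists_zero_of_concave_left (he : 0 < e) (h : ∀ t, HasDerivAt f (f₁ t) t)
    (h₁ : ∀ t, HasDerivAt f₁ (f₂ t) t) (hneg : ∀ t ∈ Icc (-e) e, f₂ t < 0) (h0 : f 0 = 0)
    (h10 : f₁ 0 < 0) (hfe : f (-e) < 0) : ∃ τ ∈ Ioo (-e) 0, f τ = 0 := by
  obtain ⟨τ, hτ, hτ0, -⟩ := exists_zero_of_concave_right he (hasDerivAt_reflect h)
    (hasDerivAt_reflect_neg h₁) (fun t ht => hneg _ ⟨by linarith [ht.2], by linarith [ht.1]⟩)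
    (by simpa) (by simpa) hfe
  exact ⟨-τ, ⟨by linarith [hτ.2], by linarith [hτ.1]⟩, hτ0⟩

end Concave

/-! ### How orbits near that of `q` cross `D^u` -/

namespace Bifocal

section FlowNear

variable {η M : ℝ} {q : Phase}

theorem flow_coords (y : Phase) (t : ℝ) :
    HasDerivAt (fun s => flow η M y s 0) (flow η M y t 1) t ∧
    HasDerivAt (fun s => flow η M y s 1) (flow η M y t 2) t ∧
    HasDerivAt (fun s => flow η M y s 2) (flow η M y t 3) t := by
  have h := hasDerivAt_flow (η := η) (M := M) y t
  rw [hasDerivAt_pi] at h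
  exact ⟨h 0, h 1, h 2⟩

theorem eventually_flow_mem {O : Set Phase} (hO : IsOpen O) {K : Set ℝ} (hK : IsCompact K)
    (h : ∀ t ∈ K, flow η M q t ∈ O) : ∀ᶠ y in 𝓝 q, ∀ t ∈ K, flow η M y t ∈ O :=
  hK.eventually_forall_of_forall_eventually fun t ht =>
    continuous_flow.continuousAt (x := (q, t)) (hO.mem_nhds (h t ht))

theorem exists_flow_mem_Icc {O : Set Phase} (hO : IsOpen O) {t₀ : ℝ}
    (h : flow η M q t₀ ∈ O) :
    ∃ ε > 0, ∀ᶠ y in 𝓝 q, ∀ t ∈ Icc (t₀ - ε) (t₀ + ε), flow η M y t ∈ O := by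
  obtain ⟨ε, hε, hb⟩ := Metric.nhds_basis_closedBall.mem_iff.1
    ((continuous_flow_apply (η := η) (M := M) q).continuousAt (x := t₀) (hO.mem_nhds h))
  refine ⟨ε, hε, eventually_flow_mem hO isCompact_Icc fun t ht => hb ?_⟩
  rwa [Real.closedBall_eq_Icc]

theorem eventually_norm_flow_sub_lt (N : ℝ) {ε : ℝ} (hε : 0 < ε) :
    ∀ᶠ y in 𝓝 q, ∀ t ∈ Icc (-N) 0, ‖flow η M y t - flow η M q t‖ < ε := by
  have hc : Continuous fun y : Phase => ‖y - q‖ * Real.exp (modConst η M * N) := by fun_prop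
  have := hc.continuousAt.eventually_lt (x₀ := q) (continuousAt_const (y := ε)) (by simpa)
  filter_upwards [this] with y hy t ht
  refine (norm_flow_sub_flow_le y q t).trans_lt (lt_of_le_of_lt ?_ hy)
  refine mul_le_mul_of_nonneg_left (Real.exp_le_exp.2 (mul_le_mul_of_nonneg_left ?_
    (modConst η M).2)) (norm_nonneg _)
  rw [abs_of_nonpos ht.2]; linarith [ht.1]

end FlowNear

/-- The closed disc of radius `r` lies inside the domain of analyticity, so `a` and `b` are
continuous on it. The graph over the open disc of radius `R` need not be closed. -/
theorem isClosed_graph_le {η δ R r : ℝ} {a b : ℝ → ℝ → ℝ}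
    (hab : IsLocalUnstableGraph η δ R a b) (hr : 0 < r) (hrR : r < R) :
    IsClosed {x : Phase | x ∈ graphOver a b R ∧ x 0 ^ 2 + x 1 ^ 2 ≤ r ^ 2} := by
  have hrr : r ^ 2 < R ^ 2 := by gcongr
  set K : Set Phase := {x | x 0 ^ 2 + x 1 ^ 2 ≤ r ^ 2}
  have hK : IsClosed K := isClosed_le (by fun_prop) continuous_const
  have hproj : Continuous fun x : Phase => (x 0, x 1) := by fun_prop
  have hmap : MapsTo (fun x : Phase => (x 0, x 1)) K {y : ℝ × ℝ | y.1 ^ 2 + y.2 ^ 2 < R ^ 2} :=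
    fun x (hx : _ ≤ _) => lt_of_le_of_lt hx hrr
  have ha : ContinuousOn (fun x : Phase => a (x 0) (x 1)) K :=
    hab.analytic_fst.continuousOn.comp hproj.continuousOn hmap
  have hb : ContinuousOn (fun x : Phase => b (x 0) (x 1)) K :=
    hab.analytic_snd.continuousOn.comp hproj.continuousOn hmap
  have hg : ContinuousOn (fun x : Phase => (x 2 - a (x 0) (x 1), x 3 - b (x 0) (x 1))) K :=
    ((continuous_apply 2).continuousOn.sub ha).prodMk ((continuous_apply 3).continuousOn.sub hb)
  convert hg.preimage_isClosed_of_isClosed hK (isClosed_singleton (x := ((0 : ℝ), (0 : ℝ)))) using 1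
  ext x
  simp only [graphOver, mem_ofPred_eq, mem_inter_iff, mem_preimage, mem_singleton_iff,
    Prod.mk.injEq, sub_eq_zero]
  exact ⟨fun h => ⟨h.2, h.1.2⟩, fun h => ⟨⟨lt_of_le_of_lt h.1 hrr, h.2⟩, h.1⟩⟩

theorem isClosed_domain {η δ R r : ℝ} {a b : ℝ → ℝ → ℝ}
    (hab : IsLocalUnstableGraph η δ R a b) (hr : 0 < r) (hrR : r < R) :
    IsClosed (domain a b r) := by
  have h1 := isClosed_graph_le hab hr hrR
  have h2 : IsClosed {x : Phase | x 0 ^ 2 + x 1 ^ 2 = r ^ 2} :=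
    isClosed_eq (by fun_prop) continuous_const
  convert h1.inter h2 using 1
  ext x
  rw [mem_domain_iff hr hrR]
  exact ⟨fun h => ⟨⟨h.1, h.2.le⟩, h.2⟩, fun h => ⟨h.1.1, h.2⟩⟩

namespace TangencyOrbit

variable {η δ R r M T : ℝ} {a b : ℝ → ℝ → ℝ} {k : ℕ} {q : Phase}

theorem mem_graph_iff (S : TangencyOrbit η δ R r M T a b k q) {x : Phase}
    (hx : x 0 ^ 2 + x 1 ^ 2 < R ^ 2) : x ∈ graphOver a b R ↔ x ∈ localUnstable η δ := by
  rw [← S.hab.eq_graph]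
  exact ⟨fun h => h.1, fun h => ⟨h, hx⟩⟩

theorem isOpen_untruncated : IsOpen {x : Phase | |x 0| < |M|} :=
  isOpen_lt (by fun_prop) continuous_const

theorem eventually_untruncated (S : TangencyOrbit η δ R r M T a b k q) (N : ℝ) :
    ∀ᶠ y in 𝓝 q, ∀ t ∈ Icc (-N) 0, |flow η M y t 0| < |M| :=
  eventually_flow_mem isOpen_untruncated isCompact_Icc fun t ht => S.bound t ht.2

theorem start_mem_graph (S : TangencyOrbit η δ R r M T a b k q) :
    flow η M q (-T) ∈ graphOver a b R :=
  ((mem_domain_iff S.hr S.hrR).1 S.mem_domain).1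

/-- Near the starting point on `D^u`, membership in the local unstable manifold propagates along
orbits. -/
theorem exists_shift (S : TangencyOrbit η δ R r M T a b k q) :
    ∃ ε > 0, ∀ᶠ y in 𝓝 q, ∀ t ∈ Icc (-T - ε) (-T + ε), ∀ t' ∈ Icc (-T - ε) (-T + ε),
      flow η M y t ∈ graphOver a b R → flow η M y t' ∈ graphOver a b R := by
  have hO : IsOpen ({x : Phase | ‖x‖ < δ} ∩ {x | x 0 ^ 2 + x 1 ^ 2 < R ^ 2} ∩
      {x | |x 0| < |M|}) :=
    ((isOpen_lt continuous_norm continuous_const).inter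
      (isOpen_lt (by fun_prop) continuous_const)).inter isOpen_untruncated
  obtain ⟨ε, hε, h⟩ := exists_flow_mem_Icc (η := η) (M := M) (q := q) (t₀ := -T) hO
    ⟨⟨S.small _ le_rfl, S.start_mem_graph.1⟩, S.bound _ (by linarith [S.hT])⟩
  refine ⟨ε, hε, ?_⟩
  filter_upwards [h] with y hy t ht t' ht' hG
  rw [S.mem_graph_iff (hy t ht).1.2] at hG
  rw [S.mem_graph_iff (hy t' ht').1.2]
  rcases le_total t t' with hle | hle
  · exact localUnstable_of_forward hle
      (isIntegralCurveOn_flow fun s hs => (hy s ⟨ht.1.trans hs.1, hs.2.trans ht'.2⟩).2.le)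
      (fun s hs => (hy s ⟨ht.1.trans hs.1, hs.2.trans ht'.2⟩).1.1) hG
  · exact localUnstable_of_backward hle
      (isIntegralCurveOn_flow fun s hs => (hy s ⟨ht'.1.trans hs.1, hs.2.trans ht.2⟩).2.le) hG

theorem mem_domain_of_sq_eq (S : TangencyOrbit η δ R r M T a b k q) {x : Phase}
    (hx : x ∈ localUnstable η δ) (h : x 0 ^ 2 + x 1 ^ 2 = r ^ 2) : x ∈ domain a b r := by
  have hrr : r ^ 2 < R ^ 2 := by
    have := S.hr; have := S.hrR; gcongr
  exact (mem_domain_iff S.hr S.hrR).2 ⟨(S.mem_graph_iff (h.trans_lt hrr)).2 hx, h⟩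

/-- Before crossing `D^u`, the orbit is inside the disc of radius `r`. -/
theorem sq_lt_of_lt (S : TangencyOrbit η δ R r M T a b k q) {t : ℝ} (ht : t < -T) :
    flow η M q t 0 ^ 2 + flow η M q t 1 ^ 2 < r ^ 2 := by
  by_contra! hge
  have hTp := S.hT
  have hf := continuous_flow_apply (η := η) (M := M) q
  have hlim : Tendsto (fun t => flow η M q t 0 ^ 2 + flow η M q t 1 ^ 2) atBot (𝓝 0) := by
    have h0 := (tendsto_pi_nhds.1 S.lim) 0
    have h1 := (tendsto_pi_nhds.1 S.lim) 1
    simpa using (h0.pow 2).add (h1.pow 2)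
  obtain ⟨s, hs, hst⟩ := ((hlim.eventually_lt_const (sq_pos_of_pos S.hr)).and
    (eventually_le_atBot t)).exists
  -- A point on or outside the circle before time `-T` would force a second crossing of `D^u`, since
  -- the orbit starts near the origin and stays in the local unstable manifold until `-T`.
  obtain ⟨u, hu, hu0⟩ := intermediate_value_Icc hst
    (show Continuous fun t => flow η M q t 0 ^ 2 + flow η M q t 1 ^ 2 by fun_prop).continuousOn
    ⟨hs.le, hge⟩
  have hLU : flow η M q u ∈ localUnstable η δ := by
    refine localUnstable_of_backward (v := -T) (by linarith [hu.2])
      (isIntegralCurveOn_flow fun s hs => (S.bound s (by linarith [hs.2])).le) ?_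
    exact (S.mem_graph_iff S.start_mem_graph.1).1 S.start_mem_graph
  have := S.time_unique u (by linarith [hu.2]) (S.mem_domain_of_sq_eq hLU hu0)
  linarith [hu.2]

/-- The point `q` is not on the local unstable manifold. -/
theorem notMem_graph (S : TangencyOrbit η δ R r M T a b k q) : q ∉ graphOver a b R := by
  intro h
  have hR : 0 < R := S.hr.trans S.hrR
  have hδ : 0 < δ := (norm_nonneg _).trans_lt (S.small _ le_rfl)
  -- The origin is the point of the graph over `(0, 0)`, so `b 0 0 = 0`, whereas `q` would give `b 0
  -- 0 = q₄ < 0`.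
  have h0 : (0 : Phase) ∈ graphOver a b R :=
    (S.mem_graph_iff (by simp; positivity)).2 (zero_mem_localUnstable hδ)
  have e1 := h.2.2
  have e2 := h0.2.2
  rw [S.q0, S.q1] at e1
  simp only [Pi.zero_apply] at e2
  have := S.q3
  linarith

/-- Just after crossing `D^u`, the orbit is outside the disc of radius `r`. -/
theorem exists_sq_gt (S : TangencyOrbit η δ R r M T a b k q) {ε : ℝ} (hε : 0 < ε) :
    ∃ t ∈ Ioo (-T) (-T + ε), r ^ 2 < flow η M q t 0 ^ 2 + flow η M q t 1 ^ 2 := by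
  have hTp := S.hT
  have hf := continuous_flow_apply (η := η) (M := M) q
  have hrr : r ^ 2 < R ^ 2 := by
    have := S.hr; have := S.hrR; gcongr
  obtain ⟨ε₂, hε₂, hsh⟩ := S.exists_shift
  set d := min (min ε ε₂) T / 2 with hd
  have hd0 : 0 < d := by positivity
  have hdε : d < ε := by
    have := (min_le_left (min ε ε₂) T).trans (min_le_left _ _); linarith
  have hdε₂ : d < ε₂ := by
    have := (min_le_left (min ε ε₂) T).trans (min_le_right _ _); linarith
  have hdT : d < T := by
    have := min_le_right (min ε ε₂) T; linarith
  refine ⟨-T + d, ⟨by linarith, by linarith⟩, ?_⟩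
  have hG : flow η M q (-T + d) ∈ graphOver a b R :=
    hsh.self_of_nhds (-T) ⟨by linarith, by linarith⟩ _ ⟨by linarith, by linarith⟩
      S.start_mem_graph
  have hne : ∀ t, -T < t → t ≤ 0 → flow η M q t ∈ graphOver a b R →
      flow η M q t 0 ^ 2 + flow η M q t 1 ^ 2 ≠ r ^ 2 := fun t h1 h2 h3 h4 => by
    have := S.time_unique t h2 ((mem_domain_iff S.hr S.hrR).2 ⟨h3, h4⟩)
    linarith
  by_contra! hle
  set A : Set ℝ := {t | flow η M q t ∈ graphOver a b R ∧
    flow η M q t 0 ^ 2 + flow η M q t 1 ^ 2 ≤ r ^ 2}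
  have hA : IsClosed A := (isClosed_graph_le S.hab S.hr S.hrR).preimage hf
  -- Continuation: the orbit cannot meet the circle again while on the graph, so it stays strictly
  -- inside and in the `δ`-ball, and membership extends a little further. Up to time `0` this would
  -- put `q` on the graph.
  have hsub : Icc (-T + d) 0 ⊆ A := by
    refine (hA.inter isClosed_Icc).Icc_subset_of_forall_exists_gt ⟨hG, hle⟩ ?_
    rintro t ⟨⟨htG, htle⟩, ht⟩ u (hu : t < u)
    have hlt := lt_of_le_of_ne htle (hne t (by linarith [ht.1]) ht.2.le htG)
    have hLU := (S.mem_graph_iff htG.1).1 htG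
    have hnorm : ‖flow η M q t‖ < δ := by
      obtain ⟨γ, -, h0, hγ, -⟩ := hLU
      rw [← h0]; exact hγ 0 le_rfl
    have hO : IsOpen ({x : Phase | ‖x‖ < δ} ∩ {x | x 0 ^ 2 + x 1 ^ 2 < r ^ 2}) :=
      (isOpen_lt continuous_norm continuous_const).inter
        (isOpen_lt (by fun_prop) continuous_const)
    obtain ⟨ε₃, hε₃, h3⟩ := exists_flow_mem_Icc (η := η) (M := M) (q := q) (t₀ := t) hO
      ⟨hnorm, hlt⟩
    have h3 := h3.self_of_nhds
    set w := min (t + ε₃) (min u 0)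
    have htw : t < w := lt_min (by linarith) (lt_min hu ht.2)
    have hw1 : w ≤ t + ε₃ := min_le_left _ _
    have hw2 : w ≤ u := (min_le_right _ _).trans (min_le_left _ _)
    have hw3 : w ≤ 0 := (min_le_right _ _).trans (min_le_right _ _)
    have hw := h3 w ⟨by linarith, hw1⟩
    refine ⟨w, ⟨?_, hw.2.le⟩, htw, hw2⟩
    refine (S.mem_graph_iff (hw.2.trans hrr)).2 (localUnstable_of_forward htw.le
      (isIntegralCurveOn_flow fun s hs => (S.bound s (by linarith [hs.2])).le)
      (fun s hs => (h3 s ⟨by linarith [hs.1], by linarith [hs.2]⟩).1) hLU)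
  have := (hsub (right_mem_Icc.2 (by linarith))).1
  rw [flow_zero] at this
  exact S.notMem_graph this

/-- Orbits close to that of `q` in the local unstable manifold cross `D^u`. -/
theorem eventually_cross (S : TangencyOrbit η δ R r M T a b k q) {ε : ℝ} (hε : 0 < ε) :
    ∀ᶠ y in 𝓝 q, flow η M y (-T) ∈ graphOver a b R →
      ∃ t ∈ Ioo (-T - ε) (-T + ε), flow η M y t ∈ domain a b r := by
  obtain ⟨ε₂, hε₂, hsh⟩ := S.exists_shift
  set d := min ε ε₂ / 2
  have hd : 0 < d := by positivity
  have hdε : d < ε := by have := min_le_left ε ε₂; simp only [d]; linarith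
  have hdε₂ : d < ε₂ := by have := min_le_right ε ε₂; simp only [d]; linarith
  have h1 := S.sq_lt_of_lt (show -T - d < -T by linarith)
  obtain ⟨t₂, ht₂, h2⟩ := S.exists_sq_gt hd
  have c1 : Continuous fun y => flow η M y (-T - d) :=
    continuous_flow.comp (continuous_id.prodMk continuous_const)
  have c2 : Continuous fun y => flow η M y t₂ :=
    continuous_flow.comp (continuous_id.prodMk continuous_const)
  have e1 : ∀ᶠ y in 𝓝 q, flow η M y (-T - d) 0 ^ 2 + flow η M y (-T - d) 1 ^ 2 < r ^ 2 :=
    ContinuousAt.eventually_lt (by fun_prop) continuousAt_const h1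
  have e2 : ∀ᶠ y in 𝓝 q, r ^ 2 < flow η M y t₂ 0 ^ 2 + flow η M y t₂ 1 ^ 2 :=
    ContinuousAt.eventually_lt continuousAt_const (by fun_prop) h2
  filter_upwards [hsh, e1, e2] with y hy h1 h2 hG
  have hf := continuous_flow_apply (η := η) (M := M) y
  obtain ⟨t, ht, ht0⟩ := intermediate_value_Icc (show -T - d ≤ t₂ by linarith [ht₂.1])
    (show Continuous fun t => flow η M y t 0 ^ 2 + flow η M y t 1 ^ 2 by fun_prop).continuousOn
    ⟨h1.le, h2.le⟩
  refine ⟨t, ⟨by linarith [ht.1], by linarith [ht.2, ht₂.2]⟩, (mem_domain_iff S.hr S.hrR).2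
    ⟨hy (-T) ⟨by linarith, by linarith⟩ t ⟨by linarith [ht.1], by linarith [ht.2, ht₂.2]⟩ hG, ht0⟩⟩

/-- `D^u` is closed and the orbit of `q` avoids it on the compact set of remaining times; nearby
orbits do the same. -/
theorem eventually_time_near (S : TangencyOrbit η δ R r M T a b k q) (N : ℝ) {ε : ℝ}
    (hε : 0 < ε) : ∀ᶠ y in 𝓝 q, ∀ t ∈ Icc (-N) 0, flow η M y t ∈ domain a b r →
      t ∈ Ioo (-T - ε) (-T + ε) := by
  have := eventually_flow_mem (η := η) (M := M) (q := q)
    (isClosed_domain S.hab S.hr S.hrR).isOpen_compl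
    (isCompact_Icc.diff isOpen_Ioo : IsCompact (Icc (-N) 0 \ Ioo (-T - ε) (-T + ε)))
    (fun t ht hD => ht.2 (by
      rw [S.time_unique t ht.1.2 hD]; exact ⟨by linarith, by linarith⟩))
  filter_upwards [this] with y hy t ht hD
  by_contra hne
  exact hy t ⟨ht, hne⟩ hD

end TangencyOrbit

end Bifocal

/-! ### The set `Σ^u_k` near the tangency -/

namespace Bifocal

namespace TangencyOrbit

variable {η δ R r M T : ℝ} {a b : ℝ → ℝ → ℝ} {k : ℕ} {q : Phase}

theorem flow_coord_one_hasDerivAt (y : Phase) (t : ℝ) :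
    HasDerivAt (fun s => flow η M y s 1) (flow η M y t 2) t := (flow_coords y t).2.1

theorem flow_coord_two_hasDerivAt (y : Phase) (t : ℝ) :
    HasDerivAt (fun s => flow η M y s 2) (flow η M y t 3) t := (flow_coords y t).2.2

/-- Near the tangency the second coordinate is concave in time, with negative values at both ends
of a short time interval. -/
theorem exists_concave (S : TangencyOrbit η δ R r M T a b k q) {e₀ : ℝ} (he₀ : 0 < e₀) :
    ∃ e > 0, e < e₀ ∧ (∀ t ∈ Icc (-e) e, flow η M q t 3 < 0) ∧
      ∀ᶠ y in 𝓝 q, (∀ t ∈ Icc (-e) e, flow η M y t 3 < 0 ∧ |flow η M y t 0| < |M|) ∧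
        flow η M y (-e) 1 < 0 ∧ flow η M y e 1 < 0 := by
  have hO : IsOpen ({x : Phase | x 3 < 0} ∩ {x | |x 0| < |M|}) :=
    (isOpen_lt (by fun_prop) continuous_const).inter isOpen_untruncated
  obtain ⟨ε, hε, h⟩ := exists_flow_mem_Icc (η := η) (M := M) (q := q) (t₀ := 0) hO
    (by rw [flow_zero]; exact ⟨S.q3, by simpa using S.bound 0 le_rfl⟩)
  set e := min ε e₀ / 2
  have he : 0 < e := by positivity
  have heε : e < ε := by have := min_le_left ε e₀; simp only [e]; linarith
  have hee₀ : e < e₀ := by have := min_le_right ε e₀; simp only [e]; linarith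
  have hsub : Icc (-e) e ⊆ Icc (0 - ε) (0 + ε) := Icc_subset_Icc (by linarith) (by linarith)
  have hq3 : ∀ t ∈ Icc (-e) e, flow η M q t 3 < 0 := fun t ht => (h.self_of_nhds t (hsub ht)).1
  have h1 := neg_of_concave_left he (flow_coord_one_hasDerivAt q) (flow_coord_two_hasDerivAt q) hq3
    (by simp [S.q1]) (by simp [S.q2]) (-e) ⟨le_rfl, by linarith⟩
  have h2 := neg_of_concave_right he (flow_coord_one_hasDerivAt q) (flow_coord_two_hasDerivAt q) hq3
    (by simp [S.q1]) (by simp [S.q2]) e ⟨he, le_rfl⟩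
  have hc : ∀ t, Continuous fun y => flow η M y t := fun t =>
    continuous_flow.comp (continuous_id.prodMk continuous_const)
  have c1 := hc (-e)
  have c2 := hc e
  have e1 : ∀ᶠ y in 𝓝 q, flow η M y (-e) 1 < 0 :=
    ContinuousAt.eventually_lt (by fun_prop) continuousAt_const h1
  have e2 : ∀ᶠ y in 𝓝 q, flow η M y e 1 < 0 :=
    ContinuousAt.eventually_lt (by fun_prop) continuousAt_const h2
  refine ⟨e, he, hee₀, hq3, ?_⟩
  filter_upwards [h, e1, e2] with y hy h1 h2
  exact ⟨fun t ht => hy t (hsub ht), h1, h2⟩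

/-- The number of transverse zeros of the second coordinate before the tangency is locally
constant. -/
theorem exists_eventually_encard (S : TangencyOrbit η δ R r M T a b k q) {e : ℝ} (he : 0 < e)
    (heT : e < T) (h3 : ∀ t ∈ Icc (-e) e, flow η M q t 3 < 0) :
    ∃ n : ℕ, k = n + 1 ∧
      ∀ᶠ y in 𝓝 q, {t | t ∈ Icc (-T) (-e) ∧ flow η M y t 1 = 0}.encard = n := by
  have hTp := S.hT
  have hneg := neg_of_concave_left he (flow_coord_one_hasDerivAt q) (flow_coord_two_hasDerivAt q)
    h3 (by simp [S.q1]) (by simp [S.q2])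
  have hset : {s | s ∈ Ioc (-T) 0 ∧ flow η M q s 1 = 0} =
      insert 0 {t | t ∈ Icc (-T) (-e) ∧ flow η M q t 1 = 0} := by
    ext s
    simp only [mem_ofPred_eq, mem_insert_iff]
    constructor
    · rintro ⟨hs, hs0⟩
      by_cases h : s = 0
      · exact Or.inl h
      · refine Or.inr ⟨⟨hs.1.le, ?_⟩, hs0⟩
        by_contra! hlt
        exact (hneg s ⟨hlt.le, lt_of_le_of_ne hs.2 h⟩).ne hs0
    · rintro (rfl | ⟨hs, hs0⟩)
      · exact ⟨⟨by linarith, le_rfl⟩, by simp [S.q1]⟩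
      · refine ⟨⟨lt_of_le_of_ne hs.1 ?_, by linarith [hs.2]⟩, hs0⟩
        rintro rfl
        exact S.start_ne hs0
  have hcard := S.encard_zeros
  rw [hset, encard_insert_of_notMem (by rintro ⟨⟨_, h⟩, _⟩; linarith)] at hcard
  have hfin : {t | t ∈ Icc (-T) (-e) ∧ flow η M q t 1 = 0}.encard ≠ ⊤ := by
    intro h
    rw [h] at hcard
    exact ENat.natCast_ne_top k (by rw [← hcard]; rfl)
  obtain ⟨n, hn⟩ := ENat.ne_top_iff_exists.1 hfin
  refine ⟨n, ?_, ?_⟩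
  · rw [← hn] at hcard; exact_mod_cast hcard.symm
  obtain ⟨ε, hε, H⟩ := exists_forall_C1Close_encard_zeros_eq (g := fun t => flow η M q t 1)
    (g' := fun t => flow η M q t 2) (a := -T) n (b := -e)
    (fun t _ => flow_coord_one_hasDerivAt q t)
    (by have := continuous_flow_apply (η := η) (M := M) q; fun_prop) S.start_ne
    (hneg (-e) ⟨le_rfl, by linarith⟩).ne
    (fun t ht h0 => S.simple t ⟨lt_of_le_of_ne ht.1 (by rintro rfl; exact S.start_ne h0),
      by linarith [ht.2]⟩ h0) hn.symm
  filter_upwards [eventually_norm_flow_sub_lt (η := η) (M := M) (q := q) T hε] with y hy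
  refine H _ (fun t => flow η M y t 2) fun t ht => ⟨flow_coord_one_hasDerivAt y t, ?_, ?_⟩
  · exact (norm_le_pi_norm (flow η M y t - flow η M q t) 1).trans_lt
      (hy t ⟨ht.1, by linarith [ht.2]⟩)
  · exact (norm_le_pi_norm (flow η M y t - flow η M q t) 2).trans_lt
      (hy t ⟨ht.1, by linarith [ht.2]⟩)

/-- The crossing time `s` of `D^u` varies with the orbit. As there is no zero within `ε` of `-T`,
counting from `s` or from `-T` is the same, and only the final window depends on the end point. -/
theorem encard_split {h : ℝ → ℝ} {s T e ε : ℝ} {n : ℕ}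
    (hs : s ∈ Icc (-T - ε) (-T + ε)) (hsT : -T + ε < -e) (he : 0 < e)
    (hne : ∀ t ∈ Icc (-T - ε) (-T + ε), h t ≠ 0)
    (hn : {t | t ∈ Icc (-T) (-e) ∧ h t = 0}.encard = n) :
    {t | t ∈ Ioc s 0 ∧ h t = 0}.encard = n + {t | t ∈ Ioc (-e) 0 ∧ h t = 0}.encard := by
  rw [← hn, ← encard_union_eq]
  · congr 1
    ext t
    simp only [mem_ofPred_eq, mem_union]
    constructor
    · rintro ⟨ht, h0⟩
      rcases le_or_gt t (-e) with hte | hte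
      · refine Or.inl ⟨⟨?_, hte⟩, h0⟩
        by_contra! hlt
        exact hne t ⟨by linarith [hs.1, ht.1], by linarith [hs.1, hs.2]⟩ h0
      · exact Or.inr ⟨⟨hte, ht.2⟩, h0⟩
    · rintro (⟨ht, h0⟩ | ⟨ht, h0⟩)
      · refine ⟨⟨?_, by linarith [ht.2]⟩, h0⟩
        by_contra! hlt
        exact hne t ⟨by linarith [hs.1, hs.2, ht.1], by linarith [hs.2]⟩ h0
      · exact ⟨⟨by linarith [hs.2, ht.1], ht.2⟩, h0⟩
  · rw [Set.disjoint_left]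
    rintro t ⟨ht, _⟩ ⟨ht', _⟩
    linarith [ht.2, ht'.1]

/-- Near the tangency point, the set of `k`-th intersections consists of the points of the
unstable sheet through `q` lying on the section with nonnegative third coordinate. -/
theorem eventually_mem_SigmaU_iff (S : TangencyOrbit η δ R r M T a b k q) :
    ∀ᶠ y in 𝓝 q, y ∈ SigmaU η a b r k ↔
      y 1 = 0 ∧ 0 ≤ y 2 ∧ flow η M y (-T) ∈ graphOver a b R := by
  have hTp := S.hT
  obtain ⟨e, he, heT, hq3, hconc⟩ := S.exists_concave hTp
  obtain ⟨n, rfl, hcount⟩ := S.exists_eventually_encard he heT hq3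
  obtain ⟨ε₁, hε₁, hshift⟩ := S.exists_shift
  obtain ⟨ε₂, hε₂, hne⟩ := exists_flow_mem_Icc (η := η) (M := M) (q := q) (t₀ := -T)
    (O := {x : Phase | x 1 ≠ 0}) (isOpen_ne_fun (by fun_prop) continuous_const) S.start_ne
  -- Around `-T` the sheet is preserved by the flow, `x₂` does not vanish, and the final window
  -- `(-e, 0]` is not reached.
  set ε := min (min ε₁ ε₂) (T - e) / 2 with hε
  have hTe : 0 < T - e := by linarith
  have hε0 : 0 < ε := by positivity
  have hεε₁ : ε < ε₁ := by
    have := (min_le_left (min ε₁ ε₂) (T - e)).trans (min_le_left _ _); linarith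
  have hεε₂ : ε < ε₂ := by
    have := (min_le_left (min ε₁ ε₂) (T - e)).trans (min_le_right _ _); linarith
  have hεT : ε < T - e := by have := min_le_right (min ε₁ ε₂) (T - e); linarith
  have hq0 : flow η M q 0 ≠ 0 := by
    rw [flow_zero]; intro h
    have := S.q3
    rw [h] at this; simp at this
  -- Here `k = n + 1`, so `n + 2` zeros are one too many: a `k`-th intersection near `q` left `D^u`
  -- after time `-N`.
  obtain ⟨N, hN, ε₃, hε₃, hosc⟩ := exists_forall_close_le_encard_zeros
    (g := fun t => flow η M q t 1)
    (exists_lt_coord_one_pos S.hη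
      (isIntegralCurveOn_flow fun t ht => (S.bound t ht).le) S.lim hq0) (n + 2)
  rw [SigmaU_eq]
  filter_upwards [hconc, hcount, hshift, hne, S.eventually_cross hε0,
    S.eventually_time_near N hε0, S.eventually_untruncated N,
    S.eventually_untruncated (T + ε),
    eventually_norm_flow_sub_lt (η := η) (M := M) (q := q) N hε₃]
    with y hconc hcount hshift hne hcross hnear hbN hbT hclose
  have hne' : ∀ t ∈ Icc (-T - ε) (-T + ε), flow η M y t 1 ≠ 0 := fun t ht =>
    hne t ⟨by linarith [ht.1], by linarith [ht.2]⟩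
  have hy3 : ∀ t ∈ Icc (-e) e, flow η M y t 3 < 0 := fun t ht => (hconc.1 t ht).1
  have hd1 := flow_coord_one_hasDerivAt (η := η) (M := M) y
  have hd2 := flow_coord_two_hasDerivAt (η := η) (M := M) y
  constructor
  · intro hy
    have hy1 : y 1 = 0 := by
      obtain ⟨_, _, _, _, _, _, _, _, h, _⟩ := hy
      exact h
    obtain ⟨t, ht, c, hc, hc0, hcD, hcard⟩ := exists_curve_of_iteratedHit _ hy
    have heq : ∀ s ∈ Icc (-(min t N)) 0, c s = flow η M y s := by
      refine eqOn_of_vectorField (η := η) ordConnected_Icc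
        (s := 0) ⟨by have := le_min ht hN.le; linarith, le_rfl⟩ (hc.mono
        (Icc_subset_Icc (by linarith [min_le_left t N]) le_rfl)) (isIntegralCurveOn_flow
        fun s hs => (hbN s ⟨by linarith [min_le_right t N, hs.1], hs.2⟩).le) (by simp [hc0])
    have htN : t < N := by
      by_contra! hle
      have h1 := hosc (fun s => flow η M y s 1)
        (by have := continuous_flow_apply (η := η) (M := M) y; fun_prop)
        (fun s hs => (norm_le_pi_norm (flow η M y s - flow η M q s) 1).trans_lt (hclose s hs))
      have h2 : {s | s ∈ Ioo (-N) 0 ∧ flow η M y s 1 = 0} ⊆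
          {s | s ∈ Ioc (-t) 0 ∧ c s 1 = 0} := by
        rintro s ⟨hs, hs0⟩
        refine ⟨⟨by linarith [hs.1], hs.2.le⟩, ?_⟩
        rw [heq s ⟨by rw [min_eq_right hle]; exact hs.1.le, hs.2.le⟩]
        exact hs0
      have h3 := h1.trans (encard_le_encard h2)
      rw [hcard] at h3
      have : n + 2 ≤ n + 1 := by exact_mod_cast h3
      omega
    rw [min_eq_left htN.le] at heq
    rw [heq (-t) ⟨le_rfl, by linarith⟩] at hcD
    have htT := hnear (-t) ⟨by linarith, by linarith⟩ hcD
    refine ⟨hy1, ?_, hshift (-t) ⟨by linarith [htT.1], by linarith [htT.2]⟩ (-T)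
      ⟨by linarith, by linarith⟩ ((mem_domain_iff S.hr S.hrR).1 hcD).1⟩
    by_contra! hy2
    -- If `x₃ < 0` at time `0`, concavity gives an additional zero inside the window, again one too
    -- many.
    obtain ⟨τ, hτ, hτ0⟩ := exists_zero_of_concave_left he hd1 hd2 hy3 (by simpa) (by simpa)
      hconc.2.1
    have hset : {s | s ∈ Ioc (-t) 0 ∧ c s 1 = 0} =
        {s | s ∈ Ioc (-t) 0 ∧ flow η M y s 1 = 0} := by
      ext s
      simp only [mem_ofPred_eq]
      exact and_congr_right fun hs => by rw [heq s ⟨hs.1.le, hs.2⟩]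
    rw [hset, encard_split (Ioo_subset_Icc_self htT) (by linarith) he hne' hcount] at hcard
    have hpair : ({0, τ} : Set ℝ) ⊆ {s | s ∈ Ioc (-e) 0 ∧ flow η M y s 1 = 0} := by
      rintro s (rfl | rfl)
      · exact ⟨⟨by linarith, le_rfl⟩, by simpa⟩
      · exact ⟨⟨hτ.1, hτ.2.le⟩, hτ0⟩
    have h2 := encard_le_encard hpair
    rw [encard_pair hτ.2.ne'] at h2
    have h3 : ((n + 2 : ℕ) : ℕ∞) ≤ (n + 1 : ℕ) := by
      rw [← hcard]
      push_cast
      gcongr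
    have : n + 2 ≤ n + 1 := by exact_mod_cast h3
    omega
  · rintro ⟨hy1, hy2, hG⟩
    obtain ⟨t, ht, htD⟩ := hcross hG
    have hcurve : IsIntegralCurveOn (flow η M y) (fun _ => vectorField η) (Icc (-(-t)) 0) :=
      isIntegralCurveOn_flow fun s hs => (hbT s ⟨by linarith [hs.1, ht.1], hs.2⟩).le
    have hneg := neg_of_concave_left he hd1 hd2 hy3 (by simpa) (by simpa)
    have hone : {s | s ∈ Ioc (-e) 0 ∧ flow η M y s 1 = 0} = {0} := by
      ext s
      simp only [mem_ofPred_eq, mem_singleton_iff]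
      constructor
      · rintro ⟨hs, hs0⟩
        by_contra h
        exact (hneg s ⟨hs.1.le, lt_of_le_of_ne hs.2 h⟩).ne hs0
      · rintro rfl
        exact ⟨⟨by linarith, le_rfl⟩, by simpa⟩
    have := iteratedHit_of_curve (η := η) (D := domain a b r) n hcurve (by rwa [neg_neg])
      (by simpa) (by
        rw [neg_neg, encard_split (Ioo_subset_Icc_self ht) (by linarith) he hne' hcount, hone,
          encard_singleton]
        push_cast; rfl)
    simpa using this

end TangencyOrbit

end Bifocal

/-! ### The sheet of the unstable manifold through `q` -/

namespace Bifocal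

namespace TangencyOrbit

variable {η δ R r M T : ℝ} {a b : ℝ → ℝ → ℝ} {k : ℕ} {q : Phase}

/-- The forward time-`T` map is inverse to the backward one, so the chain rule supplies a right
inverse of the derivative. -/
theorem exists_surjective_hasStrictFDerivAt (S : TangencyOrbit η δ R r M T a b k q) :
    ∃ B : Phase →L[ℝ] Phase, HasStrictFDerivAt (fun x => flow η M x (-T)) B q ∧
      Function.Surjective B := by
  have hTp := S.hT
  obtain ⟨B, hB⟩ := exists_hasStrictFDerivAt_flow (η := η) (M := M) (q := q) (T := -T)
    (fun t ht => S.bound t (by rw [uIcc_of_ge (by linarith)] at ht; exact ht.2))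
  obtain ⟨B', hB'⟩ := exists_hasStrictFDerivAt_flow (η := η) (M := M) (q := flow η M q (-T))
    (T := T) (fun t ht => by
      rw [uIcc_of_le hTp.le] at ht
      rw [flow_add]; exact S.bound _ (by linarith [ht.2]))
  have hpq : flow η M (flow η M q (-T)) T = q := by rw [flow_add]; simp
  refine ⟨B, hB, fun v => ⟨B' v, ?_⟩⟩
  rw [← hpq] at hB
  have h1 := HasFDerivAt.comp (f := fun x => flow η M x T)
    (g := fun x => flow η M x (-T)) (flow η M q (-T)) hB.hasFDerivAt hB'.hasFDerivAt
  have h2 : ((fun x => flow η M x (-T)) ∘ fun x => flow η M x T) = id := by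
    ext1 x
    simp [flow_add]
  rw [h2] at h1
  exact congrArg (fun L : Phase →L[ℝ] Phase => L v) (h1.unique (hasFDerivAt_id _))

/-- Points near `q` lying on a sheet of the unstable manifold lie on the sheet of the orbit of
`q`. -/
theorem eventually_mem_graph_of_flowsTo (S : TangencyOrbit η δ R r M T a b k q) (T' : ℝ) :
    ∀ᶠ y in 𝓝 q, ∀ x ∈ graphOver a b R, FlowsTo η T' x y →
      flow η M y (-T) ∈ graphOver a b R := by
  have hTp := S.hT
  have h1 : ∀ᶠ y in 𝓝 q, ∀ t ∈ Icc (-T') (-T), flow η M y t ∈ {x : Phase | ‖x‖ < δ} :=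
    eventually_flow_mem (isOpen_lt continuous_norm continuous_const) isCompact_Icc
      fun t ht => S.small t ht.2
  have h2 : ∀ᶠ y in 𝓝 q, ∀ t ∈ ({-T} : Set ℝ),
      flow η M y t ∈ {x : Phase | x 0 ^ 2 + x 1 ^ 2 < R ^ 2} :=
    eventually_flow_mem (isOpen_lt (by fun_prop) continuous_const) isCompact_singleton
      fun t ht => by rw [mem_singleton_iff.1 ht]; exact S.start_mem_graph.1
  filter_upwards [h1, h2, S.eventually_untruncated T', S.eventually_untruncated T]
    with y h1 h2 hb hbT x hx hxy
  obtain ⟨hT', γ, hγ, hγ0, hγT⟩ := hxy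
  have hflow : flow η M y (-T') = x := by
    have := eqOn_of_vectorField (η := η) (γ₁ := fun t => γ (t + T')) (γ₂ := flow η M y)
      (ordConnected_Icc (a := -T') (b := 0)) (s := 0) ⟨by linarith, le_rfl⟩
      (hγ.shift fun t ht => ⟨by linarith [ht.1], by linarith [ht.2]⟩)
      (isIntegralCurveOn_flow fun t ht => (hb t ht).le) (by simp [hγT])
      (show -T' ∈ Icc (-T') 0 from ⟨le_rfl, by linarith⟩)
    rw [← this]; simp [hγ0]
  rw [S.mem_graph_iff hx.1, ← hflow] at hx
  rw [S.mem_graph_iff (h2 _ rfl)]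
  rcases le_total T T' with h | h
  · exact localUnstable_of_forward (by linarith : -T' ≤ -T)
      (isIntegralCurveOn_flow fun t ht => (hb t ⟨ht.1, by linarith [ht.2]⟩).le)
      (fun t ht => h1 t ht) hx
  · exact localUnstable_of_backward (by linarith : -T ≤ -T')
      (isIntegralCurveOn_flow fun t ht => (hbT t ⟨ht.1, by linarith [ht.2]⟩).le) hx

end TangencyOrbit

/-- On the line through `q` in a direction with `v 1 = 0`, `H` vanishes to second order. -/
theorem fderiv_firstIntegral_apply_eq_zero {η : ℝ} {q : Phase} (h0 : q 0 = 0) (h1 : q 1 = 0)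
    (h2 : q 2 = 0) {v : Phase} (hv : v 1 = 0) : fderiv ℝ (firstIntegral η) q v = 0 := by
  have hd : DifferentiableAt ℝ (firstIntegral η) q := by
    unfold firstIntegral; fun_prop
  have hl : HasDerivAt (fun s : ℝ => q + s • v) v 0 := by
    simpa using ((hasDerivAt_id (0 : ℝ)).smul_const v).const_add q
  have hd' : HasFDerivAt (firstIntegral η) (fderiv ℝ (firstIntegral η) q) (q + (0 : ℝ) • v) := by
    simpa using hd.hasFDerivAt
  have h3 := hd'.comp_hasDerivAt (0 : ℝ) hl
  have e : (firstIntegral η ∘ fun s : ℝ => q + s • v) =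
      fun s => s ^ 2 * (v 0 ^ 2 / 2 - s * v 0 ^ 3 / 3 - v 2 ^ 2 / 2) := by
    ext s
    simp [firstIntegral, h0, h1, h2, hv]
    ring
  rw [e] at h3
  have hid := hasDerivAt_id (0 : ℝ)
  have h4 := (hid.pow 2).mul
    ((((hid.mul_const (v 0 ^ 3)).div_const 3).const_sub (v 0 ^ 2 / 2)).sub_const (v 2 ^ 2 / 2))
  have h5 := h3.unique h4
  rw [h5]
  simp

namespace TangencyOrbit

variable {η δ R r M T : ℝ} {a b : ℝ → ℝ → ℝ} {k : ℕ} {q : Phase}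

/-- The sheet of the unstable manifold through a transverse intersection with `v₁` is a graph over
the first and third coordinates. -/
theorem exists_sheet (S : TangencyOrbit η δ R r M T a b k q)
    (htrans : TransverseToLine1 η a b R q) :
    ∃ w : ℝ × ℝ → Phase, w 0 = q ∧
      (∀ᶠ z in 𝓝 (0 : ℝ × ℝ), ContinuousAt w z ∧ w z 0 = z.1 ∧ w z 2 = z.2 ∧
        flow η M (w z) (-T) ∈ graphOver a b R) ∧
      ∀ᶠ y in 𝓝 q, flow η M y (-T) ∈ graphOver a b R → y = w (y 0, y 2) := by
  obtain ⟨B, hB, hBsurj⟩ := S.exists_surjective_hasStrictFDerivAt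
  set p := flow η M q (-T) with hp
  have hpG := S.start_mem_graph
  obtain ⟨La, hLa⟩ : ∃ L, HasStrictFDerivAt (fun y : ℝ × ℝ => a y.1 y.2) L (p 0, p 1) :=
    ⟨_, (S.hab.analytic_fst _ hpG.1).hasStrictFDerivAt⟩
  obtain ⟨Lb, hLb⟩ : ∃ L, HasStrictFDerivAt (fun y : ℝ × ℝ => b y.1 y.2) L (p 0, p 1) :=
    ⟨_, (S.hab.analytic_snd _ hpG.1).hasStrictFDerivAt⟩
  have hBi := hasStrictFDerivAt_pi'.1 hB
  set pr : Phase →L[ℝ] ℝ × ℝ :=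
    ((ContinuousLinearMap.proj (0 : Fin 4)).comp B).prod
      ((ContinuousLinearMap.proj (1 : Fin 4)).comp B)
  have hpr : HasStrictFDerivAt (fun x => (flow η M x (-T) 0, flow η M x (-T) 1)) pr q :=
    (hBi 0).prodMk (hBi 1)
  set D₁ : Phase →L[ℝ] ℝ := (ContinuousLinearMap.proj (2 : Fin 4)).comp B - La.comp pr with hD₁
  set D₂ : Phase →L[ℝ] ℝ := (ContinuousLinearMap.proj (3 : Fin 4)).comp B - Lb.comp pr with hD₂
  let E₁ : Phase → ℝ := fun x => flow η M x (-T) 2 - a (flow η M x (-T) 0) (flow η M x (-T) 1)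
  let E₂ : Phase → ℝ := fun x => flow η M x (-T) 3 - b (flow η M x (-T) 0) (flow η M x (-T) 1)
  have hE₁ : HasStrictFDerivAt E₁ D₁ q := (hBi 2).sub (HasStrictFDerivAt.comp q hLa hpr)
  have hE₂ : HasStrictFDerivAt E₂ D₂ q := (hBi 3).sub (HasStrictFDerivAt.comp q hLb hpr)
  have hE_of : ∀ {x : Phase}, flow η M x (-T) ∈ graphOver a b R → E₁ x = 0 ∧ E₂ x = 0 :=
    fun h => ⟨sub_eq_zero.2 h.2.1, sub_eq_zero.2 h.2.2⟩
  -- tangent vectors of the unstable manifold are in the kernel of the defining equations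
  have hker : Submodule.span ℝ (unstableTangent η a b R q) ≤
      LinearMap.ker D₁.toLinearMap ⊓ LinearMap.ker D₂.toLinearMap := by
    refine Submodule.span_le.2 ?_
    rintro v ⟨T', c, hc0, hcv, hev⟩
    have h1 : ∀ᶠ s in 𝓝 (0 : ℝ), flow η M (c s) (-T) ∈ graphOver a b R := by
      have hcc : Tendsto c (𝓝 0) (𝓝 q) := by rw [← hc0]; exact hcv.continuousAt
      filter_upwards [hcc.eventually (S.eventually_mem_graph_of_flowsTo T'), hev] with s hs hx
      obtain ⟨x, hx, hxs⟩ := hx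
      exact hs x hx hxs
    have key : ∀ {E : Phase → ℝ} {D : Phase →L[ℝ] ℝ}, HasStrictFDerivAt E D q →
        (∀ᶠ s in 𝓝 (0 : ℝ), E (c s) = 0) → D v = 0 := by
      intro E D hE h0
      rw [← hc0] at hE
      have h2 := hE.hasFDerivAt.comp_hasDerivAt (0 : ℝ) hcv
      exact h2.unique ((hasDerivAt_const (0 : ℝ) (0 : ℝ)).congr_of_eventuallyEq h0)
    exact ⟨key hE₁ (h1.mono fun s hs => (hE_of hs).1), key hE₂ (h1.mono fun s hs => (hE_of hs).2)⟩
  -- Transversality writes `v` as a combination of tangent vectors of `W^u` plus a multiple of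
  -- `(0,0,0,1)`; the first summand keeps the first and third coordinates of `v` and is killed by
  -- `D₁` and `D₂`.
  have hdecomp : ∀ v : Phase, v 1 = 0 → ∃ u : Phase, D₁ u = 0 ∧ D₂ u = 0 ∧
      u 0 = v 0 ∧ u 2 = v 2 := by
    intro v hv
    have hmem : v ∈ LinearMap.ker (fderiv ℝ (firstIntegral η) q).toLinearMap :=
      fderiv_firstIntegral_apply_eq_zero S.q0 S.q1 S.q2 hv
    rw [← htrans] at hmem
    obtain ⟨u, hu, z, hz, rfl⟩ := Submodule.mem_sup.1 hmem
    obtain ⟨s, rfl⟩ := Submodule.mem_span_singleton.1 hz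
    have := hker hu
    exact ⟨u, this.1, this.2, by simp, by simp⟩
  obtain ⟨k₁, hk₁a, hk₁b, hk₁0, hk₁2⟩ := hdecomp ![1, 0, 0, 0] rfl
  obtain ⟨k₃, hk₃a, hk₃b, hk₃0, hk₃2⟩ := hdecomp ![0, 0, 1, 0] rfl
  let Λ : Phase →L[ℝ] Phase := ContinuousLinearMap.pi
    ![ContinuousLinearMap.proj 0, ContinuousLinearMap.proj 2, D₁, D₂]
  have hsurj : Function.Surjective Λ := by
    intro z
    -- Zero first two entries remove the `La` and `Lb` terms, so `u` has the prescribed `D₁` and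
    -- `D₂`; adding multiples of `k₁` and `k₃` then corrects `x₁` and `x₃` without disturbing them.
    obtain ⟨u, hu⟩ := hBsurj ![0, 0, z 2, z 3]
    have hpru : pr u = 0 := by
      ext <;> simp [pr, hu]
    have hu1 : D₁ u = z 2 := by simp [hD₁, hpru, hu]
    have hu2 : D₂ u = z 3 := by simp [hD₂, hpru, hu]
    refine ⟨u + (z 0 - u 0) • k₁ + (z 1 - u 2) • k₃, ?_⟩
    have e0 : (u + (z 0 - u 0) • k₁ + (z 1 - u 2) • k₃) 0 = z 0 := by
      simp [hk₁0, hk₃0]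
    have e1 : (u + (z 0 - u 0) • k₁ + (z 1 - u 2) • k₃) 2 = z 1 := by
      simp [hk₁2, hk₃2]
    have e2 : D₁ (u + (z 0 - u 0) • k₁ + (z 1 - u 2) • k₃) = z 2 := by
      rw [map_add, map_add, map_smul, map_smul, hk₁a, hk₃a, hu1]; simp
    have e3 : D₂ (u + (z 0 - u 0) • k₁ + (z 1 - u 2) • k₃) = z 3 := by
      rw [map_add, map_add, map_smul, map_smul, hk₁b, hk₃b, hu2]; simp
    ext i
    fin_cases i
    exacts [e0, e1, e2, e3]
  have hinj : Function.Injective Λ := (LinearMap.injective_iff_surjective (f := Λ.toLinearMap)).2 hsurj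
  let Λe : Phase ≃L[ℝ] Phase := ContinuousLinearEquiv.ofBijective Λ
    (LinearMap.ker_eq_bot.2 hinj) (LinearMap.range_eq_top.2 hsurj)
  -- Straightening chart: two coordinates together with the two equations of the sheet, which
  -- becomes the plane where the last two entries vanish.
  let Θ : Phase → Phase := fun x => ![x 0, x 2, E₁ x, E₂ x]
  have hΘ : HasStrictFDerivAt Θ (Λe : Phase →L[ℝ] Phase) q := by
    rw [hasStrictFDerivAt_pi']
    intro i
    fin_cases i
    · exact (ContinuousLinearMap.proj (R := ℝ) (φ := fun _ : Fin 4 => ℝ) 0).hasStrictFDerivAt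
    · exact (ContinuousLinearMap.proj (R := ℝ) (φ := fun _ : Fin 4 => ℝ) 2).hasStrictFDerivAt
    · exact hE₁
    · exact hE₂
  set Ψ := hΘ.toOpenPartialHomeomorph Θ with hΨ
  have hΨΘ : ∀ x, Ψ x = Θ x := fun x => rfl
  have hqs : q ∈ Ψ.source := hΘ.mem_toOpenPartialHomeomorph_source
  let ι : ℝ × ℝ → Phase := fun z => ![z.1, z.2, 0, 0]
  have hι : Continuous ι := by
    refine continuous_pi fun i => ?_
    fin_cases i
    exacts [continuous_fst, continuous_snd, continuous_const, continuous_const]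
  have hΘq : Θ q = ι 0 := by
    have := hE_of hpG
    ext i
    fin_cases i
    exacts [S.q0, S.q2, this.1, this.2]
  have hιt : ι 0 ∈ Ψ.target := by rw [← hΘq]; exact Ψ.map_source hqs
  have hw0 : Ψ.symm (ι 0) = q := by rw [← hΘq]; exact Ψ.left_inv hqs
  have hcont : ∀ z, ι z ∈ Ψ.target → ContinuousAt (fun z => Ψ.symm (ι z)) z := fun z hz =>
    ContinuousAt.comp (f := ι) (g := Ψ.symm) (Ψ.continuousAt_symm hz) hι.continuousAt
  refine ⟨fun z => Ψ.symm (ι z), hw0, ?_, ?_⟩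
  · have h1 : ∀ᶠ z in 𝓝 (0 : ℝ × ℝ), ι z ∈ Ψ.target :=
      hι.continuousAt.eventually (Ψ.open_target.mem_nhds hιt)
    have h2 : ∀ᶠ y in 𝓝 q, ∀ t ∈ ({-T} : Set ℝ),
        flow η M y t ∈ {x : Phase | x 0 ^ 2 + x 1 ^ 2 < R ^ 2} :=
      eventually_flow_mem (isOpen_lt (by fun_prop) continuous_const) isCompact_singleton
        fun t ht => by rw [mem_singleton_iff.1 ht]; exact hpG.1
    have h3 : Tendsto (fun z => Ψ.symm (ι z)) (𝓝 0) (𝓝 q) := by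
      have := hcont 0 hιt
      rwa [ContinuousAt, hw0] at this
    filter_upwards [h1, h3.eventually h2] with z hz hdisc
    have hright : Θ (Ψ.symm (ι z)) = ι z := Ψ.right_inv hz
    refine ⟨hcont z hz, congrFun hright 0, congrFun hright 1, hdisc _ rfl, ?_, ?_⟩
    · exact sub_eq_zero.1 (congrFun hright 2)
    · exact sub_eq_zero.1 (congrFun hright 3)
  · filter_upwards [Ψ.open_source.mem_nhds hqs] with y hy hG
    have hΘy : Θ y = ι (y 0, y 2) := by
      have := hE_of hG
      ext i
      fin_cases i
      exacts [rfl, rfl, this.1, this.2]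
    change y = Ψ.symm (ι (y 0, y 2))
    rw [← hΘy]
    exact (Ψ.left_inv hy).symm

end TangencyOrbit

end Bifocal

/-! ### The Poincaré map near the tangency -/

namespace Bifocal

variable {η : ℝ}

theorem FirstHit.unique {x y y' : Phase} (h : FirstHit η x y) (h' : FirstHit η x y') : y = y' := by
  obtain ⟨τ, hτ, γ, hγ, hγ0, hγτ, hyS, hno⟩ := h
  obtain ⟨τ', hτ', γ', hγ', hγ'0, hγ'τ, hyS', hno'⟩ := h'
  wlog hle : τ ≤ τ' generalizing y y' τ τ' γ γ'
  · exact (this τ' hτ' γ' hγ' hγ'0 hγ'τ hyS' hno' τ hτ γ hγ hγ0 hγτ hyS hno (not_le.1 hle).le).symm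
  have heq := eqOn_of_vectorField (ordConnected_Icc (a := 0) (b := τ)) ⟨le_rfl, hτ.le⟩ hγ
    (hγ'.mono (Icc_subset_Icc le_rfl hle)) (hγ0.trans hγ'0.symm) ⟨hτ.le, le_rfl⟩
  rcases hle.eq_or_lt with h | h
  · subst h; rw [← hγτ, ← hγ'τ, heq]
  · exact absurd (by rw [← heq, hγτ]; exact hyS) (hno' τ ⟨hτ, h⟩)

/-- Backwards from the common hit, the orbit with the longer time would pass through the other
starting point, a point of `S`, before its own first hit. This makes `Π` injective on the arcs. -/
theorem FirstHit.source_unique {x x' y : Phase} (hx : x 1 = 0) (hx' : x' 1 = 0)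
    (h : FirstHit η x y) (h' : FirstHit η x' y) : x = x' := by
  obtain ⟨τ, hτ, γ, hγ, hγ0, hγτ, -, hno⟩ := h
  obtain ⟨τ', hτ', γ', hγ', hγ'0, hγ'τ, -, hno'⟩ := h'
  wlog hle : τ ≤ τ' generalizing x x' τ τ' γ γ'
  · exact (this hx' hx τ' hτ' γ' hγ' hγ'0 hγ'τ hno' τ hτ γ hγ hγ0 hγτ hno (not_le.1 hle).le).symm
  have heq := eqOn_of_vectorField (η := η) (γ₂ := fun t => γ' (t + (τ' - τ)))
    (ordConnected_Icc (a := 0) (b := τ)) (s := τ) ⟨hτ.le, le_rfl⟩ hγ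
    (hγ'.shift fun t ht => ⟨by linarith [ht.1], by linarith [ht.2]⟩)
    (by simp [hγτ, hγ'τ]) (show (0 : ℝ) ∈ Icc 0 τ from ⟨le_rfl, hτ.le⟩)
  simp only [zero_add, hγ0] at heq
  rcases hle.eq_or_lt with h | h
  · subst h; rw [heq, sub_self, hγ'0]
  · exact absurd (show γ' (τ' - τ) 1 = 0 by rw [← heq]; exact hx)
      (hno' (τ' - τ) ⟨by linarith, by linarith⟩)

theorem hitImage_eq_image {A : Set Phase} {P : Phase → Phase}
    (h : ∀ x ∈ A, FirstHit η x (P x)) : hitImage η A = P '' A := by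
  ext y
  constructor
  · rintro ⟨x, hx, hxy⟩
    exact ⟨x, hx, (h x hx).unique hxy⟩
  · rintro ⟨x, hx, rfl⟩
    exact ⟨x, hx, h x hx⟩

namespace TangencyOrbit

variable {δ R r M T : ℝ} {a b : ℝ → ℝ → ℝ} {k : ℕ} {q : Phase}

/-- The Poincaré map near the tangency point, on the part of the section where `x₃ ≥ 0`. -/
theorem exists_poincare (S : TangencyOrbit η δ R r M T a b k q) :
    ∃ (U : Set Phase) (P : Phase → Phase), U ∈ 𝓝 q ∧ P q = q ∧
      ContinuousOn P {y | y ∈ U ∧ y 1 = 0 ∧ 0 ≤ y 2} ∧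
      ∀ y ∈ U, y 1 = 0 → 0 < y 2 → FirstHit η y (P y) ∧ P y 2 < 0 ∧
        y 0 ≤ P y 0 ∧ P y 0 ≤ y 0 + y 2 / 4 ∧
        firstIntegral η (P y) = firstIntegral η y := by
  obtain ⟨e, he, he2, -, hconc⟩ := S.exists_concave (e₀ := 1 / 2) (by norm_num)
  set U := {y | (∀ t ∈ Icc (-e) e, flow η M y t 3 < 0 ∧ |flow η M y t 0| < |M|) ∧
        flow η M y (-e) 1 < 0 ∧ flow η M y e 1 < 0} with hU
  have hd0 : ∀ (y : Phase) t, HasDerivAt (fun s => flow η M y s 0) (flow η M y t 1) t :=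
    fun y t => (flow_coords y t).1
  have hd1 := flow_coord_one_hasDerivAt (η := η) (M := M)
  have hd2 := flow_coord_two_hasDerivAt (η := η) (M := M)
  have hex : ∀ y : Phase, ∃ τ, y ∈ U → y 1 = 0 → 0 ≤ y 2 → τ ∈ Ico 0 e ∧
      flow η M y τ 1 = 0 ∧ (∀ t ∈ Ioo 0 τ, 0 < flow η M y t 1 ∧ flow η M y t 1 ≤ y 2 * t) ∧
      (∀ t ∈ Ioc τ e, flow η M y t 1 < 0) ∧ (0 < y 2 → 0 < τ ∧ flow η M y τ 2 < 0) := by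
    intro y
    by_cases hy : y ∈ U ∧ y 1 = 0 ∧ 0 ≤ y 2
    · obtain ⟨hyU, hy1, hy2⟩ := hy
      have hy3 : ∀ t ∈ Icc (-e) e, flow η M y t 3 < 0 := fun t ht => (hyU.1 t ht).1
      rcases hy2.eq_or_lt with h | h
      -- At `x₃ = 0` the excursion degenerates; return time `0` is the value that extends `τ`
      -- continuously and fixes `q`.
      · refine ⟨0, fun _ _ _ => ⟨⟨le_rfl, he⟩, by simpa, by simp, ?_, fun h' => by linarith⟩⟩
        exact neg_of_concave_right he (hd1 y) (hd2 y) hy3 (by simpa) (by simp [← h])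
      · obtain ⟨τ, hτ, hτ0, hpos, hτ2⟩ := exists_zero_of_concave_right he (hd1 y) (hd2 y) hy3
          (by simpa) (by simpa) hyU.2.2
        refine ⟨τ, fun _ _ _ => ⟨⟨hτ.1.le, hτ.2⟩, hτ0, by simpa using hpos, fun t ht => ?_,
          fun _ => ⟨hτ.1, hτ2⟩⟩⟩
        have hanti := strictAntiOn_of_hasDerivAt_neg (convex_Icc _ _) (hd2 y) hy3
        have hanti1 : StrictAntiOn (fun t => flow η M y t 1) (Icc τ e) :=
          strictAntiOn_of_hasDerivAt_neg (convex_Icc _ _) (hd1 y) fun s hs =>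
            (hanti.antitoneOn ⟨by linarith [hτ.1], hτ.2.le⟩ ⟨by linarith [hs.1, hτ.1], hs.2⟩
              hs.1).trans_lt hτ2
        have := hanti1 ⟨le_rfl, hτ.2.le⟩ ⟨ht.1.le, ht.2⟩ ht.1
        simp only at this
        linarith
    · exact ⟨0, fun h1 h2 h3 => absurd ⟨h1, h2, h3⟩ hy⟩
  choose τ hτ using hex
  have hcτ : ContinuousOn τ {y | y ∈ U ∧ y 1 = 0 ∧ 0 ≤ y 2} := by
    rintro y₀ ⟨hU₀, h1₀, h2₀⟩
    obtain ⟨hI₀, -, hpos₀, hneg₀, -⟩ := hτ y₀ hU₀ h1₀ h2₀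
    have hc : ∀ t, ContinuousAt (fun y => flow η M y t 1) y₀ := fun t => by
      have : Continuous fun y => flow η M y t :=
        continuous_flow.comp (continuous_id.prodMk continuous_const)
      fun_prop
    -- The signs of `x₂` at a fixed time just before or after `τ y₀` persist for nearby `y`, and
    -- this traps `τ y`.
    rw [ContinuousWithinAt, tendsto_order]
    constructor
    · intro l hl
      rcases lt_or_ge l 0 with hl0 | hl0
      · filter_upwards [self_mem_nhdsWithin] with y hy
        exact hl0.trans_le (hτ y hy.1 hy.2.1 hy.2.2).1.1
      · set m := (l + τ y₀) / 2 with hm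
        have h1 := (hpos₀ m ⟨by linarith, by linarith⟩).1
        filter_upwards [self_mem_nhdsWithin, mem_nhdsWithin_of_mem_nhds
          (continuousAt_const.eventually_lt (hc m) h1)] with y hy hpos
        obtain ⟨hI, h0, hp, hn, -⟩ := hτ y hy.1 hy.2.1 hy.2.2
        by_contra! hle
        exact lt_asymm hpos (hn m ⟨by linarith, by linarith [hI₀.2]⟩)
    · intro u hu
      set m := min ((u + τ y₀) / 2) e with hm
      have hm1 : τ y₀ < m := lt_min (by linarith) hI₀.2
      have hm2 : m < u := lt_of_le_of_lt (min_le_left _ _) (by linarith)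
      have h1 := hneg₀ m ⟨hm1, min_le_right _ _⟩
      filter_upwards [self_mem_nhdsWithin, mem_nhdsWithin_of_mem_nhds
        ((hc m).eventually_lt continuousAt_const h1)] with y hy hneg
      obtain ⟨hI, h0, hp, hn, -⟩ := hτ y hy.1 hy.2.1 hy.2.2
      by_contra! hle
      exact lt_asymm hneg (hp m ⟨by linarith [hI₀.1], by linarith⟩).1
  refine ⟨U, fun y => flow η M y (τ y), hconc, ?_, ?_, ?_⟩
  · have hqU : q ∈ U := hconc.self_of_nhds
    obtain ⟨hI, h0, hp, -, -⟩ := hτ q hqU S.q1 S.q2.ge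
    have hneg := neg_of_concave_right he (hd1 q) (hd2 q) (fun t ht => (hqU.1 t ht).1)
      (by simp [S.q1]) (by simp [S.q2])
    have : τ q = 0 := by
      by_contra hne
      exact (hneg (τ q) ⟨lt_of_le_of_ne hI.1 (Ne.symm hne), hI.2.le⟩).ne h0
    simp [this]
  · exact continuous_flow.comp_continuousOn (continuousOn_id.prodMk hcτ)
  · intro y hyU hy1 hy2
    obtain ⟨hI, h0, hp, -, hlast⟩ := hτ y hyU hy1 hy2.le
    obtain ⟨hτ0, hτ2⟩ := hlast hy2
    have hcurve : IsIntegralCurveOn (flow η M y) (fun _ => vectorField η) (Icc 0 (τ y)) :=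
      isIntegralCurveOn_flow fun t ht => (hyU.1 t ⟨by linarith [ht.1], by linarith [ht.2, hI.2]⟩).2.le
    have hcont : ContinuousOn (fun s => flow η M y s 0) (Icc 0 (τ y)) := fun s _ =>
      (hd0 y s).continuousAt.continuousWithinAt
    have hdiff : DifferentiableOn ℝ (fun s => flow η M y s 0) (interior (Icc 0 (τ y))) :=
      fun s _ => (hd0 y s).differentiableAt.differentiableWithinAt
    have hL : (0 : ℝ) ∈ Icc 0 (τ y) := ⟨le_rfl, hτ0.le⟩
    have hR : τ y ∈ Icc 0 (τ y) := ⟨hτ0.le, le_rfl⟩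
    refine ⟨⟨τ y, hτ0, flow η M y, hcurve, flow_zero y, rfl, h0, fun t ht h => (hp t ht).1.ne' h⟩,
      hτ2, ?_, ?_, ?_⟩
    · have := (convex_Icc 0 (τ y)).mul_sub_le_image_sub_of_le_deriv (C := 0) hcont hdiff
        (fun s hs => by
          rw [interior_Icc] at hs
          rw [(hd0 y s).deriv]
          exact (hp s hs).1.le) 0 hL _ hR hτ0.le
      simp only [flow_zero] at this
      linarith
    -- `x₁' = x₂ ≤ x₃(0) t`, and both `t` and the return time are below `e < 1/2`; hence the factor
    -- `1/4`.
    · have := (convex_Icc 0 (τ y)).image_sub_le_mul_sub_of_deriv_le (C := y 2 / 2) hcont hdiff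
        (fun s hs => by
          rw [interior_Icc] at hs
          rw [(hd0 y s).deriv]
          have := (hp s hs).2
          nlinarith [hs.2, hI.2]) 0 hL _ hR hτ0.le
      simp only [flow_zero] at this
      nlinarith [hI.2]
    · have := firstIntegral_eq_of_curve ordConnected_Icc hcurve hR hL
      rwa [flow_zero] at this

theorem eventually_firstIntegral_eq_zero (S : TangencyOrbit η δ R r M T a b k q) :
    ∀ᶠ y in 𝓝 q, flow η M y (-T) ∈ graphOver a b R → firstIntegral η y = 0 := by
  have hTp := S.hT
  filter_upwards [S.eventually_untruncated T] with y hb hG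
  have h1 := firstIntegral_eq_of_curve (ordConnected_Icc (a := -T) (b := 0))
    (isIntegralCurveOn_flow fun t ht => (hb t ht).le) (s := 0) (t := -T)
    ⟨by linarith, le_rfl⟩ ⟨le_rfl, by linarith⟩
  rw [flow_zero] at h1
  rw [h1]
  exact firstIntegral_eq_zero_of_localUnstable ((S.mem_graph_iff hG.1).1 hG)

end TangencyOrbit

/-! ### The loop curve and the four arcs -/

/-- The curve `x₃ = |x₁| √(1 - 2x₁/3)` in the `(x₁, x₃)`-plane, on the side given by the sign
`σ`. -/
noncomputable def loopArc (σ s : ℝ) : ℝ × ℝ := (σ * s, s * Real.sqrt (1 - 2 / 3 * (σ * s)))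

theorem continuous_loopArc (σ : ℝ) : Continuous (loopArc σ) := by
  unfold loopArc; fun_prop

theorem loopArc_spec {σ s : ℝ} (hσ : σ ^ 2 = 1) (hs0 : 0 ≤ s) (hs1 : s ≤ 1) :
    (loopArc σ s).1 ^ 2 / 2 - (loopArc σ s).1 ^ 3 / 3 - (loopArc σ s).2 ^ 2 / 2 = 0 ∧
    0 ≤ (loopArc σ s).2 ∧ (0 < s → 0 < (loopArc σ s).2) ∧ (loopArc σ s).2 ≤ 2 * s := by
  have hσ1 := (sq_le_one_iff_abs_le_one σ).1 hσ.le
  rw [abs_le] at hσ1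
  have hpos : 0 < 1 - 2 / 3 * (σ * s) := by nlinarith
  have hle : 1 - 2 / 3 * (σ * s) ≤ 4 := by nlinarith
  have hsq := Real.sq_sqrt hpos.le
  have hsqrt := Real.sqrt_pos.2 hpos
  refine ⟨?_, mul_nonneg hs0 hsqrt.le, fun h => mul_pos h hsqrt, ?_⟩
  · simp only [loopArc]
    rw [mul_pow s, hsq]
    linear_combination (s ^ 2 / 2 - σ * s ^ 3 / 3) * hσ
  · simp only [loopArc]
    have : Real.sqrt (1 - 2 / 3 * (σ * s)) ≤ 2 := by
      rw [Real.sqrt_le_left (by norm_num)]; linarith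
    nlinarith

/-- The sign `x₃ ≥ 0` selects the square root, and `s = |x₁|` is the parameter. -/
theorem eq_loopArc {σ x z : ℝ} (hσ : σ ^ 2 = 1) (hx : 0 ≤ σ * x) (hx1 : x ≤ 1) (hz : 0 ≤ z)
    (h : x ^ 2 / 2 - x ^ 3 / 3 - z ^ 2 / 2 = 0) : (x, z) = loopArc σ (σ * x) := by
  have e : σ * (σ * x) = x := by rw [← mul_assoc, ← sq, hσ, one_mul]
  have hpos : 0 ≤ 1 - 2 / 3 * x := by linarith
  simp only [loopArc, e, Prod.mk.injEq, true_and]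
  refine (sq_eq_sq₀ hz (mul_nonneg hx (Real.sqrt_nonneg _))).1 ?_
  rw [mul_pow, Real.sq_sqrt hpos, mul_pow, hσ]
  linarith

namespace TangencyOrbit

variable {δ R r M T : ℝ} {a b : ℝ → ℝ → ℝ} {k : ℕ} {q : Phase}

/-- Near `q`, a point of the zero level set of `H` over the loop lies on the section. -/
theorem eventually_coord_one_eq_zero (S : TangencyOrbit η δ R r M T a b k q) :
    ∀ᶠ y in 𝓝 q, firstIntegral η y = 0 →
      y 0 ^ 2 / 2 - y 0 ^ 3 / 3 - y 2 ^ 2 / 2 = 0 → y 1 = 0 := by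
  have h1 : ∀ᶠ y : Phase in 𝓝 q, y 3 - η / 2 * y 1 < 0 := by
    have hc : Continuous fun y : Phase => y 3 - η / 2 * y 1 := by fun_prop
    refine hc.continuousAt.eventually_lt continuousAt_const ?_
    rw [S.q1]; simpa using S.q3
  filter_upwards [h1] with y h1 hH h
  rw [firstIntegral] at hH
  have : y 1 * (y 3 - η / 2 * y 1) = 0 := by linarith
  exact (mul_eq_zero.1 this).resolve_right h1.ne

theorem exists_arcs (S : TangencyOrbit η δ R r M T a b k q)
    (htrans : TransverseToLine1 η a b R q) :
    ∀ V ∈ 𝓝 q, ∃ U : Set Phase, IsOpen U ∧ q ∈ U ∧ U ⊆ V ∧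
      ∃ A₁ A₂ : Set Phase,
        (SigmaU η a b r k ∩ U) \ {q} = A₁ ∪ A₂ ∧
        A₁ ⊆ region1 η ∧ A₂ ⊆ region2 η ∧
        IsOpenArcFrom q A₁ ∧ IsOpenArcFrom q A₂ ∧
        (∀ x ∈ A₁ ∪ A₂, ∃ y, FirstHit η x y) ∧
        ∃ A₃ A₄ : Set Phase,
          A₃ ⊆ SigmaU η a b r (k + 1) ∩ region3 η ∧
          A₄ ⊆ SigmaU η a b r (k + 1) ∩ region4 η ∧
          A₄ = hitImage η A₁ ∧ A₃ = hitImage η A₂ ∧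
          IsOpenArcFrom q A₃ ∧ IsOpenArcFrom q A₄ := by
  intro V hV
  obtain ⟨w, hw0, hw, hwuniq⟩ := S.exists_sheet htrans
  obtain ⟨N, P, hN, hPq, hPc, hP⟩ := S.exists_poincare
  have hgood : ∀ᶠ y in 𝓝 q, y ∈ V ∧ y ∈ N ∧
      (y ∈ SigmaU η a b r k ↔ y 1 = 0 ∧ 0 ≤ y 2 ∧ flow η M y (-T) ∈ graphOver a b R) ∧
      (flow η M y (-T) ∈ graphOver a b R → firstIntegral η y = 0) ∧
      (firstIntegral η y = 0 → y 0 ^ 2 / 2 - y 0 ^ 3 / 3 - y 2 ^ 2 / 2 = 0 → y 1 = 0) ∧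
      (flow η M y (-T) ∈ graphOver a b R → y = w (y 0, y 2)) := by
    filter_upwards [hV, hN, S.eventually_mem_SigmaU_iff, S.eventually_firstIntegral_eq_zero,
      S.eventually_coord_one_eq_zero, hwuniq] with y h1 h2 h3 h4 h5 h6
    exact ⟨h1, h2, h3, h4, h5, h6⟩
  obtain ⟨V₀, hV₀, hV₀o, hqV₀⟩ := eventually_nhds_iff.1 hgood
  have hwc : Tendsto w (𝓝 0) (𝓝 q) := by
    rw [← hw0]; exact hw.self_of_nhds.1
  have hw' := hw.and (hwc.eventually (hV₀o.mem_nhds hqV₀))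
  have harc0 : ∀ σ, loopArc σ 0 = 0 := fun σ => by simp [loopArc]
  have harc : ∀ σ, ∃ ρ > 0, ∀ s, |s| < ρ → (ContinuousAt w (loopArc σ s) ∧
      w (loopArc σ s) 0 = (loopArc σ s).1 ∧ w (loopArc σ s) 2 = (loopArc σ s).2 ∧
      flow η M (w (loopArc σ s)) (-T) ∈ graphOver a b R) ∧ w (loopArc σ s) ∈ V₀ := by
    intro σ
    have h1 : Tendsto (loopArc σ) (𝓝 0) (𝓝 0) := by
      have := (continuous_loopArc σ).tendsto 0
      rwa [harc0] at this
    obtain ⟨ρ, hρ, h⟩ := Metric.eventually_nhds_iff.1 (h1.eventually hw')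
    exact ⟨ρ, hρ, fun s hs => h (by simpa using hs)⟩
  obtain ⟨ρ₁, hρ₁, harc₁⟩ := harc 1
  obtain ⟨ρ₂, hρ₂, harc₂⟩ := harc (-1)
  set ρ := min 1 (min ρ₁ ρ₂) / 2 with hρdef
  have hρ : 0 < ρ := by positivity
  have hρ1 : ρ < 1 := by have := min_le_left 1 (min ρ₁ ρ₂); linarith
  have hρρ₁ : ρ < ρ₁ := by
    have := (min_le_right 1 (min ρ₁ ρ₂)).trans (min_le_left _ _); linarith
  have hρρ₂ : ρ < ρ₂ := by
    have := (min_le_right 1 (min ρ₁ ρ₂)).trans (min_le_right _ _); linarith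
  -- the properties of the points of the two arcs
  have hpt : ∀ σ, σ = 1 ∨ σ = -1 → ∀ s ∈ Icc 0 ρ, ContinuousAt w (loopArc σ s) ∧
      w (loopArc σ s) ∈ V₀ ∧ w (loopArc σ s) 0 = σ * s ∧ w (loopArc σ s) 1 = 0 ∧
      0 ≤ w (loopArc σ s) 2 ∧ (0 < s → 0 < w (loopArc σ s) 2) ∧ w (loopArc σ s) 2 ≤ 2 * s ∧
      firstIntegral η (w (loopArc σ s)) = 0 ∧
      flow η M (w (loopArc σ s)) (-T) ∈ graphOver a b R := by
    intro σ hσ s hs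
    have hσ2 : σ ^ 2 = 1 := by rcases hσ with rfl | rfl <;> norm_num
    have hs' : |s| = s := abs_of_nonneg hs.1
    obtain ⟨⟨hc, h0, h2, hG⟩, hVs⟩ : (ContinuousAt w (loopArc σ s) ∧
        w (loopArc σ s) 0 = (loopArc σ s).1 ∧ w (loopArc σ s) 2 = (loopArc σ s).2 ∧
        flow η M (w (loopArc σ s)) (-T) ∈ graphOver a b R) ∧ w (loopArc σ s) ∈ V₀ := by
      rcases hσ with rfl | rfl
      · exact harc₁ s (by rw [hs']; linarith [hs.2])
      · exact harc₂ s (by rw [hs']; linarith [hs.2])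
    obtain ⟨e1, e2, e3, e4⟩ := loopArc_spec hσ2 hs.1 (by linarith [hs.2])
    obtain ⟨-, -, -, hH, hS, -⟩ := hV₀ _ hVs
    refine ⟨hc, hVs, h0, hS (hH hG) (by rw [h0, h2]; exact e1), by rwa [h2],
      fun h => by rw [h2]; exact e3 h, by rwa [h2], hH hG, hG⟩
  -- Each arc is the lift of half of the loop curve to the sheet; `x₁ = σρu` makes it injective.
  let g : ℝ → ℝ → Phase := fun σ u => w (loopArc σ (ρ * u))
  have hmem : ∀ u ∈ Icc (0 : ℝ) 1, ρ * u ∈ Icc 0 ρ := fun u hu =>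
    ⟨mul_nonneg hρ.le hu.1, by nlinarith [hu.2]⟩
  have hmemo : ∀ u ∈ Ioo (0 : ℝ) 1, 0 < ρ * u ∧ ρ * u < ρ := fun u hu =>
    ⟨mul_pos hρ hu.1, by nlinarith [hu.2]⟩
  have hg0 : ∀ σ, g σ 0 = q := fun σ => by simp only [g, mul_zero, harc0, hw0]
  have hgc : ∀ σ, σ = 1 ∨ σ = -1 → ContinuousOn (g σ) (Icc 0 1) := fun σ hσ u hu =>
    (ContinuousAt.comp (f := fun u => loopArc σ (ρ * u)) (g := w)
      (hpt σ hσ _ (hmem u hu)).1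
      ((continuous_loopArc σ).comp (by fun_prop)).continuousAt).continuousWithinAt
  have hginj : ∀ σ, σ = 1 ∨ σ = -1 → InjOn (g σ) (Icc 0 1) := by
    intro σ hσ u hu v hv huv
    have h1 := (hpt σ hσ _ (hmem u hu)).2.2.1
    have h2 := (hpt σ hσ _ (hmem v hv)).2.2.1
    have h3 : σ * (ρ * u) = σ * (ρ * v) := by rw [← h1, ← h2]; exact congrFun huv 0
    have hσ0 : σ ≠ 0 := by rcases hσ with rfl | rfl <;> norm_num
    exact mul_left_cancel₀ hρ.ne' (mul_left_cancel₀ hσ0 h3)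
  have hcyl : ∀ σ, σ = 1 ∨ σ = -1 → ∀ u ∈ Ioo (0 : ℝ) 1, g σ u ∈ loopCylinder η ∧
      g σ u 0 = σ * (ρ * u) ∧ 0 < g σ u 2 := fun σ hσ u hu => by
    obtain ⟨-, -, h0, h1, -, h2, -, hH, -⟩ := hpt σ hσ _ (hmem u (Ioo_subset_Icc_self hu))
    exact ⟨⟨h1, hH⟩, h0, h2 (hmemo u hu).1⟩
  have hhit : ∀ σ, σ = 1 ∨ σ = -1 → ∀ u ∈ Ioc (0 : ℝ) 1, FirstHit η (g σ u) (P (g σ u)) ∧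
      P (g σ u) 2 < 0 ∧ g σ u 0 ≤ P (g σ u) 0 ∧ P (g σ u) 0 ≤ g σ u 0 + g σ u 2 / 4 ∧
      firstIntegral η (P (g σ u)) = firstIntegral η (g σ u) := fun σ hσ u hu => by
    obtain ⟨-, hVs, -, h1, -, h2, -⟩ := hpt σ hσ _ (hmem u (Ioc_subset_Icc_self hu))
    exact hP _ (hV₀ _ hVs).2.1 h1 (h2 (mul_pos hρ hu.1))
  have hhitA : ∀ σ, σ = 1 ∨ σ = -1 → ∀ x ∈ g σ '' Ioo 0 1, FirstHit η x (P x) := by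
    rintro σ hσ _ ⟨u, hu, rfl⟩
    exact (hhit σ hσ u (Ioo_subset_Ioc_self hu)).1
  have himg : ∀ σ, σ = 1 ∨ σ = -1 →
      hitImage η (g σ '' Ioo 0 1) = (fun u => P (g σ u)) '' Ioo 0 1 := fun σ hσ => by
    rw [hitImage_eq_image (hhitA σ hσ), image_image]
  have harcP : ∀ σ, σ = 1 ∨ σ = -1 → IsOpenArcFrom q (hitImage η (g σ '' Ioo 0 1)) := by
    intro σ hσ
    refine ⟨fun u => P (g σ u), hPc.comp (hgc σ hσ) fun u hu => ?_, ?_, ?_, himg σ hσ⟩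
    · obtain ⟨-, hVs, -, h1, h2, -⟩ := hpt σ hσ _ (hmem u hu)
      exact ⟨(hV₀ _ hVs).2.1, h1, h2⟩
    -- The point `q` has `x₃ = 0`, whereas every genuine return has `x₃ < 0`.
    · have hne : ∀ u ∈ Ioc (0 : ℝ) 1, P (g σ 0) ≠ P (g σ u) := fun u hu h => by
        have h2 := (hhit σ hσ u hu).2.1
        rw [← h, hg0, hPq, S.q2] at h2
        exact lt_irrefl _ h2
      intro u hu v hv huv
      rcases hu.1.eq_or_lt with rfl | hu0
      · rcases hv.1.eq_or_lt with rfl | hv0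
        · rfl
        · exact absurd huv (hne v ⟨hv0, hv.2⟩)
      · rcases hv.1.eq_or_lt with rfl | hv0
        · exact absurd huv.symm (hne u ⟨hu0, hu.2⟩)
        · refine hginj σ hσ hu hv (FirstHit.source_unique (hpt σ hσ _ (hmem u hu)).2.2.2.1
            (hpt σ hσ _ (hmem v hv)).2.2.2.1 (hhit σ hσ u ⟨hu0, hu.2⟩).1 ?_)
          have huv' : P (g σ u) = P (g σ v) := huv
          rw [huv']
          exact (hhit σ hσ v ⟨hv0, hv.2⟩).1
    · simp only [hg0, hPq]
  have hcylP : ∀ σ, σ = 1 ∨ σ = -1 → ∀ u ∈ Ioo (0 : ℝ) 1, P (g σ u) ∈ loopCylinder η :=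
    fun σ hσ u hu => by
      have h := hhit σ hσ u (Ioo_subset_Ioc_self hu)
      refine ⟨?_, ?_⟩
      · obtain ⟨_, _, _, _, _, _, h, _⟩ := h.1
        exact h
      · change firstIntegral η (P (g σ u)) = 0
        rw [h.2.2.2.2]
        exact (hcyl σ hσ u hu).1.2
  have hsub : ∀ σ, σ = 1 ∨ σ = -1 → g σ '' Ioo 0 1 ⊆ SigmaU η a b r k := by
    rintro σ hσ _ ⟨u, hu, rfl⟩
    obtain ⟨-, hVs, -, h1, h2, -, -, -, hG⟩ := hpt σ hσ _ (hmem u (Ioo_subset_Icc_self hu))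
    exact (hV₀ _ hVs).2.2.1.2 ⟨h1, h2, hG⟩
  have hsubP : ∀ σ, σ = 1 ∨ σ = -1 →
      hitImage η (g σ '' Ioo 0 1) ⊆ SigmaU η a b r (k + 1) := by
    rintro σ hσ y ⟨x, hx, hxy⟩
    rw [SigmaU_eq]
    have := hsub σ hσ hx
    rw [SigmaU_eq] at this
    exact ⟨x, this, hxy⟩
  have hm : (-1 : ℝ) = 1 ∨ (-1 : ℝ) = -1 := Or.inr rfl
  have hp : (1 : ℝ) = 1 ∨ (1 : ℝ) = -1 := Or.inl rfl
  -- `|x₁|` equals `ρu` on the arcs, so the slab cuts them exactly at the excluded end point `u =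
  -- 1`.
  refine ⟨V₀ ∩ {x | |x 0| < ρ}, hV₀o.inter (isOpen_lt (by fun_prop) continuous_const),
    ⟨hqV₀, by simpa [S.q0] using hρ⟩, fun y hy => (hV₀ y hy.1).1,
    g (-1) '' Ioo 0 1, g 1 '' Ioo 0 1, ?_, ?_, ?_, ⟨g (-1), hgc _ hm, hginj _ hm, hg0 _, rfl⟩,
    ⟨g 1, hgc _ hp, hginj _ hp, hg0 _, rfl⟩, ?_, hitImage η (g 1 '' Ioo 0 1),
    hitImage η (g (-1) '' Ioo 0 1), ?_, ?_, rfl, rfl, harcP 1 hp, harcP (-1) hm⟩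
  · apply Subset.antisymm
    · rintro y ⟨⟨hyS, hyV, hyρ⟩, hyq⟩
      have hyρ' := abs_lt.1 (show |y 0| < ρ from hyρ)
      obtain ⟨-, -, hiff, hH, -, hu⟩ := hV₀ y hyV
      obtain ⟨hy1, hy2, hG⟩ := hiff.1 hyS
      have hyw := hu hG
      have hloop : y 0 ^ 2 / 2 - y 0 ^ 3 / 3 - y 2 ^ 2 / 2 = 0 := by
        have := hH hG
        rw [firstIntegral, hy1] at this
        linarith
      -- On the loop curve `x₁ = 0` forces `x₃ = 0`, and `q` is the only point of the sheet over the
      -- origin.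
      have hy0 : y 0 ≠ 0 := fun h => by
        rw [h] at hloop
        have h2 : y 2 = 0 := by nlinarith
        rw [h, h2] at hyw
        exact hyq (hyw.trans hw0)
      rcases lt_or_gt_of_ne hy0 with h | h
      · left
        have hl := eq_loopArc (σ := -1) (by norm_num) (by linarith) (by linarith) hy2 hloop
        refine ⟨-1 * y 0 / ρ, ⟨div_pos (by linarith) hρ, by rw [div_lt_one hρ]; linarith [hyρ'.1]⟩,
          ?_⟩
        simp only [g]
        rw [mul_div_cancel₀ _ hρ.ne', ← hl, ← hyw]
      · right
        have hl := eq_loopArc (σ := 1) (by norm_num) (by linarith) (by linarith) hy2 hloop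
        refine ⟨1 * y 0 / ρ, ⟨div_pos (by linarith) hρ, by rw [div_lt_one hρ]; linarith [hyρ'.2]⟩,
          ?_⟩
        simp only [g]
        rw [mul_div_cancel₀ _ hρ.ne', ← hl, ← hyw]
    · have key : ∀ σ, σ = 1 ∨ σ = -1 →
          g σ '' Ioo 0 1 ⊆ (SigmaU η a b r k ∩ (V₀ ∩ {x | |x 0| < ρ})) \ {q} := by
        rintro σ hσ _ ⟨u, hu, rfl⟩
        obtain ⟨-, hVs, h0, -⟩ := hpt σ hσ _ (hmem u (Ioo_subset_Icc_self hu))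
        have hσ1 : |σ| = 1 := by rcases hσ with rfl | rfl <;> simp
        have habs : |g σ u 0| = ρ * u := by
          rw [(hcyl σ hσ u hu).2.1, abs_mul, hσ1, one_mul, abs_of_pos (hmemo u hu).1]
        refine ⟨⟨hsub σ hσ ⟨u, hu, rfl⟩, hVs, ?_⟩, fun h => ?_⟩
        · change |g σ u 0| < ρ
          rw [habs]; exact (hmemo u hu).2
        · rw [mem_singleton_iff.1 h, S.q0, abs_zero] at habs
          linarith [(hmemo u hu).1]
      exact union_subset (key _ hm) (key _ hp)
  · rintro _ ⟨u, hu, rfl⟩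
    obtain ⟨h1, h2, h3⟩ := hcyl _ hm u hu
    exact ⟨h1, by rw [h2]; linarith [(hmemo u hu).1], h3⟩
  · rintro _ ⟨u, hu, rfl⟩
    obtain ⟨h1, h2, h3⟩ := hcyl _ hp u hu
    exact ⟨h1, by rw [h2]; linarith [(hmemo u hu).1], h3⟩
  · rintro x (hx | hx)
    exacts [⟨_, hhitA _ hm x hx⟩, ⟨_, hhitA _ hp x hx⟩]
  · intro y hy
    refine ⟨hsubP _ hp hy, ?_⟩
    rw [himg _ hp] at hy
    obtain ⟨u, hu, rfl⟩ := hy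
    obtain ⟨-, h2, h3, -⟩ := hhit _ hp u (Ioo_subset_Ioc_self hu)
    have h0 := (hcyl _ hp u hu).2.1
    exact ⟨hcylP _ hp u hu, by linarith [(hmemo u hu).1], h2⟩
  · intro y hy
    refine ⟨hsubP _ hm hy, ?_⟩
    rw [himg _ hm] at hy
    obtain ⟨u, hu, rfl⟩ := hy
    obtain ⟨-, h2, -, h4, -⟩ := hhit _ hm u (Ioo_subset_Ioc_self hu)
    have h0 := (hcyl _ hm u hu).2.1
    -- With `s = ρu`, the start has `x₁ = -s` and `x₃ ≤ 2s`, so `x₁` grows by at most `s/2` and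
    -- stays negative.
    have h5 : g (-1) u 2 ≤ 2 * (ρ * u) := (hpt _ hm _ (hmem u (Ioo_subset_Icc_self hu))).2.2.2.2.2.2.1
    exact ⟨hcylP _ hm u hu, by linarith [(hmemo u hu).1], h2⟩

end TangencyOrbit

end Bifocal

theorem mainTheorem4 (η : ℝ) (hη : η ∈ Set.Ioo (-2 : ℝ) 2)
    -- the local unstable manifold as a graph, and the closed curve `D^u` of radius `r`
    (δ R r : ℝ) (a b : ℝ → ℝ → ℝ) (hab : Bifocal.IsLocalUnstableGraph η δ R a b)
    (hr : 0 < r) (hrR : r < R)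
    -- the point `q = (0,0,0,q₄) ∈ Σ^u_k ∩ v₁`
    (k : ℕ) (hk : 1 ≤ k) (q₄ : ℝ) (hq₄ : q₄ < 0) (q : Bifocal.Phase) (hq : q = ![0, 0, 0, q₄])
    (hqk : q ∈ Bifocal.SigmaU η a b r k ∩ Bifocal.line1)
    (htrans : Bifocal.TransverseToLine1 η a b R q)
    -- the orbit of `q` crosses `D^u` once and only once, at a point other than `σ(π)`, `σ(2π)`
    (p : Bifocal.Phase)
    (hp : Bifocal.domain a b r ∩ {x | Bifocal.SameOrbit η x q} = {p})
    (hpπ : p ≠ Bifocal.sigma a b r Real.pi) (hp2π : p ≠ Bifocal.sigma a b r (2 * Real.pi))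
    -- between `p` and `q`, the orbit is nowhere tangent to `S`
    (hbetween : ∀ x ∈ Bifocal.crossSection, ∀ s t : ℝ, 0 < s → 0 < t →
      Bifocal.FlowsTo η s p x → Bifocal.FlowsTo η t x q →
      x ∉ Bifocal.line1 ∪ Bifocal.line2) :
    ∀ V ∈ nhds q, ∃ U : Set Bifocal.Phase, IsOpen U ∧ q ∈ U ∧ U ⊆ V ∧
      ∃ A₁ A₂ : Set Bifocal.Phase,
        (Bifocal.SigmaU η a b r k ∩ U) \ {q} = A₁ ∪ A₂ ∧
        A₁ ⊆ Bifocal.region1 η ∧ A₂ ⊆ Bifocal.region2 η ∧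
        Bifocal.IsOpenArcFrom q A₁ ∧ Bifocal.IsOpenArcFrom q A₂ ∧
        -- the Poincaré map is defined on both arcs
        (∀ x ∈ A₁ ∪ A₂, ∃ y, Bifocal.FirstHit η x y) ∧
        ∃ A₃ A₄ : Set Bifocal.Phase,
          A₃ ⊆ Bifocal.SigmaU η a b r (k + 1) ∩ Bifocal.region3 η ∧
          A₄ ⊆ Bifocal.SigmaU η a b r (k + 1) ∩ Bifocal.region4 η ∧
          A₄ = Bifocal.hitImage η A₁ ∧ A₃ = Bifocal.hitImage η A₂ ∧
          Bifocal.IsOpenArcFrom q A₃ ∧ Bifocal.IsOpenArcFrom q A₄ := by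
  subst hq
  obtain ⟨M, T, S⟩ := Bifocal.exists_tangencyOrbit hη hab hr hrR hk (q := ![0, 0, 0, q₄]) rfl rfl
    rfl hq₄ hqk.1 hp hpπ hp2π hbetween
  exact S.exists_arcs htrans
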